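/- Consider the two-dimensional shallow water equations over a bottom $H(x,y)$ in mass Lagrangian coordinates $(t,a,b)$, for $x(t,a,b),y(t,a,b)$ with $J=x_ay_b-x_by_a\neq0$: $$x_{tt}+2J^{-3}\bigl(x_ay_ay_{bb}-(y_bx_a+x_by_a)y_{ab}+x_by_{aa}y_b-x_{aa}y_b^2+2x_{ab}y_ay_b-x_{bb}y_a^2\bigr)=H_x,$$ $$y_{tt}+2J^{-3}\bigl(x_by_bx_{aa}-(x_ay_b+x_by_a)x_{ab}+x_ay_ax_{bb}-x_b^2y_{aa}+2x_ax_by_{ab}-x_a^2y_{bb}\bigr)=H_y.$$ A vector field $X=\zeta\partial_t+\zeta^a\partial_a+\zeta^b\partial_b+\zeta^x\partial_x+\zeta^y\partial_y$ with $C^\infty$ coefficients on a convex open set $\Omega$ of $(t,a,b,x,y)$-space is admitted over $H$ if its second prolongation annihilates both equations at every second jet over $\Omega$ with $J\ne0$ that satisfies them. The equivalence group is the group of transformations of $(t,a,b,x,y,H)$ generated by the one-parameter groups (complete flows) of $$\partial_x,\quad \partial_y,\quad y\partial_x-x\partial_y,\quad \psi_b\partial_a-\psi_a\partial_b\ (\psi=\psi(a,b)\text{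 smooth}),\quad \partial_t,\quad 2a\partial_a+t\partial_t+x\partial_x+y\partial_y,\quad \partial_H,\quad 2t\partial_t+x\partial_x+y\partial_y-2H\partial_H$$ and by the involutions $t\to-t$ and $(x,y)\to(-x,-y)$. Then the following hold for every convex open $\Omega$. (1) Let $H$ be smooth on the projection of $\Omega$ to the $(x,y)$-plane. Then $X$ is admitted over $H$ on $\Omega$ if and only if there are constants $k_1,k_4$ and smooth functions $\zeta(t),\zeta_1(t),\zeta_2(t),g(t),\psi(a,b)$ (on the corresponding projections of $\Omega$) such that on $\Omega$ the $\partial_t$-coefficient is $\zeta(t)$, $$\zeta^a=-\psi_b+4k_1a,\quad \zeta^b=\psi_a,\quad \zeta^x=\tfrac12\zeta'x+k_1x+k_4y+\zeta_1,\quad \zeta^y=\tfrac12\zeta'y+k_1y-k_4x+\zeta_2,$$ and the classifying equation $$(\alpha x+\beta y+\gamma_1)H_x+(-\beta x+\alpha y+\gamma_2)H_y=2\gamma H+q(x^2+y^2)+q_1x+q_2y+q_0$$ holds on $\Omega$, where $\alpha=\zeta'+2k_1$, $\beta=2k_4$, $\gamma=2k_1-\zeta'$, $q=\tfrac12\zeta'''$,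 $\gamma_i=2\zeta_i$, $q_i=2\zeta_i''$ $(i=1,2)$, $q_0=g$. (2) The kernel: $X$ is admitted on $\Omega$ over every smooth $H:\mathbb R^2\to\mathbb R$ if and only if on $\Omega$ it equals $c\,\partial_t+\psi_b\partial_a-\psi_a\partial_b$ for some constant $c$ and some smooth $\psi(a,b)$. (3) For every quadratic bottom $H=px^2+2cxy+by^2+q_1x+q_2y+q_0$ whose quadratic part is not a multiple of $x^2+y^2$ (in particular for $H=\lambda_1x^2+\lambda_2y^2+q_1x+q_2y+q_0$ with $\lambda_1\ne\lambda_2$) there is an element of the equivalence group which carries $H$ to one of the two bottoms below and, on every open set, the vector fields admitted over $H$ to the vector fields admitted over that bottom. (4) $H=\lambda_1x^2+\lambda_2y^2$ with $\lambda_1\lambda_2(\lambda_1-\lambda_2)\neq0$: the vector fields admitted on $\Omega$ are exactly the sums of an element of the kernel, a constant multiple of $x\partial_x+y\partial_y+4a\partial_a$, and $\zeta_1(t)\partial_x+\zeta_2(t)\partial_y$, where $\zeta_1''=2\lambda_1\zeta_1$ and $\zeta_2''=2\lambda_2\zeta_2$ on $\mathbb R$. (5) $H=\lambda_1x^2+q_2y$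 with $\lambda_1\neq0$: the vector fields admitted on $\Omega$ are exactly the sums of an element of the kernel, a linear combination with constant coefficients of $$4x\partial_x+16a\partial_a+2(2y-q_2t^2)\partial_y,\qquad t\partial_y,\qquad \partial_y,$$ and $\zeta_1(t)\partial_x$, where $\zeta_1''=2\lambda_1\zeta_1$ on $\mathbb R$. -/

import Mathlib

open scoped ContDiff

namespace ShallowWater

/-- The space of the variables `((t, a, b), (x, y))`: time and mass Lagrangian labels are the
independent variables, the particle position is the dependent one. -/
abbrev Base : Type := (Fin 3 → ℝ) × (Fin 2 → ℝ)

/-- First jets: a base point and the first derivatives `w.2 k i = ∂u^k/∂s^i`, where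
`s = (t, a, b)` and `u = (x, y)`. -/
abbrev Jet1 : Type := Base × (Fin 2 → Fin 3 → ℝ)

/-- Second jets: a first jet and the second derivatives `z.2 k i j = ∂²u^k/∂s^i∂s^j`
(only the symmetric ones are jets of functions). -/
abbrev Jet2 : Type := Jet1 × (Fin 2 → Fin 3 → Fin 3 → ℝ)

/-- A vector field `ζ ∂_t + ζ^a ∂_a + ζ^b ∂_b + ζ^x ∂_x + ζ^y ∂_y`, given by its components
`((ζ, ζ^a, ζ^b), (ζ^x, ζ^y))`, functions of `(t, a, b, x, y)`. -/
abbrev VField : Type := Base → Base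

/-- Partial derivative in the first variable. -/
noncomputable def pd₁ (f : ℝ × ℝ → ℝ) (q : ℝ × ℝ) : ℝ := fderiv ℝ f q (1, 0)

/-- Partial derivative in the second variable. -/
noncomputable def pd₂ (f : ℝ × ℝ → ℝ) (q : ℝ × ℝ) : ℝ := fderiv ℝ f q (0, 1)

/-! ### The equations -/

/-- `J = x_a y_b - x_b y_a`. -/
def jacobian (w : Jet1) : ℝ := w.2 0 1 * w.2 1 2 - w.2 0 2 * w.2 1 1

/-- The left-hand sides minus the right-hand sides of the two shallow water equations over the
bottom `H`, in mass Lagrangian coordinates, as functions on the second jets. -/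
noncomputable def equations (H : ℝ × ℝ → ℝ) (k : Fin 2) (z : Jet2) : ℝ :=
  let x := z.1.1.2 0
  let y := z.1.1.2 1
  let xa := z.1.2 0 1
  let xb := z.1.2 0 2
  let ya := z.1.2 1 1
  let yb := z.1.2 1 2
  let xtt := z.2 0 0 0
  let xaa := z.2 0 1 1
  let xab := z.2 0 1 2
  let xbb := z.2 0 2 2
  let ytt := z.2 1 0 0
  let yaa := z.2 1 1 1
  let yab := z.2 1 1 2
  let ybb := z.2 1 2 2
  let J := jacobian z.1
  ![xtt + 2 * (J ^ 3)⁻¹ * (xa * ya * ybb - (yb * xa + xb * ya) * yab + xb * yaa * yb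
        - xaa * yb ^ 2 + 2 * xab * ya * yb - xbb * ya ^ 2) - pd₁ H (x, y),
    ytt + 2 * (J ^ 3)⁻¹ * (xb * yb * xaa - (xa * yb + xb * ya) * xab + xa * ya * xbb
        - xb ^ 2 * yaa + 2 * xa * xb * yab - xa ^ 2 * ybb) - pd₂ H (x, y)] k

/-! ### Prolongation and admitted generators -/

/-- Total derivative `D_i f = f_{s^i} + ∑ u^l_i f_{u^l}` of a function of `(s, u)`. -/
noncomputable def totalD (f : Base → ℝ) (i : Fin 3) (w : Jet1) : ℝ :=
  fderiv ℝ f w.1 (Pi.single i 1, fun l => w.2 l i)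

/-- Total derivative of a function on first jets:
`D_j g = g_{s^j} + ∑ u^l_j g_{u^l} + ∑ u^l_{mj} g_{u^l_m}`. -/
noncomputable def totalD₁ (g : Jet1 → ℝ) (j : Fin 3) (z : Jet2) : ℝ :=
  fderiv ℝ g z.1 ((Pi.single j 1, fun l => z.1.2 l j), fun l m => z.2 l m j)

/-- First prolongation coefficients `η^k_i = D_i η^k - ∑ u^k_l D_i ξ^l`. -/
noncomputable def prolong₁ (X : VField) (k : Fin 2) (i : Fin 3) (w : Jet1) : ℝ :=
  totalD (fun p => (X p).2 k) i w - ∑ l, w.2 k l * totalD (fun p => (X p).1 l) i w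

/-- Second prolongation coefficients `η^k_{ij} = D_j η^k_i - ∑ u^k_{il} D_j ξ^l`. -/
noncomputable def prolong₂ (X : VField) (k : Fin 2) (i j : Fin 3) (z : Jet2) : ℝ :=
  totalD₁ (prolong₁ X k i) j z - ∑ l, z.2 k i l * totalD (fun p => (X p).1 l) j z.1

/-- The second prolongation of `X`, a vector field on the second jets. -/
noncomputable def prolongation (X : VField) (z : Jet2) : Jet2 :=
  ((X z.1.1, fun k i => prolong₁ X k i z.1), fun k i j => prolong₂ X k i j z)

/-- `X` is a smooth vector field on `Ω` which is admitted there by the shallow water equations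
over the bottom `H`: the prolonged generator annihilates both equations at every second jet
over `Ω` (with nonvanishing Jacobian) that satisfies the equations. -/
def Admitted (H : ℝ × ℝ → ℝ) (Ω : Set Base) (X : VField) : Prop :=
  ContDiffOn ℝ ∞ X Ω ∧
    ∀ z : Jet2, z.1.1 ∈ Ω → (∀ k i j, z.2 k i j = z.2 k j i) → jacobian z.1 ≠ 0 →
      (∀ k, equations H k z = 0) →
        ∀ k, fderiv ℝ (equations H k) z (prolongation X z) = 0

/-! ### Projections of a domain -/

/-- The times `t` occurring in `Ω`. -/
def times (Ω : Set Base) : Set ℝ := (fun p : Base => p.1 0) '' Ω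

/-- The labels `(a, b)` occurring in `Ω`. -/
def labels (Ω : Set Base) : Set (ℝ × ℝ) := (fun p : Base => (p.1 1, p.1 2)) '' Ω

/-- The positions `(x, y)` occurring in `Ω`. -/
def positions (Ω : Set Base) : Set (ℝ × ℝ) := (fun p : Base => (p.2 0, p.2 1)) '' Ω

/-! ### Generators -/

/-- `∂_t`. -/
def timeShift : VField := fun _ => (![1, 0, 0], ![0, 0])

/-- The relabelling `ψ_b ∂_a - ψ_a ∂_b`. -/
noncomputable def relabelling (ψ : ℝ × ℝ → ℝ) : VField := fun p =>
  (![0, pd₂ ψ (p.1 1, p.1 2), -pd₁ ψ (p.1 1, p.1 2)], ![0, 0])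

/-- `ζ₁(t) ∂_x + ζ₂(t) ∂_y`. -/
def translation (ζ₁ ζ₂ : ℝ → ℝ) : VField := fun p => (![0, 0, 0], ![ζ₁ (p.1 0), ζ₂ (p.1 0)])

/-- `x ∂_x + y ∂_y + 4 a ∂_a`. -/
def scaling : VField := fun p => (![0, 4 * p.1 1, 0], ![p.2 0, p.2 1])

/-- `4 x ∂_x + 16 a ∂_a + 2 (2 y - q₂ t²) ∂_y`. -/
def scalingPlane (q₂ : ℝ) : VField := fun p =>
  (![0, 16 * p.1 1, 0], ![4 * p.2 0, 2 * (2 * p.2 1 - q₂ * p.1 0 ^ 2)])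

/-! ### Bottoms -/

/-- `H = p x² + 2 c x y + b y² + q₁ x + q₂ y + q₀`. -/
def quadraticBottom (p c b q₁ q₂ q₀ : ℝ) : ℝ × ℝ → ℝ := fun r =>
  p * r.1 ^ 2 + 2 * c * r.1 * r.2 + b * r.2 ^ 2 + q₁ * r.1 + q₂ * r.2 + q₀

/-- `H = l₁ x² + l₂ y²`. -/
def bottom₁ (l₁ l₂ : ℝ) : ℝ × ℝ → ℝ := fun r => l₁ * r.1 ^ 2 + l₂ * r.2 ^ 2

/-- `H = l₁ x² + q₂ y`. -/
def bottom₂ (l₁ q₂ : ℝ) : ℝ × ℝ → ℝ := fun r => l₁ * r.1 ^ 2 + q₂ * r.2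

/-! ### The equivalence group, acting on `((t, a, b), (x, y), H)` -/

/-- The generators of the equivalence group, as vector fields on the space of
`(((t, a, b), (x, y)), H)`. -/
inductive EquivGenerator : (Base × ℝ → Base × ℝ) → Prop
  /-- `∂_x` -/
  | shift_x : EquivGenerator (fun _ => ((![0, 0, 0], ![1, 0]), 0))
  /-- `∂_y` -/
  | shift_y : EquivGenerator (fun _ => ((![0, 0, 0], ![0, 1]), 0))
  /-- `y ∂_x - x ∂_y` -/
  | rotation : EquivGenerator (fun P => ((![0, 0, 0], ![P.1.2 1, -P.1.2 0]), 0))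
  /-- `ψ_b ∂_a - ψ_a ∂_b` -/
  | relabel (ψ : ℝ × ℝ → ℝ) (hψ : ContDiff ℝ ∞ ψ) :
      EquivGenerator (fun P => (relabelling ψ P.1, 0))
  /-- `∂_t` -/
  | shift_t : EquivGenerator (fun _ => ((![1, 0, 0], ![0, 0]), 0))
  /-- `2 a ∂_a + t ∂_t + x ∂_x + y ∂_y` -/
  | scale_a : EquivGenerator
      (fun P => ((![P.1.1 0, 2 * P.1.1 1, 0], ![P.1.2 0, P.1.2 1]), 0))
  /-- `∂_H` -/
  | shift_H : EquivGenerator (fun _ => ((![0, 0, 0], ![0, 0]), 1))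
  /-- `2 t ∂_t + x ∂_x + y ∂_y - 2 H ∂_H` -/
  | scale_H : EquivGenerator
      (fun P => ((![2 * P.1.1 0, 0, 0], ![P.1.2 0, P.1.2 1]), -2 * P.2))

/-- The equivalence group: the transformations of the space of `(((t, a, b), (x, y)), H)`
generated by the one-parameter groups of the generators above and the two involutions
`t → -t` and `(x, y) → (-x, -y)`. -/
inductive EquivGroup : (Base × ℝ → Base × ℝ) → Prop
  | flow (V : Base × ℝ → Base × ℝ) (hV : EquivGenerator V) (F : ℝ → Base × ℝ → Base × ℝ)
      (h_zero : ∀ P, F 0 P = P)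
      (h_deriv : ∀ s P, HasDerivAt (fun r => F r P) (V (F s P)) s) (s : ℝ) :
      EquivGroup (F s)
  | reverse_time :
      EquivGroup (fun P => ((![-P.1.1 0, P.1.1 1, P.1.1 2], P.1.2), P.2))
  | reverse_space : EquivGroup (fun P => ((P.1.1, -P.1.2), P.2))
  | comp (T S : Base × ℝ → Base × ℝ) (hT : EquivGroup T) (hS : EquivGroup S) :
      EquivGroup (fun P => T (S P))

/-- `T` carries the bottom `H` to the bottom `H'`: it maps points of the graph of `H` to points
of the graph of `H'`. -/
def MapsBottom (T : Base × ℝ → Base × ℝ) (H H' : ℝ × ℝ → ℝ) : Prop :=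
  ∀ p : Base, (T (p, H (p.2 0, p.2 1))).2 =
    H' ((T (p, H (p.2 0, p.2 1))).1.2 0, (T (p, H (p.2 0, p.2 1))).1.2 1)

/-- The transformation of `((t, a, b), (x, y))` that `T` induces over the bottom `H`. -/
def baseMap (T : Base × ℝ → Base × ℝ) (H : ℝ × ℝ → ℝ) : Base → Base :=
  fun p => (T (p, H (p.2 0, p.2 1))).1

/-- `T` transforms the algebras admitted over `H` into those admitted over `H'`: if `X'` is the
image of `X` under the induced transformation, then `X` is admitted over `H` on `Ω` if and only
if `X'` is admitted over `H'` on the image of `Ω`. -/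
def TransformsAdmitted (T : Base × ℝ → Base × ℝ) (H H' : ℝ × ℝ → ℝ) : Prop :=
  ∀ (Ω : Set Base) (X X' : VField), IsOpen Ω →
    (∀ p ∈ Ω, X' (baseMap T H p) = fderiv ℝ (baseMap T H) p (X p)) →
      (Admitted H Ω X ↔ Admitted H' (baseMap T H '' Ω) X')

/-! ### The classifying equation -/

/-- `X` has, on `Ω`, the form
`ζ^a = -ψ_b + 4 k₁ a`, `ζ^b = ψ_a`, `ζ^x = ζ' x / 2 + k₁ x + k₄ y + ζ₁`,
`ζ^y = ζ' y / 2 + k₁ y - k₄ x + ζ₂`, with `ζ = ζ(t)`. -/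
def HasForm (Ω : Set Base) (X : VField) (k₁ k₄ : ℝ) (ζ ζ₁ ζ₂ : ℝ → ℝ) (ψ : ℝ × ℝ → ℝ) : Prop :=
  ∀ p ∈ Ω, X p =
    (![ζ (p.1 0), -pd₂ ψ (p.1 1, p.1 2) + 4 * k₁ * p.1 1, pd₁ ψ (p.1 1, p.1 2)],
     ![deriv ζ (p.1 0) / 2 * p.2 0 + k₁ * p.2 0 + k₄ * p.2 1 + ζ₁ (p.1 0),
       deriv ζ (p.1 0) / 2 * p.2 1 + k₁ * p.2 1 - k₄ * p.2 0 + ζ₂ (p.1 0)])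

/-- The classifying equation at `(t, x, y)`:
`(α x + β y + γ₁) H_x + (-β x + α y + γ₂) H_y = 2 γ H + q (x² + y²) + q₁ x + q₂ y + q₀`. -/
def ClassifyingEquation (H : ℝ × ℝ → ℝ) (k₁ k₄ : ℝ) (ζ ζ₁ ζ₂ g : ℝ → ℝ) (t x y : ℝ) : Prop :=
  let α := deriv ζ t + 2 * k₁
  let β := 2 * k₄
  let γ := 2 * k₁ - deriv ζ t
  let γ₁ := 2 * ζ₁ t
  let γ₂ := 2 * ζ₂ t
  let q := iteratedDeriv 3 ζ t / 2
  let q₁ := 2 * iteratedDeriv 2 ζ₁ t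
  let q₂ := 2 * iteratedDeriv 2 ζ₂ t
  let q₀ := g t
  (α * x + β * y + γ₁) * pd₁ H (x, y) + (-β * x + α * y + γ₂) * pd₂ H (x, y) =
    2 * γ * H (x, y) + q * (x ^ 2 + y ^ 2) + q₁ * x + q₂ * y + q₀

end ShallowWater

/-!
The invariance condition is a polynomial identity in the derivatives of `(x, y)` on the solution
manifold of the equations. On the jets with `x_a = y_b = ±1`, `x_b = y_a = 0` the accelerations are
explicit, and the velocities and the other second derivatives remain free (`testJet`). Comparing
coefficients there already yields everything. The mixed derivatives `u_{ta}, u_{tb}` force the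
vector field to be projectable: `ξ^t = ξ^t(t)` and `(ξ^a, ξ^b)` depends on `(a, b)` only
(`Admitted.projectable`). The parts odd and even in the sign, the velocities and the spatial second
derivatives then give the determining equations (`Admitted.determiningAt`): `η` does not depend on
the labels, `(ξ^a, ξ^b)` has constant divergence `4 k₁`, `η` is affine in the position with a
conformal matrix whose trace is tied to `ξ^t_t` and `k₁`, and two equations contain the bottom.
Conversely these equations suffice at every jet, because the prolonged field maps the two equations
to linear combinations of themselves (`admitted_of_determiningAt`).

On a convex open set, functions with vanishing partial derivatives descend to projections and closed
forms have primitives, so the homogeneous part of the system integrates to the stated form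
(`exists_hasForm`). The two equations with the bottom are the derivatives in `x` and `y` of the
classifying equation (`dd_classifyingDefect`); integrating them produces the free function `g(t)`,
whence `admitted_iff`.

The kernel is found by testing with `0, x, y, x², y²` (`forall_admitted_iff`). Over a diagonal
quadratic bottom the classifying equation is a polynomial in the position, and its coefficients give
`ζ' = 0`, `k₄ = 0` and linear ordinary differential equations for `ζ₁, ζ₂`
(`exists_of_admitted_diagonal`), whose solutions extend to the line (`exists_global_solution`).

A quadratic bottom is carried to its normal form by diagonalizing the quadratic part by a rotation,
completing squares by shifts of `x, y`, and removing the constant by a shift of `H`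
(`exists_normal_form`). Such a motion preserves the class of vector fields described by
`admitted_iff`, with explicit new `ζ₁, ζ₂, g` (`Admitted.of_motion`); this is applied on small
balls, since the sets in question need not be convex.
-/

namespace ShallowWater

/-! ### Total derivatives and the second prolongation -/

/-- The coordinate vectors `∂_t, ∂_a, ∂_b` of the base. -/
def eS (i : Fin 3) : Base := (Pi.single i 1, 0)

/-- The coordinate vectors `∂_x, ∂_y` of the base. -/
def eU (l : Fin 2) : Base := (0, Pi.single l 1)

/-- The derivative of `f` in the constant direction `v`, as a function on the base. -/
noncomputable def dd (v : Base) (f : Base → ℝ) : Base → ℝ := fun p => fderiv ℝ f p v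

lemma base_decomp (v : Base) :
    v = v.1 0 • eS 0 + v.1 1 • eS 1 + v.1 2 • eS 2 + v.2 0 • eU 0 + v.2 1 • eU 1 := by
  ext i <;> fin_cases i <;> simp [eS, eU]

lemma fderiv_decomp (f : Base → ℝ) (p v : Base) :
    fderiv ℝ f p v = v.1 0 * dd (eS 0) f p + v.1 1 * dd (eS 1) f p + v.1 2 * dd (eS 2) f p
      + v.2 0 * dd (eU 0) f p + v.2 1 * dd (eU 1) f p := by
  conv_lhs => rw [base_decomp v]
  simp only [map_add, map_smul, smul_eq_mul, dd]

lemma totalD_eq (f : Base → ℝ) (i : Fin 3) (w : Jet1) :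
    totalD f i w = dd (eS i) f w.1 + w.2 0 i * dd (eU 0) f w.1 + w.2 1 i * dd (eU 1) f w.1 := by
  rw [totalD, fderiv_decomp]
  fin_cases i <;> simp

lemma contDiffAt_dd {f : Base → ℝ} {p : Base} (hf : ContDiffAt ℝ ∞ f p) (v : Base) :
    ContDiffAt ℝ ∞ (dd v f) p :=
  (hf.fderiv_right (m := ∞) (by simp)).clm_apply contDiffAt_const

lemma dd_comm {f : Base → ℝ} {p : Base} (hf : ContDiffAt ℝ ∞ f p) (v w : Base) :
    dd v (dd w f) p = dd w (dd v f) p := by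
  have h : DifferentiableAt ℝ (fderiv ℝ f) p :=
    (hf.fderiv_right (m := 1) (by norm_cast)).differentiableAt (by norm_num)
  have e : ∀ a b : Base, dd a (dd b f) p = fderiv ℝ (fderiv ℝ f) p a b := fun a b => by
    have hd : dd b f = fun q => fderiv ℝ f q b := rfl
    rw [hd, dd, fderiv_clm_apply h (by fun_prop)]
    simp
  rw [e, e]
  refine hf.isSymmSndFDerivAt ?_ v w
  simp only [minSmoothness_of_isRCLikeNormedField]
  exact WithTop.coe_le_coe.2 (le_top : (2 : ℕ∞) ≤ ⊤)

lemma dd_congr {f g : Base → ℝ} {Ω : Set Base} (hΩ : IsOpen Ω) (h : Set.EqOn f g Ω) (v : Base) :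
    Set.EqOn (dd v f) (dd v g) Ω := fun p hp => by
  simp only [dd]
  rw [(Filter.eventuallyEq_of_mem (hΩ.mem_nhds hp) h).fderiv_eq]

lemma dd_const (v : Base) (c : ℝ) : dd v (fun _ => c) = fun _ => 0 := by
  ext; simp [dd]

lemma totalD₁_base {F : Base → ℝ} (j : Fin 3) (z : Jet2) (hF : DifferentiableAt ℝ F z.1.1) :
    totalD₁ (fun w => F w.1) j z = totalD F j z.1 := by
  have : HasFDerivAt (fun w : Jet1 => F w.1)
      ((fderiv ℝ F z.1.1).comp (ContinuousLinearMap.fst ℝ _ _)) z.1 :=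
    HasFDerivAt.comp z.1 hF.hasFDerivAt hasFDerivAt_fst
  rw [totalD₁, this.fderiv, totalD]
  rfl

lemma totalD₁_coord (k : Fin 2) (i j : Fin 3) (z : Jet2) :
    totalD₁ (fun w => w.2 k i) j z = z.2 k i j := by
  let c : Jet1 →L[ℝ] ℝ := (ContinuousLinearMap.proj (R := ℝ) (φ := fun _ : Fin 3 => ℝ) i).comp
    ((ContinuousLinearMap.proj (R := ℝ) (φ := fun _ : Fin 2 => Fin 3 → ℝ) k).comp
      (ContinuousLinearMap.snd ℝ Base (Fin 2 → Fin 3 → ℝ)))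
  have : HasFDerivAt (fun w : Jet1 => w.2 k i) c z.1 := c.hasFDerivAt
  rw [totalD₁, this.fderiv]
  rfl

lemma totalD₁_add {f g : Jet1 → ℝ} (j : Fin 3) (z : Jet2) (hf : DifferentiableAt ℝ f z.1)
    (hg : DifferentiableAt ℝ g z.1) :
    totalD₁ (fun w => f w + g w) j z = totalD₁ f j z + totalD₁ g j z := by
  simp only [totalD₁]
  rw [fderiv_fun_add hf hg]; rfl

lemma totalD₁_sub {f g : Jet1 → ℝ} (j : Fin 3) (z : Jet2) (hf : DifferentiableAt ℝ f z.1)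
    (hg : DifferentiableAt ℝ g z.1) :
    totalD₁ (fun w => f w - g w) j z = totalD₁ f j z - totalD₁ g j z := by
  simp only [totalD₁]
  rw [fderiv_fun_sub hf hg]; rfl

lemma totalD₁_mul {f g : Jet1 → ℝ} (j : Fin 3) (z : Jet2) (hf : DifferentiableAt ℝ f z.1)
    (hg : DifferentiableAt ℝ g z.1) :
    totalD₁ (fun w => f w * g w) j z = f z.1 * totalD₁ g j z + totalD₁ f j z * g z.1 := by
  simp only [totalD₁]
  rw [fderiv_fun_mul hf hg]
  simp [mul_comm]

/-- The second total derivative `D_j D_i f` of a function on the base. -/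
noncomputable def totalDD (f : Base → ℝ) (i j : Fin 3) (z : Jet2) : ℝ :=
  totalD (dd (eS i) f) j z.1
    + (z.1.2 0 i * totalD (dd (eU 0) f) j z.1 + z.2 0 i j * dd (eU 0) f z.1.1)
    + (z.1.2 1 i * totalD (dd (eU 1) f) j z.1 + z.2 1 i j * dd (eU 1) f z.1.1)

lemma differentiableAt_coord (k : Fin 2) (i : Fin 3) (w : Jet1) :
    DifferentiableAt ℝ (fun w : Jet1 => w.2 k i) w := by fun_prop

lemma differentiableAt_base {F : Base → ℝ} {w : Jet1} (hF : DifferentiableAt ℝ F w.1) :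
    DifferentiableAt ℝ (fun w : Jet1 => F w.1) w :=
  DifferentiableAt.comp w hF differentiableAt_fst

lemma differentiableAt_dd {f : Base → ℝ} {p : Base} (hf : ContDiffAt ℝ ∞ f p) (v : Base) :
    DifferentiableAt ℝ (dd v f) p := (contDiffAt_dd hf v).differentiableAt (by simp)

lemma totalD_funext (f : Base → ℝ) (i : Fin 3) :
    totalD f i = fun w => (dd (eS i) f w.1 + w.2 0 i * dd (eU 0) f w.1)
      + w.2 1 i * dd (eU 1) f w.1 := funext (totalD_eq f i)

lemma differentiableAt_totalD {f : Base → ℝ} {w : Jet1} (hf : ContDiffAt ℝ ∞ f w.1) (i : Fin 3) :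
    DifferentiableAt ℝ (totalD f i) w := by
  rw [totalD_funext]
  have h : ∀ v, DifferentiableAt ℝ (fun w : Jet1 => dd v f w.1) w := fun v =>
    differentiableAt_base (differentiableAt_dd hf v)
  exact ((h _).fun_add ((differentiableAt_coord 0 i w).fun_mul (h _))).add
    ((differentiableAt_coord 1 i w).fun_mul (h _))

lemma totalD₁_totalD {f : Base → ℝ} {z : Jet2} (hf : ContDiffAt ℝ ∞ f z.1.1) (i j : Fin 3) :
    totalD₁ (totalD f i) j z = totalDD f i j z := by
  have h : ∀ v, DifferentiableAt ℝ (fun w : Jet1 => dd v f w.1) z.1 := fun v =>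
    differentiableAt_base (differentiableAt_dd hf v)
  have c := fun k => differentiableAt_coord k i z.1
  rw [totalD_funext, totalD₁_add _ _ ((h _).fun_add ((c 0).fun_mul (h _))) ((c 1).fun_mul (h _)),
    totalD₁_add _ _ (h _) ((c 0).fun_mul (h _)), totalD₁_mul _ _ (c 0) (h _),
    totalD₁_mul _ _ (c 1) (h _)]
  simp only [totalD₁_base _ _ (differentiableAt_dd hf _), totalD₁_coord, totalDD]

/-- The second prolongation written with total derivatives of functions on the base only:
`η^k_{ij} = D_j D_i η^k - ∑ (u^k_l D_j D_i ξ^l + u^k_{lj} D_i ξ^l) - ∑ u^k_{il} D_j ξ^l`. -/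
lemma prolong₂_eq {X : VField} {z : Jet2} (hX : ContDiffAt ℝ ∞ X z.1.1) (k : Fin 2)
    (i j : Fin 3) :
    prolong₂ X k i j z = totalDD (fun p => (X p).2 k) i j z
      - ∑ l, (z.1.2 k l * totalDD (fun p => (X p).1 l) i j z
        + z.2 k l j * totalD (fun p => (X p).1 l) i z.1)
      - ∑ l, z.2 k i l * totalD (fun p => (X p).1 l) j z.1 := by
  have hη : ContDiffAt ℝ ∞ (fun p => (X p).2 k) z.1.1 := contDiffAt_pi.1 hX.snd k
  have hξ : ∀ l, ContDiffAt ℝ ∞ (fun p => (X p).1 l) z.1.1 := contDiffAt_pi.1 hX.fst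
  have h : prolong₁ X k i = fun w => totalD (fun p => (X p).2 k) i w
      - ((w.2 k 0 * totalD (fun p => (X p).1 0) i w + w.2 k 1 * totalD (fun p => (X p).1 1) i w)
      + w.2 k 2 * totalD (fun p => (X p).1 2) i w) := by
    ext w; rw [prolong₁, Fin.sum_univ_three]
  have d := fun l => differentiableAt_totalD (hξ l) i
  have c := fun l => differentiableAt_coord k l z.1
  rw [prolong₂, h, totalD₁_sub _ _ (differentiableAt_totalD hη i)
    ((((c 0).fun_mul (d 0)).fun_add ((c 1).fun_mul (d 1))).fun_add ((c 2).fun_mul (d 2))),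
    totalD₁_add _ _ (((c 0).fun_mul (d 0)).fun_add ((c 1).fun_mul (d 1))) ((c 2).fun_mul (d 2)),
    totalD₁_add _ _ ((c 0).fun_mul (d 0)) ((c 1).fun_mul (d 1)),
    totalD₁_mul _ _ (c 0) (d 0), totalD₁_mul _ _ (c 1) (d 1), totalD₁_mul _ _ (c 2) (d 2),
    totalD₁_totalD hη]
  simp only [totalD₁_totalD (hξ _), totalD₁_coord, Fin.sum_univ_three]

/-! ### The derivative of the equations on the second jets -/

/-- The position `(x, y)` of a point of the base. -/
def pos (p : Base) : ℝ × ℝ := (p.2 0, p.2 1)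

lemma contDiffAt_pd₁ {H : ℝ × ℝ → ℝ} {q : ℝ × ℝ} (hH : ContDiffAt ℝ ∞ H q) :
    ContDiffAt ℝ ∞ (pd₁ H) q :=
  (hH.fderiv_right (m := ∞) (by simp)).clm_apply contDiffAt_const

lemma contDiffAt_pd₂ {H : ℝ × ℝ → ℝ} {q : ℝ × ℝ} (hH : ContDiffAt ℝ ∞ H q) :
    ContDiffAt ℝ ∞ (pd₂ H) q :=
  (hH.fderiv_right (m := ∞) (by simp)).clm_apply contDiffAt_const

lemma fderiv_apply_eq_pd {F : ℝ × ℝ → ℝ} (q v : ℝ × ℝ) :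
    fderiv ℝ F q v = v.1 * pd₁ F q + v.2 * pd₂ F q := by
  have : v = v.1 • ((1 : ℝ), (0 : ℝ)) + v.2 • ((0 : ℝ), (1 : ℝ)) := by ext <;> simp
  conv_lhs => rw [this]
  simp only [map_add, map_smul, smul_eq_mul, pd₁, pd₂]

lemma hasDerivAt_line (a b : ℝ) : HasDerivAt (fun ε : ℝ => a + ε * b) b 0 := by
  simpa using ((hasDerivAt_id (0 : ℝ)).mul_const b).const_add a

/-- Up to the factor `2 J⁻³`, the pressure term of the first equation, for the first derivatives
`x_a, x_b, y_a, y_b` and the second derivatives. -/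
def presX (xa xb ya yb xaa xab xbb yaa yab ybb : ℝ) : ℝ :=
  xa * ya * ybb - (yb * xa + xb * ya) * yab + xb * yaa * yb
        - xaa * yb ^ 2 + 2 * xab * ya * yb - xbb * ya ^ 2

/-- Up to the factor `2 J⁻³`, the pressure term of the second equation. -/
def presY (xa xb ya yb xaa xab xbb yaa yab ybb : ℝ) : ℝ :=
  xb * yb * xaa - (xa * yb + xb * ya) * xab + xa * ya * xbb
        - xb ^ 2 * yaa + 2 * xa * xb * yab - xa ^ 2 * ybb

lemma equations_zero (H : ℝ × ℝ → ℝ) (z : Jet2) :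
    equations H 0 z = z.2 0 0 0 + 2 * (jacobian z.1 ^ 3)⁻¹ *
      presX (z.1.2 0 1) (z.1.2 0 2) (z.1.2 1 1) (z.1.2 1 2) (z.2 0 1 1) (z.2 0 1 2) (z.2 0 2 2)
        (z.2 1 1 1) (z.2 1 1 2) (z.2 1 2 2) - pd₁ H (pos z.1.1) := rfl

lemma equations_one (H : ℝ × ℝ → ℝ) (z : Jet2) :
    equations H 1 z = z.2 1 0 0 + 2 * (jacobian z.1 ^ 3)⁻¹ *
      presY (z.1.2 0 1) (z.1.2 0 2) (z.1.2 1 1) (z.1.2 1 2) (z.2 0 1 1) (z.2 0 1 2) (z.2 0 2 2)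
        (z.2 1 1 1) (z.2 1 1 2) (z.2 1 2 2) - pd₂ H (pos z.1.1) := rfl

/-- The derivative of `presX` with respect to the first derivatives, along the increments
`dxa, dxb, dya, dyb`. As `presX` is linear in the second derivatives, its full derivative is the sum
of `dPresX` and of `presX` at the increments of the second derivatives. -/
def dPresX (xa xb ya yb xaa xab xbb yaa yab ybb dxa dxb dya dyb : ℝ) : ℝ :=
  (dxa * ya + xa * dya) * ybb - (dyb * xa + yb * dxa + dxb * ya + xb * dya) * yab
    + (dxb * yb + xb * dyb) * yaa - 2 * yb * dyb * xaa + 2 * xab * (dya * yb + ya * dyb)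
    - 2 * ya * dya * xbb

/-- The derivative of `presY` with respect to the first derivatives, as for `presX`. -/
def dPresY (xa xb ya yb xaa xab xbb yaa yab ybb dxa dxb dya dyb : ℝ) : ℝ :=
  (dxb * yb + xb * dyb) * xaa - (dxa * yb + xa * dyb + dxb * ya + xb * dya) * xab
    + (dxa * ya + xa * dya) * xbb - 2 * xb * dxb * yaa + 2 * yab * (dxa * xb + xa * dxb)
    - 2 * xa * dxa * ybb

lemma differentiableAt_equations {H : ℝ × ℝ → ℝ} {z : Jet2} (hH : ContDiffAt ℝ ∞ H (pos z.1.1))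
    (hJ : jacobian z.1 ≠ 0) (k : Fin 2) : DifferentiableAt ℝ (equations H k) z := by
  have hp : DifferentiableAt ℝ (fun z : Jet2 => pos z.1.1) z := by unfold pos; fun_prop
  have h₁ : DifferentiableAt ℝ (fun z : Jet2 => pd₁ H (pos z.1.1)) z :=
    DifferentiableAt.comp (g := pd₁ H) z ((contDiffAt_pd₁ hH).differentiableAt (by simp)) hp
  have h₂ : DifferentiableAt ℝ (fun z : Jet2 => pd₂ H (pos z.1.1)) z :=
    DifferentiableAt.comp (g := pd₂ H) z ((contDiffAt_pd₂ hH).differentiableAt (by simp)) hp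
  have hj : DifferentiableAt ℝ (fun z : Jet2 => (jacobian z.1 ^ 3)⁻¹) z := by
    refine DifferentiableAt.fun_inv ?_ (pow_ne_zero 3 hJ)
    unfold jacobian; fun_prop
  fin_cases k
  · refine DifferentiableAt.congr_of_eventuallyEq ?_ (.of_forall (equations_zero H))
    unfold presX
    fun_prop
  · refine DifferentiableAt.congr_of_eventuallyEq ?_ (.of_forall (equations_one H))
    unfold presY
    fun_prop

lemma hasDerivAt_jacobian_inv (xa xb ya yb dxa dxb dya dyb : ℝ) (hJ : xa * yb - xb * ya ≠ 0) :
    HasDerivAt (fun ε : ℝ => (((xa + ε * dxa) * (yb + ε * dyb)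
        - (xb + ε * dxb) * (ya + ε * dya)) ^ 3)⁻¹)
      (-3 * ((xa * yb - xb * ya) ^ 4)⁻¹ * (dxa * yb + xa * dyb - dxb * ya - xb * dya)) 0 := by
  have h := (((hasDerivAt_line xa dxa).fun_mul (hasDerivAt_line yb dyb)).fun_sub
    ((hasDerivAt_line xb dxb).fun_mul (hasDerivAt_line ya dya))).fun_pow 3
  have h' := h.fun_inv (by simpa using hJ)
  refine h'.congr_deriv ?_
  simp only [zero_mul, add_zero]
  field_simp
  ring

lemma hasDerivAt_presX (xa xb ya yb xaa xab xbb yaa yab ybb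
    dxa dxb dya dyb dxaa dxab dxbb dyaa dyab dybb : ℝ) :
    HasDerivAt (fun ε : ℝ => presX (xa + ε * dxa) (xb + ε * dxb) (ya + ε * dya) (yb + ε * dyb)
        (xaa + ε * dxaa) (xab + ε * dxab) (xbb + ε * dxbb)
        (yaa + ε * dyaa) (yab + ε * dyab) (ybb + ε * dybb))
      (dPresX xa xb ya yb xaa xab xbb yaa yab ybb dxa dxb dya dyb
        + presX xa xb ya yb dxaa dxab dxbb dyaa dyab dybb) 0 := by
  have l := hasDerivAt_line
  have h := ((((((((l xa dxa).fun_mul (l ya dya)).fun_mul (l ybb dybb)).fun_sub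
    ((((l yb dyb).fun_mul (l xa dxa)).fun_add ((l xb dxb).fun_mul (l ya dya))).fun_mul
      (l yab dyab))).fun_add
    (((l xb dxb).fun_mul (l yaa dyaa)).fun_mul (l yb dyb))).fun_sub
    ((l xaa dxaa).fun_mul ((l yb dyb).fun_pow 2))).fun_add
    ((((l xab dxab).const_mul 2).fun_mul (l ya dya)).fun_mul (l yb dyb))).fun_sub
    ((l xbb dxbb).fun_mul ((l ya dya).fun_pow 2)))
  refine h.congr_deriv ?_
  simp only [dPresX, presX]
  ring

lemma hasDerivAt_presY (xa xb ya yb xaa xab xbb yaa yab ybb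
    dxa dxb dya dyb dxaa dxab dxbb dyaa dyab dybb : ℝ) :
    HasDerivAt (fun ε : ℝ => presY (xa + ε * dxa) (xb + ε * dxb) (ya + ε * dya) (yb + ε * dyb)
        (xaa + ε * dxaa) (xab + ε * dxab) (xbb + ε * dxbb)
        (yaa + ε * dyaa) (yab + ε * dyab) (ybb + ε * dybb))
      (dPresY xa xb ya yb xaa xab xbb yaa yab ybb dxa dxb dya dyb
        + presY xa xb ya yb dxaa dxab dxbb dyaa dyab dybb) 0 := by
  have l := hasDerivAt_line
  have h := ((((((((l xb dxb).fun_mul (l yb dyb)).fun_mul (l xaa dxaa)).fun_sub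
    ((((l xa dxa).fun_mul (l yb dyb)).fun_add ((l xb dxb).fun_mul (l ya dya))).fun_mul
      (l xab dxab))).fun_add
    (((l xa dxa).fun_mul (l ya dya)).fun_mul (l xbb dxbb))).fun_sub
    (((l xb dxb).fun_pow 2).fun_mul (l yaa dyaa))).fun_add
    ((((l xa dxa).const_mul 2).fun_mul (l xb dxb)).fun_mul (l yab dyab))).fun_sub
    (((l xa dxa).fun_pow 2).fun_mul (l ybb dybb)))
  refine h.congr_deriv ?_
  simp only [dPresY, presY]
  ring

lemma hasDerivAt_comp_pos {F : ℝ × ℝ → ℝ} {p : Base} (hF : DifferentiableAt ℝ F (pos p))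
    (v : Base) :
    HasDerivAt (fun ε : ℝ => F (pos (p + ε • v)))
      (v.2 0 * pd₁ F (pos p) + v.2 1 * pd₂ F (pos p)) 0 := by
  have hF' : HasFDerivAt F (fderiv ℝ F (pos p)) ((fun ε : ℝ => pos (p + ε • v)) 0) := by
    simpa using hF.hasFDerivAt
  have hl : HasDerivAt (fun ε : ℝ => pos (p + ε • v)) (v.2 0, v.2 1) 0 := by
    simpa [pos] using (hasDerivAt_line (p.2 0) (v.2 0)).prodMk (hasDerivAt_line (p.2 1) (v.2 1))
  have := hF'.comp_hasDerivAt (0 : ℝ) hl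
  rwa [fderiv_apply_eq_pd] at this

/-- The derivative of a differentiable function on the jets can be computed along a line, where it
is a derivative in one real variable. -/
lemma fderiv_eq_of_line {E : Jet2 → ℝ} {z v : Jet2} {d : ℝ} (hE : DifferentiableAt ℝ E z)
    (h : HasDerivAt (fun ε : ℝ => E (z + ε • v)) d 0) : fderiv ℝ E z v = d := by
  have hl : HasDerivAt (fun ε : ℝ => z + ε • v) v 0 := by
    simpa using ((hasDerivAt_id (0 : ℝ)).smul_const v).const_add z
  have hE' : HasFDerivAt E (fderiv ℝ E z) ((fun ε : ℝ => z + ε • v) 0) := by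
    simpa using hE.hasFDerivAt
  exact (hE'.comp_hasDerivAt (0 : ℝ) hl).unique h

/-- The derivative of the Jacobian at the first derivatives `w` along the increment `v`. -/
def dJacobian (w v : Fin 2 → Fin 3 → ℝ) : ℝ :=
  v 0 1 * w 1 2 + w 0 1 * v 1 2 - v 0 2 * w 1 1 - w 0 2 * v 1 1

lemma fderiv_equations_zero {H : ℝ × ℝ → ℝ} {z : Jet2} (hH : ContDiffAt ℝ ∞ H (pos z.1.1))
    (hJ : jacobian z.1 ≠ 0) (v : Jet2) :
    fderiv ℝ (equations H 0) z v = v.2 0 0 0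
      - 6 * (jacobian z.1 ^ 4)⁻¹ * dJacobian z.1.2 v.1.2 *
        presX (z.1.2 0 1) (z.1.2 0 2) (z.1.2 1 1) (z.1.2 1 2) (z.2 0 1 1) (z.2 0 1 2) (z.2 0 2 2)
          (z.2 1 1 1) (z.2 1 1 2) (z.2 1 2 2)
      + 2 * (jacobian z.1 ^ 3)⁻¹ *
        (dPresX (z.1.2 0 1) (z.1.2 0 2) (z.1.2 1 1) (z.1.2 1 2) (z.2 0 1 1) (z.2 0 1 2)
          (z.2 0 2 2) (z.2 1 1 1) (z.2 1 1 2) (z.2 1 2 2)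
          (v.1.2 0 1) (v.1.2 0 2) (v.1.2 1 1) (v.1.2 1 2)
        + presX (z.1.2 0 1) (z.1.2 0 2) (z.1.2 1 1) (z.1.2 1 2) (v.2 0 1 1) (v.2 0 1 2)
          (v.2 0 2 2) (v.2 1 1 1) (v.2 1 1 2) (v.2 1 2 2))
      - (v.1.1.2 0 * pd₁ (pd₁ H) (pos z.1.1) + v.1.1.2 1 * pd₂ (pd₁ H) (pos z.1.1)) := by
  apply fderiv_eq_of_line (differentiableAt_equations hH hJ 0)
  simp only [equations_zero]
  refine ((((hasDerivAt_line _ _).fun_add (((hasDerivAt_jacobian_inv _ _ _ _ _ _ _ _ hJ).const_mul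
    2).fun_mul (hasDerivAt_presX _ _ _ _ _ _ _ _ _ _ _ _ _ _ _ _ _ _ _ _))).fun_sub
    (hasDerivAt_comp_pos ((contDiffAt_pd₁ hH).differentiableAt (by simp)) _)).congr_deriv ?_)
  simp only [zero_mul, add_zero, dJacobian, jacobian]
  ring

lemma fderiv_equations_one {H : ℝ × ℝ → ℝ} {z : Jet2} (hH : ContDiffAt ℝ ∞ H (pos z.1.1))
    (hJ : jacobian z.1 ≠ 0) (v : Jet2) :
    fderiv ℝ (equations H 1) z v = v.2 1 0 0
      - 6 * (jacobian z.1 ^ 4)⁻¹ * dJacobian z.1.2 v.1.2 *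
        presY (z.1.2 0 1) (z.1.2 0 2) (z.1.2 1 1) (z.1.2 1 2) (z.2 0 1 1) (z.2 0 1 2) (z.2 0 2 2)
          (z.2 1 1 1) (z.2 1 1 2) (z.2 1 2 2)
      + 2 * (jacobian z.1 ^ 3)⁻¹ *
        (dPresY (z.1.2 0 1) (z.1.2 0 2) (z.1.2 1 1) (z.1.2 1 2) (z.2 0 1 1) (z.2 0 1 2)
          (z.2 0 2 2) (z.2 1 1 1) (z.2 1 1 2) (z.2 1 2 2)
          (v.1.2 0 1) (v.1.2 0 2) (v.1.2 1 1) (v.1.2 1 2)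
        + presY (z.1.2 0 1) (z.1.2 0 2) (z.1.2 1 1) (z.1.2 1 2) (v.2 0 1 1) (v.2 0 1 2)
          (v.2 0 2 2) (v.2 1 1 1) (v.2 1 1 2) (v.2 1 2 2))
      - (v.1.1.2 0 * pd₁ (pd₂ H) (pos z.1.1) + v.1.1.2 1 * pd₂ (pd₂ H) (pos z.1.1)) := by
  apply fderiv_eq_of_line (differentiableAt_equations hH hJ 1)
  simp only [equations_one]
  refine ((((hasDerivAt_line _ _).fun_add (((hasDerivAt_jacobian_inv _ _ _ _ _ _ _ _ hJ).const_mul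
    2).fun_mul (hasDerivAt_presY _ _ _ _ _ _ _ _ _ _ _ _ _ _ _ _ _ _ _ _))).fun_sub
    (hasDerivAt_comp_pos ((contDiffAt_pd₂ hH).differentiableAt (by simp)) _)).congr_deriv ?_)
  simp only [zero_mul, add_zero, dJacobian, jacobian]
  ring

/-! ### The invariance condition at special jets -/

/-- The components `ξ^t, ξ^a, ξ^b` of a vector field. -/
def compS (X : VField) (l : Fin 3) : Base → ℝ := fun p => (X p).1 l

/-- The components `η^x, η^y` of a vector field. -/
def compU (X : VField) (k : Fin 2) : Base → ℝ := fun p => (X p).2 k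

lemma contDiffAt_compS {X : VField} {p : Base} (hX : ContDiffAt ℝ ∞ X p) (l : Fin 3) :
    ContDiffAt ℝ ∞ (compS X l) p := contDiffAt_pi.1 hX.fst l

lemma contDiffAt_compU {X : VField} {p : Base} (hX : ContDiffAt ℝ ∞ X p) (k : Fin 2) :
    ContDiffAt ℝ ∞ (compU X k) p := contDiffAt_pi.1 hX.snd k

lemma prolong₁_compU (X : VField) (k : Fin 2) (i : Fin 3) (w : Jet1) :
    prolong₁ X k i w = totalD (compU X k) i w - ∑ l, w.2 k l * totalD (compS X l) i w := rfl

lemma prolong₂_compU {X : VField} {z : Jet2} (hX : ContDiffAt ℝ ∞ X z.1.1) (k : Fin 2)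
    (i j : Fin 3) :
    prolong₂ X k i j z = totalDD (compU X k) i j z
      - ∑ l, (z.1.2 k l * totalDD (compS X l) i j z + z.2 k l j * totalD (compS X l) i z.1)
      - ∑ l, z.2 k i l * totalD (compS X l) j z.1 := prolong₂_eq hX k i j

/-- The second jet over `p` with `x_a = y_b = s`, `x_b = y_a = 0`, with the given velocity `v`,
mixed derivatives `m k = (u^k_{ta}, u^k_{tb})` and spatial second derivatives
`S k = (u^k_{aa}, u^k_{ab}, u^k_{bb})`, and with the accelerations that the equations demand
when `s = ± 1`. -/
noncomputable def testJet (H : ℝ × ℝ → ℝ) (p : Base) (s : ℝ) (v : Fin 2 → ℝ)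
    (m : Fin 2 → Fin 2 → ℝ) (S : Fin 2 → Fin 3 → ℝ) : Jet2 :=
  ((p, ![![v 0, s, 0], ![v 1, 0, s]]),
   ![![![2 * (S 0 0 + S 1 1) + pd₁ H (pos p), m 0 0, m 0 1],
       ![m 0 0, S 0 0, S 0 1], ![m 0 1, S 0 1, S 0 2]],
     ![![2 * (S 0 1 + S 1 2) + pd₂ H (pos p), m 1 0, m 1 1],
       ![m 1 0, S 1 0, S 1 1], ![m 1 1, S 1 1, S 1 2]]])

lemma jacobian_testJet {H : ℝ × ℝ → ℝ} {p : Base} {s : ℝ} {v : Fin 2 → ℝ}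
    {m : Fin 2 → Fin 2 → ℝ} {S : Fin 2 → Fin 3 → ℝ} (hs : s ^ 2 = 1) :
    jacobian (testJet H p s v m S).1 = 1 := by
  simp [jacobian, testJet]; linarith

/-- The invariance condition at the jets `testJet`, which satisfy the equations. It is polynomial in
the free parameters `v, m, S` of these jets, so that its coefficients vanish separately; comparing
`s = 1` with `s = -1` separates the parts that are even and odd in the spatial first derivatives. -/
lemma Admitted.at_testJet {H : ℝ × ℝ → ℝ} {Ω : Set Base} {X : VField} (h : Admitted H Ω X)
    {p : Base} (hp : p ∈ Ω) (hH : ContDiffAt ℝ ∞ H (pos p))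
    {s : ℝ} (hs : s ^ 2 = 1) (v : Fin 2 → ℝ) (m : Fin 2 → Fin 2 → ℝ) (S : Fin 2 → Fin 3 → ℝ) :
    (prolong₂ X 0 0 0 (testJet H p s v m S)
      + 2 * s * (prolong₁ X 1 1 (testJet H p s v m S).1 * (S 1 2 + 2 * S 0 1)
        + prolong₁ X 0 2 (testJet H p s v m S).1 * S 1 0
        - 2 * prolong₁ X 1 2 (testJet H p s v m S).1 * S 0 0
        - (prolong₁ X 0 1 (testJet H p s v m S).1 + prolong₁ X 1 2 (testJet H p s v m S).1)
          * S 1 1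
        + 3 * (prolong₁ X 0 1 (testJet H p s v m S).1 + prolong₁ X 1 2 (testJet H p s v m S).1)
          * (S 0 0 + S 1 1))
      - 2 * (prolong₂ X 0 1 1 (testJet H p s v m S) + prolong₂ X 1 1 2 (testJet H p s v m S))
      - (compU X 0 p * pd₁ (pd₁ H) (pos p) + compU X 1 p * pd₂ (pd₁ H) (pos p)) = 0) ∧
    (prolong₂ X 1 0 0 (testJet H p s v m S)
      + 2 * s * (prolong₁ X 0 2 (testJet H p s v m S).1 * (S 0 0 + 2 * S 1 1)
        + prolong₁ X 1 1 (testJet H p s v m S).1 * S 0 2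
        - 2 * prolong₁ X 0 1 (testJet H p s v m S).1 * S 1 2
        - (prolong₁ X 0 1 (testJet H p s v m S).1 + prolong₁ X 1 2 (testJet H p s v m S).1)
          * S 0 1
        + 3 * (prolong₁ X 0 1 (testJet H p s v m S).1 + prolong₁ X 1 2 (testJet H p s v m S).1)
          * (S 0 1 + S 1 2))
      - 2 * (prolong₂ X 0 1 2 (testJet H p s v m S) + prolong₂ X 1 2 2 (testJet H p s v m S))
      - (compU X 0 p * pd₁ (pd₂ H) (pos p) + compU X 1 p * pd₂ (pd₂ H) (pos p)) = 0) := by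
  have hJ := jacobian_testJet (H := H) (p := p) (v := v) (m := m) (S := S) hs
  have hJ' : jacobian (testJet H p s v m S).1 ≠ 0 := by rw [hJ]; norm_num
  have hsol : ∀ k, equations H k (testJet H p s v m S) = 0 := by
    intro k
    fin_cases k
    · refine (equations_zero _ _).trans ?_
      rw [hJ]
      simp [presX, testJet]
      linear_combination (-2 * S 1 1 - 2 * S 0 0) * hs
    · refine (equations_one _ _).trans ?_
      rw [hJ]
      simp [presY, testJet]
      linear_combination (-2 * S 0 1 - 2 * S 1 2) * hs
  have hsymm : ∀ k i j, (testJet H p s v m S).2 k i j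
      = (testJet H p s v m S).2 k j i := by
    intro k i j
    fin_cases k <;> fin_cases i <;> fin_cases j <;> rfl
  have key := h.2 (testJet H p s v m S) hp hsymm hJ' hsol
  have k0 := key 0
  have k1 := key 1
  rw [fderiv_equations_zero hH hJ', hJ] at k0
  rw [fderiv_equations_one hH hJ', hJ] at k1
  simp only [prolongation, dJacobian] at k0 k1
  generalize prolong₂ X 0 0 0 (testJet H p s v m S) = a1 at *
  generalize prolong₂ X 1 0 0 (testJet H p s v m S) = a2 at *
  generalize prolong₂ X 0 1 1 (testJet H p s v m S) = a3 at *
  generalize prolong₂ X 0 1 2 (testJet H p s v m S) = a4 at *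
  generalize prolong₂ X 0 2 2 (testJet H p s v m S) = a5 at *
  generalize prolong₂ X 1 1 1 (testJet H p s v m S) = a6 at *
  generalize prolong₂ X 1 1 2 (testJet H p s v m S) = a7 at *
  generalize prolong₂ X 1 2 2 (testJet H p s v m S) = a8 at *
  generalize prolong₁ X 0 1 (testJet H p s v m S).1 = n11 at *
  generalize prolong₁ X 0 2 (testJet H p s v m S).1 = n12 at *
  generalize prolong₁ X 1 1 (testJet H p s v m S).1 = n21 at *
  generalize prolong₁ X 1 2 (testJet H p s v m S).1 = n22 at *
  simp only [presX, presY, dPresX, dPresY, testJet, Matrix.cons_val_zero,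
    Matrix.cons_val_one, Matrix.cons_val] at k0 k1
  change _ - (compU X 0 p * _ + compU X 1 p * _) = 0 at k0
  change _ - (compU X 0 p * _ + compU X 1 p * _) = 0 at k1
  constructor
  · linear_combination k0 + (-6 * s * (n11 + n22) * (S 0 0 + S 1 1) + 2 * (a3 + a7)) * hs
  · linear_combination k1 + (-6 * s * (n11 + n22) * (S 0 1 + S 1 2) + 2 * (a4 + a8)) * hs

/-! ### Admitted vector fields are projectable -/

lemma Admitted.contDiffAt {H : ℝ × ℝ → ℝ} {Ω : Set Base} {X : VField} (h : Admitted H Ω X)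
    (hΩ : IsOpen Ω) {p : Base} (hp : p ∈ Ω) : ContDiffAt ℝ ∞ X p :=
  (h.1 p hp).contDiffAt (hΩ.mem_nhds hp)

/-- The coefficients of the mixed derivatives `u^k_{ta}`, `u^k_{tb}` in the invariance condition:
`ξ^t` depends on `t` only. -/
lemma Admitted.dd_compS_zero {H : ℝ × ℝ → ℝ} {Ω : Set Base} {X : VField} (h : Admitted H Ω X)
    (hΩ : IsOpen Ω) {p : Base} (hp : p ∈ Ω) (hH : ContDiffAt ℝ ∞ H (pos p)) :
    dd (eS 1) (compS X 0) p = 0 ∧ dd (eS 2) (compS X 0) p = 0 ∧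
    dd (eU 0) (compS X 0) p = 0 ∧ dd (eU 1) (compS X 0) p = 0 := by
  have hX := h.contDiffAt hΩ hp
  have e := fun (s : ℝ) (m : Fin 2 → Fin 2 → ℝ) (k : Fin 2) (i j : Fin 3) =>
    prolong₂_compU (z := testJet H p s 0 m 0) hX k i j
  have kp := fun (m : Fin 2 → Fin 2 → ℝ) => (h.at_testJet hp hH (s := 1) (by norm_num) 0 m 0).1
  have kn := fun (m : Fin 2 → Fin 2 → ℝ) => (h.at_testJet hp hH (s := -1) (by norm_num) 0 m 0).1
  simp only [e, totalDD, totalD_eq, prolong₁_compU, Fin.sum_univ_three] at kp kn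
  simp [testJet] at kp kn
  have p0 := kp 0
  have p1 := kp ![0, ![1, 0]]
  have p2 := kp ![0, ![0, 1]]
  have n0 := kn 0
  have n1 := kn ![0, ![1, 0]]
  have n2 := kn ![0, ![0, 1]]
  simp at p0 p1 p2 n0 n1 n2
  refine ⟨?_, ?_, ?_, ?_⟩ <;> linarith

/-- The coefficients of the mixed derivatives `u^k_{ta}`, `u^k_{tb}` in the invariance condition,
for arbitrary velocities: `ξ^a` and `ξ^b` depend on `(a, b)` only. -/
lemma Admitted.dd_compS_one_two {H : ℝ × ℝ → ℝ} {Ω : Set Base} {X : VField}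
    (h : Admitted H Ω X)
    (hΩ : IsOpen Ω) {p : Base} (hp : p ∈ Ω) (hH : ContDiffAt ℝ ∞ H (pos p)) :
    (dd (eS 0) (compS X 1) p = 0 ∧ dd (eU 0) (compS X 1) p = 0 ∧ dd (eU 1) (compS X 1) p = 0) ∧
    dd (eS 0) (compS X 2) p = 0 ∧ dd (eU 0) (compS X 2) p = 0 ∧ dd (eU 1) (compS X 2) p = 0 := by
  have hX := h.contDiffAt hΩ hp
  obtain ⟨z1, z2, z3, z4⟩ := h.dd_compS_zero hΩ hp hH
  have e := fun (v : Fin 2 → ℝ) (m : Fin 2 → Fin 2 → ℝ) (k : Fin 2) (i j : Fin 3) =>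
    prolong₂_compU (z := testJet H p 1 v m 0) hX k i j
  have kp := fun (v : Fin 2 → ℝ) (m : Fin 2 → Fin 2 → ℝ) =>
    (h.at_testJet hp hH (s := 1) (by norm_num) v m 0).1
  simp only [e, totalDD, totalD_eq, prolong₁_compU, Fin.sum_univ_three] at kp
  simp [testJet, z1, z2, z3, z4] at kp
  have p0 := kp ![0, 0] 0
  have p1 := kp ![0, 0] ![![1, 0], 0]
  have p2 := kp ![0, 0] ![![0, 1], 0]
  have q0 := kp ![1, 0] 0
  have q1 := kp ![1, 0] ![![1, 0], 0]
  have q2 := kp ![1, 0] ![![0, 1], 0]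
  have r0 := kp ![0, 1] 0
  have r1 := kp ![0, 1] ![![1, 0], 0]
  have r2 := kp ![0, 1] ![![0, 1], 0]
  simp at p0 p1 p2 q0 q1 q2 r0 r1 r2
  have t1 : dd (eS 0) (compS X 1) p = 0 := by linarith
  have t2 : dd (eS 0) (compS X 2) p = 0 := by linarith
  refine ⟨⟨t1, ?_, ?_⟩, t2, ?_, ?_⟩ <;> linarith

lemma dd_dd_eq_zero {f : Base → ℝ} {Ω : Set Base} (hΩ : IsOpen Ω) {v : Base}
    (hv : ∀ q ∈ Ω, dd v f q = 0) {p : Base} (hp : p ∈ Ω) (hf : ContDiffAt ℝ ∞ f p) :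
    (∀ w, dd w (dd v f) p = 0) ∧ ∀ w, dd v (dd w f) p = 0 := by
  have h : ∀ w, dd w (dd v f) p = 0 := fun w => by
    rw [dd_congr hΩ (g := fun _ => 0) hv w hp, dd_const]
  exact ⟨h, fun w => by rw [dd_comm hf, h]⟩

/-- `X` is a smooth vector field on `Ω` with `ξ^t = ξ^t(t)`, `ξ^a = ξ^a(a, b)` and
`ξ^b = ξ^b(a, b)`, expressed by the vanishing of derivatives. -/
structure Projectable (Ω : Set Base) (X : VField) : Prop where
  contDiffAt : ∀ p ∈ Ω, ContDiffAt ℝ ∞ X p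
  time : ∀ p ∈ Ω, dd (eS 1) (compS X 0) p = 0 ∧ dd (eS 2) (compS X 0) p = 0 ∧
    dd (eU 0) (compS X 0) p = 0 ∧ dd (eU 1) (compS X 0) p = 0
  label : ∀ p ∈ Ω, ∀ l : Fin 3, l ≠ 0 → dd (eS 0) (compS X l) p = 0 ∧
    dd (eU 0) (compS X l) p = 0 ∧ dd (eU 1) (compS X l) p = 0

lemma Admitted.projectable {H : ℝ × ℝ → ℝ} {Ω : Set Base} {X : VField} (h : Admitted H Ω X)
    (hΩ : IsOpen Ω) (hH : ∀ q ∈ Ω, ContDiffAt ℝ ∞ H (pos q)) : Projectable Ω X where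
  contDiffAt p hp := h.contDiffAt hΩ hp
  time p hp := h.dd_compS_zero hΩ hp (hH p hp)
  label p hp l hl := by
    have := h.dd_compS_one_two hΩ hp (hH p hp)
    fin_cases l
    · exact absurd rfl hl
    · exact this.1
    · exact this.2

/-- The prolonged coefficients of a projectable vector field. -/
lemma Projectable.prolong_eqs {Ω : Set Base} {X : VField} (h : Projectable Ω X)
    (hΩ : IsOpen Ω) {z : Jet2} (hz : z.1.1 ∈ Ω) (k : Fin 2) :
    (∀ i : Fin 3, i ≠ 0 → prolong₁ X k i z.1 = totalD (compU X k) i z.1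
      - (z.1.2 k 1 * dd (eS i) (compS X 1) z.1.1 + z.1.2 k 2 * dd (eS i) (compS X 2) z.1.1)) ∧
    prolong₂ X k 0 0 z = totalDD (compU X k) 0 0 z
      - z.1.2 k 0 * dd (eS 0) (dd (eS 0) (compS X 0)) z.1.1
      - 2 * z.2 k 0 0 * dd (eS 0) (compS X 0) z.1.1 ∧
    ∀ i j : Fin 3, i ≠ 0 → j ≠ 0 → prolong₂ X k i j z = totalDD (compU X k) i j z
      - (z.1.2 k 1 * dd (eS j) (dd (eS i) (compS X 1)) z.1.1
        + z.1.2 k 2 * dd (eS j) (dd (eS i) (compS X 2)) z.1.1)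
      - (z.2 k 1 j * dd (eS i) (compS X 1) z.1.1 + z.2 k 2 j * dd (eS i) (compS X 2) z.1.1)
      - (z.2 k i 1 * dd (eS j) (compS X 1) z.1.1
        + z.2 k i 2 * dd (eS j) (compS X 2) z.1.1) := by
  have hX := h.contDiffAt _ hz
  obtain ⟨a1, a2, a3, a4⟩ := h.time _ hz
  obtain ⟨b1, b2, b3⟩ := h.label _ hz 1 (by decide)
  obtain ⟨c1, c2, c3⟩ := h.label _ hz 2 (by decide)
  have A1 := dd_dd_eq_zero hΩ (fun q hq => (h.time q hq).1) hz (contDiffAt_compS hX 0)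
  have A2 := dd_dd_eq_zero hΩ (fun q hq => (h.time q hq).2.1) hz (contDiffAt_compS hX 0)
  have A3 := dd_dd_eq_zero hΩ (fun q hq => (h.time q hq).2.2.1) hz (contDiffAt_compS hX 0)
  have A4 := dd_dd_eq_zero hΩ (fun q hq => (h.time q hq).2.2.2) hz (contDiffAt_compS hX 0)
  have B1 := dd_dd_eq_zero hΩ (fun q hq => (h.label q hq 1 (by decide)).1) hz
    (contDiffAt_compS hX 1)
  have B2 := dd_dd_eq_zero hΩ (fun q hq => (h.label q hq 1 (by decide)).2.1) hz
    (contDiffAt_compS hX 1)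
  have B3 := dd_dd_eq_zero hΩ (fun q hq => (h.label q hq 1 (by decide)).2.2) hz
    (contDiffAt_compS hX 1)
  have C1 := dd_dd_eq_zero hΩ (fun q hq => (h.label q hq 2 (by decide)).1) hz
    (contDiffAt_compS hX 2)
  have C2 := dd_dd_eq_zero hΩ (fun q hq => (h.label q hq 2 (by decide)).2.1) hz
    (contDiffAt_compS hX 2)
  have C3 := dd_dd_eq_zero hΩ (fun q hq => (h.label q hq 2 (by decide)).2.2) hz
    (contDiffAt_compS hX 2)
  have ti : ∀ i : Fin 3, i ≠ 0 → totalD (compS X 0) i z.1 = 0 := by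
    intro i hi
    rw [totalD_eq, a3, a4]
    fin_cases i
    · exact absurd rfl hi
    · simp [a1]
    · simp [a2]
  have t0 : totalD (compS X 0) 0 z.1 = dd (eS 0) (compS X 0) z.1.1 := by
    rw [totalD_eq, a3, a4]; ring
  have u1 : ∀ i, totalD (compS X 1) i z.1 = dd (eS i) (compS X 1) z.1.1 := fun i => by
    rw [totalD_eq, b2, b3]; ring
  have u2 : ∀ i, totalD (compS X 2) i z.1 = dd (eS i) (compS X 2) z.1.1 := fun i => by
    rw [totalD_eq, c2, c3]; ring
  have T0 : ∀ i j, totalDD (compS X 0) i j z = dd (eS j) (dd (eS i) (compS X 0)) z.1.1 :=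
    fun i j => by
      simp only [totalDD, totalD_eq, a3, a4, A3.1, A3.2, A4.1, A4.2]; ring
  have T1 : ∀ i j, totalDD (compS X 1) i j z = dd (eS j) (dd (eS i) (compS X 1)) z.1.1 :=
    fun i j => by
      simp only [totalDD, totalD_eq, b2, b3, B2.1, B2.2, B3.1, B3.2]; ring
  have T2 : ∀ i j, totalDD (compS X 2) i j z = dd (eS j) (dd (eS i) (compS X 2)) z.1.1 :=
    fun i j => by
      simp only [totalDD, totalD_eq, c2, c3, C2.1, C2.2, C3.1, C3.2]; ring
  refine ⟨fun i hi => ?_, ?_, fun i j hi hj => ?_⟩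
  · rw [prolong₁_compU, Fin.sum_univ_three, ti i hi, u1, u2]; ring
  · rw [prolong₂_compU hX, Fin.sum_univ_three, Fin.sum_univ_three, T0, T1, T2, t0, u1, u2, b1, c1,
      B1.1, C1.1]
    ring
  · have T0' : dd (eS j) (dd (eS i) (compS X 0)) z.1.1 = 0 := by
      fin_cases i
      · exact absurd rfl hi
      · exact A1.1 _
      · exact A2.1 _
    rw [prolong₂_compU hX, Fin.sum_univ_three, Fin.sum_univ_three, T0, T1, T2, ti i hi, ti j hj,
      u1, u2, u1, u2, T0']
    ring

/-! ### The determining equations -/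

/-- The coefficients in the invariance condition that are odd under the reversal of the
spatial first derivatives and linear in the second ones: `η^x` and `η^y` do not depend on `a`,
`b`. -/
lemma Admitted.dd_compU {H : ℝ × ℝ → ℝ} {Ω : Set Base} {X : VField} (h : Admitted H Ω X)
    (hΩ : IsOpen Ω) (hH : ∀ q ∈ Ω, ContDiffAt ℝ ∞ H (pos q)) {p : Base} (hp : p ∈ Ω) (k : Fin 2) :
    dd (eS 1) (compU X k) p = 0 ∧ dd (eS 2) (compU X k) p = 0 := by
  have e1 := fun (s : ℝ) (S : Fin 2 → Fin 3 → ℝ) (k : Fin 2) =>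
    ((h.projectable hΩ hH).prolong_eqs hΩ (z := testJet H p s 0 0 S) hp k).1 1 (by decide)
  have e2 := fun (s : ℝ) (S : Fin 2 → Fin 3 → ℝ) (k : Fin 2) =>
    ((h.projectable hΩ hH).prolong_eqs hΩ (z := testJet H p s 0 0 S) hp k).1 2 (by decide)
  have e00 := fun (s : ℝ) (S : Fin 2 → Fin 3 → ℝ) (k : Fin 2) =>
    ((h.projectable hΩ hH).prolong_eqs hΩ (z := testJet H p s 0 0 S) hp k).2.1
  have e11 := fun (s : ℝ) (S : Fin 2 → Fin 3 → ℝ) (k : Fin 2) =>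
    ((h.projectable hΩ hH).prolong_eqs hΩ (z := testJet H p s 0 0 S) hp k).2.2
      1 1 (by decide) (by decide)
  have e12 := fun (s : ℝ) (S : Fin 2 → Fin 3 → ℝ) (k : Fin 2) =>
    ((h.projectable hΩ hH).prolong_eqs hΩ (z := testJet H p s 0 0 S) hp k).2.2
      1 2 (by decide) (by decide)
  have kp := fun (S : Fin 2 → Fin 3 → ℝ) =>
    (h.at_testJet hp (hH p hp) (s := 1) (by norm_num) 0 0 S).1
  have kn := fun (S : Fin 2 → Fin 3 → ℝ) =>
    (h.at_testJet hp (hH p hp) (s := -1) (by norm_num) 0 0 S).1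
  simp only [e1, e2, e00, e11, e12, totalDD, totalD_eq] at kp kn
  simp [testJet] at kp kn
  have p0 := kp 0
  have p1 := kp ![![0, 0, 0], ![0, 0, 1]]
  have p2 := kp ![![0, 0, 0], ![1, 0, 0]]
  have p3 := kp ![![0, 0, 0], ![0, 1, 0]]
  have p4 := kp ![![1, 0, 0], ![0, 0, 0]]
  have n0 := kn 0
  have n1 := kn ![![0, 0, 0], ![0, 0, 1]]
  have n2 := kn ![![0, 0, 0], ![1, 0, 0]]
  have n3 := kn ![![0, 0, 0], ![0, 1, 0]]
  have n4 := kn ![![1, 0, 0], ![0, 0, 0]]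
  simp at p0 p1 p2 p3 p4 n0 n1 n2 n3 n4
  have r1 : dd (eS 1) (compU X 1) p = 0 := by linear_combination (p1 - p0 - n1 + n0) / 4
  have r2 : dd (eS 2) (compU X 0) p = 0 := by linear_combination (p2 - p0 - n2 + n0) / 4
  have r3 : dd (eS 1) (compU X 0) p + dd (eS 2) (compU X 1) p = 0 := by
    linear_combination (p3 - p0 - n3 + n0) / 8
  have r4 : dd (eS 2) (compU X 1) p = 0 := by
    linear_combination -(p4 - p0 - n4 + n0) / 8 + 3 / 2 * r3
  have r5 : dd (eS 1) (compU X 0) p = 0 := by linear_combination r3 - r4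
  fin_cases k
  · exact ⟨r5, r2⟩
  · exact ⟨r1, r4⟩

/-- The determining equations for a projectable vector field at a point of the base: `η` does not
depend on the labels (`label`), the divergence of `(ξ^a, ξ^b)` is constant (`div`), the derivatives
of `η` in the position depend on the time only (`second_x`, `second_y`) and form a conformal matrix
(`conformal`), and two equations involve the bottom. -/
structure DeterminingAt (H : ℝ × ℝ → ℝ) (X : VField) (p : Base) : Prop where
  label : ∀ k, dd (eS 1) (compU X k) p = 0 ∧ dd (eS 2) (compU X k) p = 0
  div : dd (eS 1) (dd (eS 1) (compS X 1)) p + dd (eS 2) (dd (eS 1) (compS X 2)) p = 0 ∧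
    dd (eS 2) (dd (eS 1) (compS X 1)) p + dd (eS 2) (dd (eS 2) (compS X 2)) p = 0
  second_x : 2 * dd (eU 0) (dd (eS 0) (compU X 0)) p = dd (eS 0) (dd (eS 0) (compS X 0)) p ∧
    dd (eU 1) (dd (eS 0) (compU X 0)) p = 0 ∧ dd (eU 0) (dd (eU 0) (compU X 0)) p = 0 ∧
    dd (eU 1) (dd (eU 0) (compU X 0)) p = 0 ∧ dd (eU 1) (dd (eU 1) (compU X 0)) p = 0
  second_y : 2 * dd (eU 1) (dd (eS 0) (compU X 1)) p = dd (eS 0) (dd (eS 0) (compS X 0)) p ∧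
    dd (eU 0) (dd (eS 0) (compU X 1)) p = 0 ∧ dd (eU 0) (dd (eU 0) (compU X 1)) p = 0 ∧
    dd (eU 1) (dd (eU 0) (compU X 1)) p = 0 ∧ dd (eU 1) (dd (eU 1) (compU X 1)) p = 0
  conformal : dd (eU 0) (compU X 0) p = dd (eS 0) (compS X 0) p / 2
        + (dd (eS 1) (compS X 1) p + dd (eS 2) (compS X 2) p) / 4 ∧
    dd (eU 1) (compU X 1) p = dd (eS 0) (compS X 0) p / 2
        + (dd (eS 1) (compS X 1) p + dd (eS 2) (compS X 2) p) / 4 ∧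
    dd (eU 0) (compU X 1) p = -dd (eU 1) (compU X 0) p
  bottom_x : dd (eS 0) (dd (eS 0) (compU X 0)) p + dd (eU 0) (compU X 0) p * pd₁ H (pos p)
      + dd (eU 1) (compU X 0) p * pd₂ H (pos p) - 2 * dd (eS 0) (compS X 0) p * pd₁ H (pos p)
      - (compU X 0 p * pd₁ (pd₁ H) (pos p) + compU X 1 p * pd₂ (pd₁ H) (pos p)) = 0
  bottom_y : dd (eS 0) (dd (eS 0) (compU X 1)) p + dd (eU 0) (compU X 1) p * pd₁ H (pos p)
      + dd (eU 1) (compU X 1) p * pd₂ H (pos p) - 2 * dd (eS 0) (compS X 0) p * pd₂ H (pos p)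
      - (compU X 0 p * pd₁ (pd₂ H) (pos p) + compU X 1 p * pd₂ (pd₂ H) (pos p)) = 0

/-- The determining equations are the coefficients of the invariance condition at `testJet`: its
part odd in `s` gives `div`, the parts quadratic and linear in the velocity give `second_x` and
`second_y`, the coefficients of the spatial second derivatives give `conformal`, and the rest gives
the equations for the bottom. -/
lemma Admitted.determiningAt {H : ℝ × ℝ → ℝ} {Ω : Set Base} {X : VField} (h : Admitted H Ω X)
    (hΩ : IsOpen Ω) (hH : ∀ q ∈ Ω, ContDiffAt ℝ ∞ H (pos q)) {p : Base} (hp : p ∈ Ω) :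
    DeterminingAt H X p := by
  have hX := h.contDiffAt hΩ hp
  have f1 := fun k => (h.dd_compU hΩ hH hp k).1
  have f2 := fun k => (h.dd_compU hΩ hH hp k).2
  have F1 := fun k => dd_dd_eq_zero hΩ (fun q hq => (h.dd_compU hΩ hH hq k).1) hp
    (contDiffAt_compU hX k)
  have F2 := fun k => dd_dd_eq_zero hΩ (fun q hq => (h.dd_compU hΩ hH hq k).2) hp
    (contDiffAt_compU hX k)
  have e1 := fun (s : ℝ) (v : Fin 2 → ℝ) (S : Fin 2 → Fin 3 → ℝ) (k : Fin 2) =>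
    ((h.projectable hΩ hH).prolong_eqs hΩ (z := testJet H p s v 0 S) hp k).1 1 (by decide)
  have e2 := fun (s : ℝ) (v : Fin 2 → ℝ) (S : Fin 2 → Fin 3 → ℝ) (k : Fin 2) =>
    ((h.projectable hΩ hH).prolong_eqs hΩ (z := testJet H p s v 0 S) hp k).1 2 (by decide)
  have e00 := fun (s : ℝ) (v : Fin 2 → ℝ) (S : Fin 2 → Fin 3 → ℝ) (k : Fin 2) =>
    ((h.projectable hΩ hH).prolong_eqs hΩ (z := testJet H p s v 0 S) hp k).2.1
  have e11 := fun (s : ℝ) (v : Fin 2 → ℝ) (S : Fin 2 → Fin 3 → ℝ) (k : Fin 2) =>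
    ((h.projectable hΩ hH).prolong_eqs hΩ (z := testJet H p s v 0 S) hp k).2.2
      1 1 (by decide) (by decide)
  have e12 := fun (s : ℝ) (v : Fin 2 → ℝ) (S : Fin 2 → Fin 3 → ℝ) (k : Fin 2) =>
    ((h.projectable hΩ hH).prolong_eqs hΩ (z := testJet H p s v 0 S) hp k).2.2
      1 2 (by decide) (by decide)
  have e22 := fun (s : ℝ) (v : Fin 2 → ℝ) (S : Fin 2 → Fin 3 → ℝ) (k : Fin 2) =>
    ((h.projectable hΩ hH).prolong_eqs hΩ (z := testJet H p s v 0 S) hp k).2.2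
      2 2 (by decide) (by decide)
  have K := fun (s : ℝ) (hs : s ^ 2 = 1) (v : Fin 2 → ℝ) (S : Fin 2 → Fin 3 → ℝ) =>
    h.at_testJet hp (hH p hp) hs v 0 S
  have k0 := fun v S => (K 1 (by norm_num) v S).1
  have k1 := fun v S => (K 1 (by norm_num) v S).2
  have m0 := (K (-1) (by norm_num) 0 0).1
  have m1 := (K (-1) (by norm_num) 0 0).2
  have c : ∀ k, dd (eS 0) (dd (eU 0) (compU X k)) p = dd (eU 0) (dd (eS 0) (compU X k)) p ∧
      dd (eS 0) (dd (eU 1) (compU X k)) p = dd (eU 1) (dd (eS 0) (compU X k)) p ∧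
      dd (eU 0) (dd (eU 1) (compU X k)) p = dd (eU 1) (dd (eU 0) (compU X k)) p := fun k =>
    ⟨dd_comm (contDiffAt_compU hX k) _ _, dd_comm (contDiffAt_compU hX k) _ _,
      dd_comm (contDiffAt_compU hX k) _ _⟩
  simp only [e1, e2, e00, e11, e12, e22, totalDD, totalD_eq] at k0 k1 m0 m1
  simp [testJet, f1, f2, (F1 _).1, (F1 _).2, (F2 _).1, (F2 _).2, (c _).1, (c _).2.1,
    (c _).2.2] at k0 k1 m0 m1
  have k00 := k0 0 0
  have k10 := k1 0 0
  have vx := k0 ![1, 0] 0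
  have vy := k0 ![0, 1] 0
  have vx' := k0 ![-1, 0] 0
  have vy' := k0 ![0, -1] 0
  have vxy := k0 ![1, 1] 0
  have wx := k1 ![1, 0] 0
  have wy := k1 ![0, 1] 0
  have wx' := k1 ![-1, 0] 0
  have wy' := k1 ![0, -1] 0
  have wxy := k1 ![1, 1] 0
  have s1 := k0 0 ![![1, 0, 0], ![0, 0, 0]]
  have s2 := k0 0 ![![0, 0, 0], ![0, 0, 1]]
  have s3 := k1 0 ![![0, 0, 0], ![0, 0, 1]]
  clear k0 k1
  simp at k00 k10 vx vy vx' vy' vxy wx wy wx' wy' wxy s1 s2 s3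
  -- velocities `±e` separate the terms linear and quadratic in the velocity
  have x1 : dd (eU 0) (dd (eU 0) (compU X 0)) p = 0 := by
    linear_combination (vx + vx' - 2 * k00) / 2
  have x2 : dd (eU 1) (dd (eU 1) (compU X 0)) p = 0 := by
    linear_combination (vy + vy' - 2 * k00) / 2
  have x3 : 2 * dd (eU 0) (dd (eS 0) (compU X 0)) p = dd (eS 0) (dd (eS 0) (compS X 0)) p := by
    linear_combination (vx - vx') / 2
  have x4 : dd (eU 1) (dd (eS 0) (compU X 0)) p = 0 := by
    linear_combination (vy - vy') / 4
  have x5 : dd (eU 1) (dd (eU 0) (compU X 0)) p = 0 := by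
    linear_combination (vxy - vx - vy + k00) / 2
  have y1 : dd (eU 0) (dd (eU 0) (compU X 1)) p = 0 := by
    linear_combination (wx + wx' - 2 * k10) / 2
  have y2 : dd (eU 1) (dd (eU 1) (compU X 1)) p = 0 := by
    linear_combination (wy + wy' - 2 * k10) / 2
  have y3 : 2 * dd (eU 1) (dd (eS 0) (compU X 1)) p = dd (eS 0) (dd (eS 0) (compS X 0)) p := by
    linear_combination (wy - wy') / 2
  have y4 : dd (eU 0) (dd (eS 0) (compU X 1)) p = 0 := by
    linear_combination (wx - wx') / 4
  have y5 : dd (eU 1) (dd (eU 0) (compU X 1)) p = 0 := by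
    linear_combination (wxy - wx - wy + k10) / 2
  have d1 : dd (eS 1) (dd (eS 1) (compS X 1)) p + dd (eS 2) (dd (eS 1) (compS X 2)) p = 0 := by
    linear_combination (k00 - m0) / 4
  have d2 : dd (eS 2) (dd (eS 1) (compS X 1)) p + dd (eS 2) (dd (eS 2) (compS X 2)) p = 0 := by
    linear_combination (k10 - m1) / 4
  refine ⟨h.dd_compU hΩ hH hp, ⟨d1, d2⟩, ⟨x3, x4, x1, x5, x2⟩, ⟨y3, y4, y1, y5, y2⟩,
    ⟨?_, ?_, ?_⟩, ?_, ?_⟩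
  · linear_combination ((s1 - k00) * 3 - (s3 - k10)) / 16
  · linear_combination ((s3 - k10) * 3 - (s1 - k00)) / 16
  · linear_combination (s2 - k00) / 2
  · linear_combination (k00 + m0) / 2 + 2 * (x1 + y5)
  · linear_combination (k10 + m1) / 2 + 2 * (x5 + y2)

/-! ### Sufficiency of the determining equations -/

/-- A projectable vector field which satisfies the determining equations is admitted: its
prolongation sends each equation to a linear combination of the two equations, with the coefficients
`η^x_x - 2 ξ^t_t` and `± η^x_y`, up to the determining equation for the bottom. -/
lemma admitted_of_determiningAt {H : ℝ × ℝ → ℝ} {Ω : Set Base} {X : VField} (hΩ : IsOpen Ω)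
    (hH : ∀ q ∈ Ω, ContDiffAt ℝ ∞ H (pos q)) (hP : Projectable Ω X)
    (hD : ∀ p ∈ Ω, DeterminingAt H X p) : Admitted H Ω X := by
  refine ⟨fun p hp => (hP.contDiffAt p hp).contDiffWithinAt, fun z hz hsymm hJ hE => ?_⟩
  have hX := hP.contDiffAt _ hz
  have D := hD _ hz
  have f1 := fun k => (D.label k).1
  have f2 := fun k => (D.label k).2
  have F1 := fun k => dd_dd_eq_zero hΩ (fun q hq => ((hD q hq).label k).1) hz
    (contDiffAt_compU hX k)
  have F2 := fun k => dd_dd_eq_zero hΩ (fun q hq => ((hD q hq).label k).2) hz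
    (contDiffAt_compU hX k)
  have c : ∀ k v w, dd v (dd w (compU X k)) z.1.1 = dd w (dd v (compU X k)) z.1.1 :=
    fun k => dd_comm (contDiffAt_compU hX k)
  have e1 := fun k => (hP.prolong_eqs hΩ hz k).1 1 (by decide)
  have e2 := fun k => (hP.prolong_eqs hΩ hz k).1 2 (by decide)
  have e00 := fun k => (hP.prolong_eqs hΩ hz k).2.1
  have e11 := fun k => (hP.prolong_eqs hΩ hz k).2.2 1 1 (by decide) (by decide)
  have e12 := fun k => (hP.prolong_eqs hΩ hz k).2.2 1 2 (by decide) (by decide)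
  have e22 := fun k => (hP.prolong_eqs hΩ hz k).2.2 2 2 (by decide) (by decide)
  obtain ⟨d1, d2⟩ := D.div
  obtain ⟨x1, x2, x3, x4, x5⟩ := D.second_x
  obtain ⟨y1, y2, y3, y4, y5⟩ := D.second_y
  obtain ⟨l1, l2, l3⟩ := D.conformal
  have bx := D.bottom_x
  have bz := D.bottom_y
  have E0 := hE 0
  have E1 := hE 1
  rw [equations_zero] at E0
  rw [equations_one] at E1
  have hj : (z.1.2 0 1 * z.1.2 1 2 - z.1.2 0 2 * z.1.2 1 1) * (jacobian z.1)⁻¹ = 1 :=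
    mul_inv_cancel₀ hJ
  have s1 : ∀ k, z.2 k 2 1 = z.2 k 1 2 := fun k => hsymm k 2 1
  have r1 : dd (eS 2) (compS X 2) z.1.1 = 4 * dd (eU 0) (compU X 0) z.1.1
      - 2 * dd (eS 0) (compS X 0) z.1.1 - dd (eS 1) (compS X 1) z.1.1 := by linarith
  have r2 : dd (eU 1) (compU X 1) z.1.1 = dd (eU 0) (compU X 0) z.1.1 := by linarith
  have r3 : dd (eS 2) (dd (eS 1) (compS X 2)) z.1.1
      = -dd (eS 1) (dd (eS 1) (compS X 1)) z.1.1 := by linarith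
  have r4 : dd (eS 2) (dd (eS 2) (compS X 2)) z.1.1
      = -dd (eS 2) (dd (eS 1) (compS X 1)) z.1.1 := by linarith
  have r5 : dd (eU 0) (dd (eS 0) (compU X 0)) z.1.1
      = dd (eS 0) (dd (eS 0) (compS X 0)) z.1.1 / 2 := by linarith
  have r6 : dd (eU 1) (dd (eS 0) (compU X 1)) z.1.1
      = dd (eS 0) (dd (eS 0) (compS X 0)) z.1.1 / 2 := by linarith
  simp only [← inv_pow] at E0 E1
  rw [l3, r2] at bz
  intro k
  fin_cases k
  · refine (fderiv_equations_zero (hH _ hz) hJ _).trans ?_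
    simp only [prolongation, ← inv_pow, dJacobian]
    change _ - (compU X 0 _ * _ + compU X 1 _ * _) = 0
    simp only [e1, e2, e00, e11, e12, e22, totalDD, totalD_eq, f1, f2, (F1 _).1, (F1 _).2,
      (F2 _).1, (F2 _).2, c _ (eS 0) (eU _), x2, x3, x4, x5, y3, y4, y5, s1,
      c _ (eU 0) (eU 1), r1, r2, r3, r4,
      l3, r5]
    generalize (jacobian z.1)⁻¹ = j at *
    simp only [presX, presY, dPresX] at E0 E1 ⊢
    -- the derivative of the Jacobian `J` is a multiple of `J`, and `hj` cancels this factor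
    linear_combination (dd (eU 0) (compU X 0) z.1.1 - 2 * dd (eS 0) (compS X 0) z.1.1) * E0
      + dd (eU 1) (compU X 0) z.1.1 * E1 + bx - 6 * j ^ 3 * (-2 * dd (eU 0) (compU X 0) z.1.1
      + 2 * dd (eS 0) (compS X 0) z.1.1) * (z.1.2 0 1 * z.1.2 1 1 * z.2 1 2 2
      - (z.1.2 1 2 * z.1.2 0 1 + z.1.2 0 2 * z.1.2 1 1) * z.2 1 1 2
      + z.1.2 0 2 * z.2 1 1 1 * z.1.2 1 2 - z.2 0 1 1 * z.1.2 1 2 ^ 2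
      + 2 * z.2 0 1 2 * z.1.2 1 1 * z.1.2 1 2 - z.2 0 2 2 * z.1.2 1 1 ^ 2) * hj
  · refine (fderiv_equations_one (hH _ hz) hJ _).trans ?_
    simp only [prolongation, ← inv_pow, dJacobian]
    change _ - (compU X 0 _ * _ + compU X 1 _ * _) = 0
    simp only [e1, e2, e00, e11, e12, e22, totalDD, totalD_eq, f1, f2, (F1 _).1, (F1 _).2,
      (F2 _).1, (F2 _).2, c _ (eS 0) (eU _), x3, x4, x5, y2, y3, y4, y5, s1,
      c _ (eU 0) (eU 1), r1, r2, r3, r4,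
      l3, r6]
    generalize (jacobian z.1)⁻¹ = j at *
    simp only [presX, presY, dPresY] at E0 E1 ⊢
    linear_combination (dd (eU 0) (compU X 0) z.1.1 - 2 * dd (eS 0) (compS X 0) z.1.1) * E1
      - dd (eU 1) (compU X 0) z.1.1 * E0 + bz - 6 * j ^ 3 * (-2 * dd (eU 0) (compU X 0) z.1.1
      + 2 * dd (eS 0) (compS X 0) z.1.1) * (z.1.2 0 2 * z.1.2 1 2 * z.2 0 1 1
      - (z.1.2 0 1 * z.1.2 1 2 + z.1.2 0 2 * z.1.2 1 1) * z.2 0 1 2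
      + z.1.2 0 1 * z.1.2 1 1 * z.2 0 2 2 - z.1.2 0 2 ^ 2 * z.2 1 1 1
      + 2 * z.1.2 0 1 * z.1.2 0 2 * z.2 1 1 2 - z.1.2 0 1 ^ 2 * z.2 1 2 2) * hj

/-! ### Functions of some of the variables -/

/-- A smooth function on a convex open set whose derivative vanishes along the kernel of a linear
projection `L` is a smooth function of `L`. -/
lemma exists_factor {E F : Type*} [NormedAddCommGroup E] [NormedSpace ℝ E]
    [NormedAddCommGroup F] [NormedSpace ℝ F] {Ω : Set E} (hΩ : IsOpen Ω) (hc : Convex ℝ Ω)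
    (L : E →L[ℝ] F) (R : F →L[ℝ] E) (hLR : ∀ q, L (R q) = q) {f : E → ℝ}
    (hf : ∀ p ∈ Ω, ContDiffAt ℝ ∞ f p)
    (hk : ∀ p ∈ Ω, ∀ v, L v = 0 → fderiv ℝ f p v = 0) :
    ∃ g : F → ℝ, ContDiffOn ℝ ∞ g (L '' Ω) ∧ ∀ p ∈ Ω, f p = g (L p) := by
  have hconst : ∀ p ∈ Ω, ∀ q ∈ Ω, L p = L q → f p = f q := by
    intro p hp q hq h
    obtain ⟨z, hz, e⟩ := domain_mvt (f := f) (s := Ω) (x := p) (y := q)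
      (f' := fun x => fderiv ℝ f x)
      (fun x hx => ((hf x hx).differentiableAt (by simp)).hasFDerivAt.hasFDerivWithinAt) hc hp hq
    rw [hk z (hc.segment_subset hp hq hz) (q - p) (by rw [map_sub, h, sub_self])] at e
    linarith
  have hsec : ∀ q : F, ∃ y : ℝ, ∀ p ∈ Ω, L p = q → f p = y := by
    intro q
    by_cases h : ∃ p ∈ Ω, L p = q
    · obtain ⟨p, hp, rfl⟩ := h
      exact ⟨f p, fun p' hp' e => hconst p' hp' p hp e⟩
    · exact ⟨0, fun p hp e => (h ⟨p, hp, e⟩).elim⟩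
  choose g hg using hsec
  refine ⟨g, ?_, fun p hp => hg _ p hp rfl⟩
  rintro _ ⟨p, hp, rfl⟩
  -- near `L p` the function `g` is `f` composed with the affine section through `p`
  have hs : ContDiff ℝ ∞ (fun q : F => p + R (q - L p)) := by fun_prop
  have hsp : p + R (L p - L p) = p := by simp
  have hev : g =ᶠ[nhds (L p)] fun q => f (p + R (q - L p)) := by
    have : ∀ᶠ q in nhds (L p), p + R (q - L p) ∈ Ω :=
      hs.continuous.continuousAt.eventually_mem (by rw [hsp]; exact hΩ.mem_nhds hp)
    filter_upwards [this] with q hq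
    exact (hg q _ hq (by rw [map_add, hLR]; abel)).symm
  have hfp : ContDiffAt ℝ ∞ f (p + R (L p - L p)) := by rw [hsp]; exact hf p hp
  exact ((hfp.comp (L p) hs.contDiffAt).congr_of_eventuallyEq hev).contDiffWithinAt

/-- The projection to the time. -/
noncomputable def timeL : Base →L[ℝ] ℝ :=
  (ContinuousLinearMap.proj (R := ℝ) (φ := fun _ : Fin 3 => ℝ) 0).comp
    (ContinuousLinearMap.fst ℝ _ _)

/-- The projection to the labels. -/
noncomputable def labelL : Base →L[ℝ] ℝ × ℝ :=
  ((ContinuousLinearMap.proj (R := ℝ) (φ := fun _ : Fin 3 => ℝ) 1).prod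
    (ContinuousLinearMap.proj (R := ℝ) (φ := fun _ : Fin 3 => ℝ) 2)).comp
    (ContinuousLinearMap.fst ℝ _ _)

/-- The projection to the position. -/
noncomputable def posL : Base →L[ℝ] ℝ × ℝ :=
  ((ContinuousLinearMap.proj (R := ℝ) (φ := fun _ : Fin 2 => ℝ) 0).prod
    (ContinuousLinearMap.proj (R := ℝ) (φ := fun _ : Fin 2 => ℝ) 1)).comp
    (ContinuousLinearMap.snd ℝ _ _)

lemma timeL_apply (p : Base) : timeL p = p.1 0 := rfl
lemma labelL_apply (p : Base) : labelL p = (p.1 1, p.1 2) := rfl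
lemma posL_apply (p : Base) : posL p = pos p := rfl

/-- The section of `timeL` along the time axis. -/
noncomputable def timeR : ℝ →L[ℝ] Base := (ContinuousLinearMap.id ℝ ℝ).smulRight (eS 0)

/-- The section of `labelL` along the label axes. -/
noncomputable def labelR : ℝ × ℝ →L[ℝ] Base :=
  (ContinuousLinearMap.fst ℝ ℝ ℝ).smulRight (eS 1)
    + (ContinuousLinearMap.snd ℝ ℝ ℝ).smulRight (eS 2)

/-- The section of `posL` along the position axes. -/
noncomputable def posR : ℝ × ℝ →L[ℝ] Base :=
  (ContinuousLinearMap.fst ℝ ℝ ℝ).smulRight (eU 0)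
    + (ContinuousLinearMap.snd ℝ ℝ ℝ).smulRight (eU 1)

lemma timeL_timeR (t : ℝ) : timeL (timeR t) = t := by
  simp [timeL_apply, timeR, eS]

lemma labelL_labelR (q : ℝ × ℝ) : labelL (labelR q) = q := by
  simp [labelL_apply, labelR, eS]

lemma posL_posR (q : ℝ × ℝ) : posL (posR q) = q := by
  simp [posL_apply, posR, eU, pos]

lemma isOpen_image_of_section {E F : Type*} [NormedAddCommGroup E] [NormedSpace ℝ E]
    [NormedAddCommGroup F] [NormedSpace ℝ F] {Ω : Set E} (hΩ : IsOpen Ω)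
    (L : E →L[ℝ] F) (R : F →L[ℝ] E) (hLR : ∀ q, L (R q) = q) : IsOpen (L '' Ω) := by
  rw [isOpen_iff_mem_nhds]
  rintro _ ⟨p, hp, rfl⟩
  have hs : ContinuousAt (fun q : F => p + R (q - L p)) (L p) := by fun_prop
  have hsp : p + R (L p - L p) = p := by simp
  have : ∀ᶠ q in nhds (L p), p + R (q - L p) ∈ Ω :=
    hs.eventually_mem (by rw [hsp]; exact hΩ.mem_nhds hp)
  filter_upwards [this] with q hq
  exact ⟨_, hq, by rw [map_add, hLR]; abel⟩

lemma isOpen_times {Ω : Set Base} (hΩ : IsOpen Ω) : IsOpen (times Ω) :=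
  isOpen_image_of_section hΩ timeL timeR timeL_timeR

lemma isOpen_labels {Ω : Set Base} (hΩ : IsOpen Ω) : IsOpen (labels Ω) :=
  isOpen_image_of_section hΩ labelL labelR labelL_labelR

lemma isOpen_positions {Ω : Set Base} (hΩ : IsOpen Ω) : IsOpen (positions Ω) :=
  isOpen_image_of_section hΩ posL posR posL_posR

lemma convex_labels {Ω : Set Base} (hc : Convex ℝ Ω) : Convex ℝ (labels Ω) :=
  hc.linear_image labelL.toLinearMap

lemma convex_times {Ω : Set Base} (hc : Convex ℝ Ω) : Convex ℝ (times Ω) :=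
  hc.linear_image timeL.toLinearMap

/-- A function on a convex open set which does not depend on `a, b, x, y` is a function of `t`. -/
lemma exists_function_of_time {Ω : Set Base} (hΩ : IsOpen Ω) (hc : Convex ℝ Ω) {f : Base → ℝ}
    (hf : ∀ p ∈ Ω, ContDiffAt ℝ ∞ f p)
    (hk : ∀ p ∈ Ω, dd (eS 1) f p = 0 ∧ dd (eS 2) f p = 0 ∧ dd (eU 0) f p = 0 ∧ dd (eU 1) f p = 0) :
    ∃ g : ℝ → ℝ, ContDiffOn ℝ ∞ g (times Ω) ∧ ∀ p ∈ Ω, f p = g (p.1 0) := by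
  refine exists_factor hΩ hc timeL timeR timeL_timeR hf fun p hp v hv => ?_
  obtain ⟨h1, h2, h3, h4⟩ := hk p hp
  rw [timeL_apply] at hv
  rw [fderiv_decomp, hv, h1, h2, h3, h4]; ring

/-- A function on a convex open set which does not depend on `t, x, y` is a function of
`(a, b)`. -/
lemma exists_function_of_labels {Ω : Set Base} (hΩ : IsOpen Ω) (hc : Convex ℝ Ω) {f : Base → ℝ}
    (hf : ∀ p ∈ Ω, ContDiffAt ℝ ∞ f p)
    (hk : ∀ p ∈ Ω, dd (eS 0) f p = 0 ∧ dd (eU 0) f p = 0 ∧ dd (eU 1) f p = 0) :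
    ∃ g : ℝ × ℝ → ℝ, ContDiffOn ℝ ∞ g (labels Ω) ∧ ∀ p ∈ Ω, f p = g (p.1 1, p.1 2) := by
  refine exists_factor hΩ hc labelL labelR labelL_labelR hf fun p hp v hv => ?_
  obtain ⟨h1, h3, h4⟩ := hk p hp
  rw [labelL_apply, Prod.mk_eq_zero] at hv
  rw [fderiv_decomp, hv.1, hv.2, h1, h3, h4]; ring

lemma exists_const_of_dd {Ω : Set Base} (hΩ : IsOpen Ω) (hc : Convex ℝ Ω) {f : Base → ℝ}
    (hf : ∀ p ∈ Ω, DifferentiableAt ℝ f p)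
    (hk : ∀ p ∈ Ω, (∀ i, dd (eS i) f p = 0) ∧ ∀ l, dd (eU l) f p = 0) :
    ∃ c : ℝ, ∀ p ∈ Ω, f p = c := by
  refine hΩ.exists_is_const_of_fderiv_eq_zero hc.isPreconnected
    (fun p hp => (hf p hp).differentiableWithinAt) fun p hp => ?_
  refine ContinuousLinearMap.ext fun v => ?_
  rw [fderiv_decomp, (hk p hp).1, (hk p hp).1, (hk p hp).1, (hk p hp).2, (hk p hp).2]
  simp

/-! ### Directional derivatives of functions of some of the variables -/

/-- `f` is differentiable at `p`, with derivative `d` in the direction `v`. -/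
def HasDD (f : Base → ℝ) (v p : Base) (d : ℝ) : Prop := DifferentiableAt ℝ f p ∧ dd v f p = d

lemma _root_.DifferentiableAt.hasDD {f : Base → ℝ} {p : Base} (hf : DifferentiableAt ℝ f p)
    (v : Base) : HasDD f v p (dd v f p) := ⟨hf, rfl⟩

lemma _root_.HasFDerivAt.hasDD {f : Base → ℝ} {p : Base} {f' : Base →L[ℝ] ℝ}
    (hf : HasFDerivAt f f' p) (v : Base) : HasDD f v p (f' v) :=
  ⟨hf.differentiableAt, by rw [dd, hf.fderiv]⟩

lemma hasDD_const (c : ℝ) (v p : Base) : HasDD (fun _ => c) v p 0 :=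
  (hasFDerivAt_const c p).hasDD v

lemma HasDD.add {f g : Base → ℝ} {v p : Base} {d e : ℝ} (hf : HasDD f v p d)
    (hg : HasDD g v p e) : HasDD (fun p => f p + g p) v p (d + e) := by
  rw [← hf.2, ← hg.2]
  exact (hf.1.hasFDerivAt.fun_add hg.1.hasFDerivAt).hasDD v

lemma HasDD.sub {f g : Base → ℝ} {v p : Base} {d e : ℝ} (hf : HasDD f v p d)
    (hg : HasDD g v p e) : HasDD (fun p => f p - g p) v p (d - e) := by
  rw [← hf.2, ← hg.2]
  exact (hf.1.hasFDerivAt.fun_sub hg.1.hasFDerivAt).hasDD v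

lemma HasDD.mul {f g : Base → ℝ} {v p : Base} {d e : ℝ} (hf : HasDD f v p d)
    (hg : HasDD g v p e) : HasDD (fun p => f p * g p) v p (d * g p + f p * e) := by
  refine ⟨hf.1.fun_mul hg.1, ?_⟩
  rw [← hf.2, ← hg.2, dd, fderiv_fun_mul hf.1 hg.1]
  simp only [dd, add_apply, smul_apply, smul_eq_mul]
  ring

lemma hasDD_time {φ : ℝ → ℝ} {p : Base} (hφ : DifferentiableAt ℝ φ (p.1 0)) (v : Base) :
    HasDD (fun p => φ (p.1 0)) v p (v.1 0 * deriv φ (p.1 0)) := by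
  have h : HasFDerivAt (fun p : Base => φ (p.1 0)) ((fderiv ℝ φ (p.1 0)).comp timeL) p :=
    HasFDerivAt.comp (g := φ) p hφ.hasFDerivAt timeL.hasFDerivAt
  convert h.hasDD v using 1
  rw [ContinuousLinearMap.comp_apply, timeL_apply, fderiv_eq_smul_deriv, smul_eq_mul]

lemma hasDD_label {F : ℝ × ℝ → ℝ} {p : Base} (hF : DifferentiableAt ℝ F (p.1 1, p.1 2))
    (v : Base) : HasDD (fun p => F (p.1 1, p.1 2)) v p
      (v.1 1 * pd₁ F (p.1 1, p.1 2) + v.1 2 * pd₂ F (p.1 1, p.1 2)) := by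
  have h : HasFDerivAt (fun p : Base => F (p.1 1, p.1 2))
      ((fderiv ℝ F (p.1 1, p.1 2)).comp labelL) p :=
    HasFDerivAt.comp (g := F) p hF.hasFDerivAt labelL.hasFDerivAt
  convert h.hasDD v using 1
  rw [ContinuousLinearMap.comp_apply, labelL_apply, fderiv_apply_eq_pd]

lemma hasDD_pos {F : ℝ × ℝ → ℝ} {p : Base} (hF : DifferentiableAt ℝ F (pos p)) (v : Base) :
    HasDD (fun p => F (pos p)) v p (v.2 0 * pd₁ F (pos p) + v.2 1 * pd₂ F (pos p)) := by
  have h : HasFDerivAt (fun p : Base => F (pos p)) ((fderiv ℝ F (pos p)).comp posL) p :=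
    HasFDerivAt.comp (g := F) p hF.hasFDerivAt posL.hasFDerivAt
  convert h.hasDD v using 1
  rw [ContinuousLinearMap.comp_apply, posL_apply, fderiv_apply_eq_pd]
  rfl

lemma hasDD_coordU (k : Fin 2) (v p : Base) : HasDD (fun p => p.2 k) v p (v.2 k) := by
  let c : Base →L[ℝ] ℝ := (ContinuousLinearMap.proj (R := ℝ) (φ := fun _ : Fin 2 => ℝ) k).comp
    (ContinuousLinearMap.snd ℝ _ _)
  have h : HasFDerivAt (fun p : Base => p.2 k) c p := c.hasFDerivAt
  exact h.hasDD v

/-! ### The general solution of the homogeneous determining equations -/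

/-- Poincaré's lemma in the plane: a smooth closed form `A da + B db` on a convex open set has a
smooth primitive. -/
lemma exists_potential {D : Set (ℝ × ℝ)} (hD : IsOpen D) (hc : Convex ℝ D) {A B : ℝ × ℝ → ℝ}
    (hA : ContDiffOn ℝ ∞ A D) (hB : ContDiffOn ℝ ∞ B D)
    (hcl : ∀ q ∈ D, pd₂ A q = pd₁ B q) :
    ∃ ψ : ℝ × ℝ → ℝ, ContDiffOn ℝ ∞ ψ D ∧ ∀ q ∈ D, pd₁ ψ q = A q ∧ pd₂ ψ q = B q := by
  let form : ℝ × ℝ → ℝ × ℝ →L[ℝ] ℝ := fun q =>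
    A q • ContinuousLinearMap.fst ℝ ℝ ℝ + B q • ContinuousLinearMap.snd ℝ ℝ ℝ
  have hform : ContDiffOn ℝ ∞ form D :=
    (hA.smul contDiffOn_const).add (hB.smul contDiffOn_const)
  have hdA : ∀ q ∈ D, DifferentiableAt ℝ A q := fun q hq =>
    ((hA q hq).contDiffAt (hD.mem_nhds hq)).differentiableAt (by simp)
  have hdB : ∀ q ∈ D, DifferentiableAt ℝ B q := fun q hq =>
    ((hB q hq).contDiffAt (hD.mem_nhds hq)).differentiableAt (by simp)
  obtain ⟨ψ, hψ⟩ := hc.exists_forall_hasFDerivAt_of_fderiv_symmetric (𝕜 := ℝ) hD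
    (hform.differentiableOn (by simp)) (fun q hq x y => by
      have h : HasFDerivAt form _ q := ((hdA q hq).hasFDerivAt.smul_const
        (ContinuousLinearMap.fst ℝ ℝ ℝ)).add ((hdB q hq).hasFDerivAt.smul_const
        (ContinuousLinearMap.snd ℝ ℝ ℝ))
      rw [h.fderiv]
      simp only [add_apply, ContinuousLinearMap.smulRight_apply,
        smul_apply, ContinuousLinearMap.coe_fst', ContinuousLinearMap.coe_snd',
        smul_eq_mul, fderiv_apply_eq_pd, hcl q hq]
      ring)
  refine ⟨ψ, ?_, fun q hq => ?_⟩
  · rw [contDiffOn_infty_iff_fderiv_of_isOpen hD]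
    exact ⟨fun q hq => (hψ q hq).differentiableAt.differentiableWithinAt,
      hform.congr fun q hq => (hψ q hq).fderiv⟩
  · simp [pd₁, pd₂, (hψ q hq).fderiv, form]

lemma contDiffAt_time {φ : ℝ → ℝ} {Ω : Set Base} (hΩ : IsOpen Ω)
    (hφ : ContDiffOn ℝ ∞ φ (times Ω)) {p : Base} (hp : p ∈ Ω) : ContDiffAt ℝ ∞ φ (p.1 0) :=
  (hφ _ ⟨p, hp, rfl⟩).contDiffAt ((isOpen_times hΩ).mem_nhds ⟨p, hp, rfl⟩)

lemma contDiffAt_label {F : ℝ × ℝ → ℝ} {Ω : Set Base} (hΩ : IsOpen Ω)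
    (hF : ContDiffOn ℝ ∞ F (labels Ω)) {p : Base} (hp : p ∈ Ω) :
    ContDiffAt ℝ ∞ F (p.1 1, p.1 2) :=
  (hF _ ⟨p, hp, rfl⟩).contDiffAt ((isOpen_labels hΩ).mem_nhds ⟨p, hp, rfl⟩)

lemma contDiffAt_position {H : ℝ × ℝ → ℝ} {Ω : Set Base} (hΩ : IsOpen Ω)
    (hH : ContDiffOn ℝ ∞ H (positions Ω)) {p : Base} (hp : p ∈ Ω) :
    ContDiffAt ℝ ∞ H (pos p) :=
  (hH _ ⟨p, hp, rfl⟩).contDiffAt ((isOpen_positions hΩ).mem_nhds ⟨p, hp, rfl⟩)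

lemma contDiffAt_comp_timeL {φ : ℝ → ℝ} {p : Base} (hφ : ContDiffAt ℝ ∞ φ (p.1 0)) :
    ContDiffAt ℝ ∞ (fun p : Base => φ (p.1 0)) p :=
  ContDiffAt.comp (g := φ) p hφ timeL.contDiff.contDiffAt

lemma contDiffAt_comp_labelL {F : ℝ × ℝ → ℝ} {p : Base} (hF : ContDiffAt ℝ ∞ F (p.1 1, p.1 2)) :
    ContDiffAt ℝ ∞ (fun p : Base => F (p.1 1, p.1 2)) p :=
  ContDiffAt.comp (g := F) p hF labelL.contDiff.contDiffAt

lemma contDiffAt_comp_posL {F : ℝ × ℝ → ℝ} {p : Base} (hF : ContDiffAt ℝ ∞ F (pos p)) :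
    ContDiffAt ℝ ∞ (fun p : Base => F (pos p)) p :=
  ContDiffAt.comp (g := F) p hF posL.contDiff.contDiffAt

lemma contDiffAt_deriv {φ : ℝ → ℝ} {t : ℝ} (hφ : ContDiffAt ℝ ∞ φ t) :
    ContDiffAt ℝ ∞ (deriv φ) t := by
  have h : deriv φ = fun s => fderiv ℝ φ s 1 := by ext s; simp
  rw [h]
  exact (hφ.fderiv_right (m := ∞) (by simp)).clm_apply contDiffAt_const

lemma contDiffAt_iteratedDeriv {φ : ℝ → ℝ} {t : ℝ} (hφ : ContDiffAt ℝ ∞ φ t) (n : ℕ) :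
    ContDiffAt ℝ ∞ (iteratedDeriv n φ) t := by
  induction n with
  | zero => simpa using hφ
  | succ n ih => rw [iteratedDeriv_succ]; exact contDiffAt_deriv ih

/-- The function `P(t) x + Q(t) y + g(t)` on the base. -/
def affine (P Q g : ℝ → ℝ) : Base → ℝ := fun p =>
  P (p.1 0) * p.2 0 + Q (p.1 0) * p.2 1 + g (p.1 0)

lemma contDiffAt_affine {P Q g : ℝ → ℝ} {p : Base} (hP : ContDiffAt ℝ ∞ P (p.1 0))
    (hQ : ContDiffAt ℝ ∞ Q (p.1 0)) (hg : ContDiffAt ℝ ∞ g (p.1 0)) :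
    ContDiffAt ℝ ∞ (affine P Q g) p :=
  (((contDiffAt_comp_timeL hP).mul (by fun_prop)).add
    ((contDiffAt_comp_timeL hQ).mul (by fun_prop))).add (contDiffAt_comp_timeL hg)

lemma hasDD_affine {P Q g : ℝ → ℝ} {p : Base} (hP : ContDiffAt ℝ ∞ P (p.1 0))
    (hQ : ContDiffAt ℝ ∞ Q (p.1 0)) (hg : ContDiffAt ℝ ∞ g (p.1 0)) (v : Base) :
    HasDD (affine P Q g) v p (v.1 0 * affine (deriv P) (deriv Q) (deriv g) p
      + v.2 0 * P (p.1 0) + v.2 1 * Q (p.1 0)) := by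
  have h := (((hasDD_time (hP.differentiableAt (by simp)) v).mul (hasDD_coordU 0 v p)).add
    ((hasDD_time (hQ.differentiableAt (by simp)) v).mul (hasDD_coordU 1 v p))).add
    (hasDD_time (hg.differentiableAt (by simp)) v)
  refine ⟨h.1, h.2.trans ?_⟩
  simp only [affine]
  ring

/-- A function which does not depend on the labels and whose derivatives in `x` and `y` are
functions `P` and `Q` of the time is affine in the position. -/
lemma exists_affine {Ω : Set Base} (hΩ : IsOpen Ω) (hc : Convex ℝ Ω) {f : Base → ℝ}
    (hf : ∀ p ∈ Ω, ContDiffAt ℝ ∞ f p) {P Q : ℝ → ℝ} (hP : ContDiffOn ℝ ∞ P (times Ω))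
    (hQ : ContDiffOn ℝ ∞ Q (times Ω))
    (hl : ∀ p ∈ Ω, dd (eS 1) f p = 0 ∧ dd (eS 2) f p = 0)
    (hu : ∀ p ∈ Ω, dd (eU 0) f p = P (p.1 0) ∧ dd (eU 1) f p = Q (p.1 0)) :
    ∃ g : ℝ → ℝ, ContDiffOn ℝ ∞ g (times Ω) ∧ ∀ p ∈ Ω, f p = affine P Q g p := by
  have hA := fun p hp => contDiffAt_affine (g := fun _ => 0) (contDiffAt_time hΩ hP (p := p) hp)
    (contDiffAt_time hΩ hQ hp) contDiffAt_const
  obtain ⟨g, hg, e⟩ := exists_function_of_time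
    (f := fun p => f p - affine P Q (fun _ => 0) p) hΩ hc (fun p hp => (hf p hp).sub (hA p hp))
    (fun p hp => by
      have key := fun v => ((((hf p hp).differentiableAt (by simp)).hasDD v).sub
        (hasDD_affine (g := fun _ => 0) (contDiffAt_time hΩ hP hp) (contDiffAt_time hΩ hQ hp)
          contDiffAt_const v)).2
      simp only [key, (hl p hp).1, (hl p hp).2, (hu p hp).1, (hu p hp).2]
      simp [eS, eU])
  refine ⟨g, hg, fun p hp => ?_⟩
  have := e p hp
  simp only [affine] at this ⊢
  linarith

/-- The components of a projectable vector field which satisfies the determining equations: the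
label components have constant divergence, whence the stream function `ψ`, and `η` is affine in the
position. -/
lemma exists_hasForm {H : ℝ × ℝ → ℝ} {Ω : Set Base} {X : VField} (hΩ : IsOpen Ω)
    (hc : Convex ℝ Ω) (hP : Projectable Ω X) (hD : ∀ p ∈ Ω, DeterminingAt H X p) :
    ∃ (k₁ k₄ : ℝ) (ζ ζ₁ ζ₂ : ℝ → ℝ) (ψ : ℝ × ℝ → ℝ),
      ContDiffOn ℝ ∞ ζ (times Ω) ∧ ContDiffOn ℝ ∞ ζ₁ (times Ω) ∧ ContDiffOn ℝ ∞ ζ₂ (times Ω) ∧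
      ContDiffOn ℝ ∞ ψ (labels Ω) ∧ HasForm Ω X k₁ k₄ ζ ζ₁ ζ₂ ψ := by
  have hS := fun p hp l => contDiffAt_compS (hP.contDiffAt p hp) l
  have hU := fun p hp k => contDiffAt_compU (hP.contDiffAt p hp) k
  -- the time component
  obtain ⟨ζ, hζ, eζ⟩ := exists_function_of_time hΩ hc (fun p hp => hS p hp 0) hP.time
  have dζ : ∀ p ∈ Ω, dd (eS 0) (compS X 0) p = deriv ζ (p.1 0) := fun p hp => by
    rw [dd_congr hΩ eζ _ hp,
      (hasDD_time ((contDiffAt_time hΩ hζ hp).differentiableAt (by simp)) _).2]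
    simp [eS]
  -- the label components, whose divergence is constant
  obtain ⟨F₁, hF₁, e₁⟩ := exists_function_of_labels hΩ hc (fun p hp => hS p hp 1)
    (fun p hp => hP.label p hp 1 (by decide))
  obtain ⟨F₂, hF₂, e₂⟩ := exists_function_of_labels hΩ hc (fun p hp => hS p hp 2)
    (fun p hp => hP.label p hp 2 (by decide))
  have dF : ∀ {l : Fin 3} {F : ℝ × ℝ → ℝ}, ContDiffOn ℝ ∞ F (labels Ω) →
      (∀ p ∈ Ω, compS X l p = F (p.1 1, p.1 2)) → ∀ p ∈ Ω,
      dd (eS 1) (compS X l) p = pd₁ F (p.1 1, p.1 2) ∧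
        dd (eS 2) (compS X l) p = pd₂ F (p.1 1, p.1 2) := fun hF e p hp => by
    rw [dd_congr hΩ e _ hp, dd_congr hΩ e _ hp,
      (hasDD_label ((contDiffAt_label hΩ hF hp).differentiableAt (by simp)) _).2,
      (hasDD_label ((contDiffAt_label hΩ hF hp).differentiableAt (by simp)) _).2]
    simp [eS]
  have hdd : ∀ (l : Fin 3) v, ∀ p ∈ Ω, DifferentiableAt ℝ (dd v (compS X l)) p :=
    fun l v p hp => differentiableAt_dd (hS p hp l) v
  obtain ⟨k, hk⟩ := exists_const_of_dd (f := fun p => dd (eS 1) (compS X 1) p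
      + dd (eS 2) (compS X 2) p) hΩ hc (fun p hp => (hdd _ _ p hp).fun_add (hdd _ _ p hp))
    (fun p hp => by
      have z : ∀ (l : Fin 3), l ≠ 0 → ∀ v, dd (eS 0) (dd v (compS X l)) p = 0 ∧
          dd (eU 0) (dd v (compS X l)) p = 0 ∧ dd (eU 1) (dd v (compS X l)) p = 0 :=
        fun l hl v =>
        ⟨(dd_dd_eq_zero hΩ (fun q hq => (hP.label q hq l hl).1) hp (hS p hp l)).2 v,
          (dd_dd_eq_zero hΩ (fun q hq => (hP.label q hq l hl).2.1) hp (hS p hp l)).2 v,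
          (dd_dd_eq_zero hΩ (fun q hq => (hP.label q hq l hl).2.2) hp (hS p hp l)).2 v⟩
      have hadd := fun v => (((hdd 1 (eS 1) p hp).hasDD v).add ((hdd 2 (eS 2) p hp).hasDD v)).2
      obtain ⟨d1, d2⟩ := (hD p hp).div
      refine ⟨fun i => ?_, fun l => ?_⟩
      · rw [hadd]
        fin_cases i
        · simp [(z 1 (by decide) _).1, (z 2 (by decide) _).1]
        · rw [← d1]; simp [dd_comm (hS p hp 2) (eS 1) (eS 2)]
        · exact d2
      · rw [hadd]
        fin_cases l
        · simp [(z 1 (by decide) _).2.1, (z 2 (by decide) _).2.1]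
        · simp [(z 1 (by decide) _).2.2, (z 2 (by decide) _).2.2])
  obtain ⟨ψ, hψ, eψ⟩ := exists_potential (isOpen_labels hΩ) (convex_labels hc) hF₂
    (B := fun q => k * q.1 - F₁ q) ((contDiffOn_const.mul contDiffOn_fst).sub hF₁) (by
      rintro _ ⟨p, hp, rfl⟩
      have hq := (contDiffAt_label hΩ hF₁ hp).differentiableAt (by simp)
      have h := hk p hp
      simp only [(dF hF₁ e₁ p hp).1, (dF hF₂ e₂ p hp).2] at h
      have : HasFDerivAt (fun q : ℝ × ℝ => k * q.1 - F₁ q) _ (p.1 1, p.1 2) :=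
        (hasFDerivAt_fst.const_mul k).sub hq.hasFDerivAt
      rw [pd₁, this.fderiv]
      simp only [sub_apply, smul_apply,
        ContinuousLinearMap.coe_fst', smul_eq_mul, mul_one]
      change _ = k - pd₁ F₁ _
      linarith)
  -- the skew part of the matrix of `η` is constant
  obtain ⟨k₄, hk₄⟩ := exists_const_of_dd (f := dd (eU 1) (compU X 0)) hΩ hc
    (fun p hp => differentiableAt_dd (hU p hp 0) _) (fun p hp => by
      obtain ⟨-, x2, -, x4, x5⟩ := (hD p hp).second_x
      have c := fun v => dd_comm (hU p hp 0) v (eU 1)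
      refine ⟨fun i => ?_, fun l => ?_⟩
      · fin_cases i
        · exact (c _).trans x2
        · exact (dd_dd_eq_zero hΩ (fun q hq => ((hD q hq).label 0).1) hp (hU p hp 0)).2 _
        · exact (dd_dd_eq_zero hΩ (fun q hq => ((hD q hq).label 0).2) hp (hU p hp 0)).2 _
      · fin_cases l
        · exact (c _).trans x4
        · exact x5)
  have hA : ∀ p ∈ Ω, dd (eU 0) (compU X 0) p = deriv ζ (p.1 0) / 2 + k / 4 ∧
      dd (eU 1) (compU X 1) p = deriv ζ (p.1 0) / 2 + k / 4 ∧
      dd (eU 1) (compU X 0) p = k₄ ∧ dd (eU 0) (compU X 1) p = -k₄ := fun p hp => by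
    obtain ⟨l1, l2, l3⟩ := (hD p hp).conformal
    rw [hk p hp, dζ p hp] at l1 l2
    exact ⟨l1, l2, hk₄ p hp, by rw [l3, hk₄ p hp]⟩
  -- what remains of `η` after subtracting its linear part depends on the time only
  have hP' : ContDiffOn ℝ ∞ (fun t => deriv ζ t / 2 + k / 4) (times Ω) := by
    rintro _ ⟨p, hp, rfl⟩
    exact (((contDiffAt_deriv (contDiffAt_time hΩ hζ hp)).div_const 2).add
      contDiffAt_const).contDiffWithinAt
  obtain ⟨ζ₁, hζ₁, ex⟩ := exists_affine (Q := fun _ => k₄) hΩ hc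
    (fun p hp => hU p hp 0) hP' contDiffOn_const (fun p hp => (hD p hp).label 0)
    (fun p hp => ⟨(hA p hp).1, (hA p hp).2.2.1⟩)
  obtain ⟨ζ₂, hζ₂, ey⟩ := exists_affine (P := fun _ => -k₄) hΩ hc
    (fun p hp => hU p hp 1) contDiffOn_const hP' (fun p hp => (hD p hp).label 1)
    (fun p hp => ⟨(hA p hp).2.2.2, (hA p hp).2.1⟩)
  refine ⟨k / 4, k₄, ζ, ζ₁, ζ₂, ψ, hζ, hζ₁, hζ₂, hψ, fun p hp => ?_⟩
  obtain ⟨p1, p2⟩ := eψ (p.1 1, p.1 2) ⟨p, hp, rfl⟩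
  refine Prod.ext (funext fun i => ?_) (funext fun i => ?_)
  · fin_cases i
    · exact eζ p hp
    · refine (e₁ p hp).trans ?_
      simp [p2]; ring
    · refine (e₂ p hp).trans ?_
      simp [p1]
  · fin_cases i
    · refine (ex p hp).trans ?_
      simp [affine]; ring
    · refine (ey p hp).trans ?_
      simp [affine]; ring

/-! ### The classifying equation -/

/-- The data of a candidate generator are smooth on the projections of `Ω`. -/
structure SmoothData (Ω : Set Base) (ζ ζ₁ ζ₂ : ℝ → ℝ) (ψ : ℝ × ℝ → ℝ) : Prop where
  isOpen : IsOpen Ω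
  time : ContDiffOn ℝ ∞ ζ (times Ω)
  shift₁ : ContDiffOn ℝ ∞ ζ₁ (times Ω)
  shift₂ : ContDiffOn ℝ ∞ ζ₂ (times Ω)
  stream : ContDiffOn ℝ ∞ ψ (labels Ω)

/-- The coefficient `ζ' / 2 + k₁` of the isotropic part of `η`. -/
noncomputable def dilation (ζ : ℝ → ℝ) (k₁ : ℝ) : ℝ → ℝ := fun t => deriv ζ t / 2 + k₁

lemma deriv_dilation (ζ : ℝ → ℝ) (k₁ : ℝ) :
    deriv (dilation ζ k₁) = fun t => iteratedDeriv 2 ζ t / 2 := by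
  ext t
  unfold dilation
  rw [deriv_add_const, deriv_div_const, iteratedDeriv_succ, iteratedDeriv_one]

lemma deriv_deriv_dilation (ζ : ℝ → ℝ) (k₁ : ℝ) :
    deriv (deriv (dilation ζ k₁)) = fun t => iteratedDeriv 3 ζ t / 2 := by
  ext t
  rw [deriv_dilation, deriv_div_const, ← iteratedDeriv_succ]

lemma contDiffAt_dilation {ζ : ℝ → ℝ} {t : ℝ} (h : ContDiffAt ℝ ∞ ζ t) (k₁ : ℝ) :
    ContDiffAt ℝ ∞ (dilation ζ k₁) t :=
  ((contDiffAt_deriv h).div_const 2).add contDiffAt_const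

section
variable {Ω : Set Base} {X : VField} {k₁ k₄ : ℝ} {ζ ζ₁ ζ₂ : ℝ → ℝ} {ψ : ℝ × ℝ → ℝ}

lemma HasForm.compU_zero (h : HasForm Ω X k₁ k₄ ζ ζ₁ ζ₂ ψ) :
    Set.EqOn (compU X 0) (affine (dilation ζ k₁) (fun _ => k₄) ζ₁) Ω := fun p hp => by
  simp [compU, h p hp, affine, dilation]; ring

lemma HasForm.compU_one (h : HasForm Ω X k₁ k₄ ζ ζ₁ ζ₂ ψ) :
    Set.EqOn (compU X 1) (affine (fun _ => -k₄) (dilation ζ k₁) ζ₂) Ω := fun p hp => by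
  simp [compU, h p hp, affine, dilation]; ring

lemma HasForm.compS_zero (h : HasForm Ω X k₁ k₄ ζ ζ₁ ζ₂ ψ) :
    Set.EqOn (compS X 0) (fun p => ζ (p.1 0)) Ω := fun p hp => by simp [compS, h p hp]

lemma HasForm.compS_one (h : HasForm Ω X k₁ k₄ ζ ζ₁ ζ₂ ψ) :
    Set.EqOn (compS X 1) (fun p => (fun q : ℝ × ℝ => 4 * k₁ * q.1 - pd₂ ψ q) (p.1 1, p.1 2)) Ω :=
  fun p hp => by simp [compS, h p hp]; ring

lemma HasForm.compS_two (h : HasForm Ω X k₁ k₄ ζ ζ₁ ζ₂ ψ) :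
    Set.EqOn (compS X 2) (fun p => pd₁ ψ (p.1 1, p.1 2)) Ω := fun p hp => by
  simp [compS, h p hp]

/-- The difference of the two sides of the classifying equation, without the function `q₀(t)`. -/
noncomputable def classifyingDefect (H : ℝ × ℝ → ℝ) (k₁ k₄ : ℝ) (ζ ζ₁ ζ₂ : ℝ → ℝ) : Base → ℝ :=
  fun p =>
    2 * (affine (dilation ζ k₁) (fun _ => k₄) ζ₁ p * pd₁ H (pos p)
      + affine (fun _ => -k₄) (dilation ζ k₁) ζ₂ p * pd₂ H (pos p))
    - ((4 * k₁ - 2 * deriv ζ (p.1 0)) * H (pos p)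
      + (iteratedDeriv 3 ζ (p.1 0) / 2 * (p.2 0 * p.2 0 + p.2 1 * p.2 1)
        + affine (fun t => 2 * iteratedDeriv 2 ζ₁ t) (fun t => 2 * iteratedDeriv 2 ζ₂ t)
          (fun _ => 0) p))

lemma classifyingEquation_iff (H : ℝ × ℝ → ℝ) (k₁ k₄ : ℝ) (ζ ζ₁ ζ₂ g : ℝ → ℝ) (p : Base) :
    ClassifyingEquation H k₁ k₄ ζ ζ₁ ζ₂ g (p.1 0) (p.2 0) (p.2 1) ↔
      classifyingDefect H k₁ k₄ ζ ζ₁ ζ₂ p = g (p.1 0) := by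
  simp only [ClassifyingEquation, classifyingDefect, affine, dilation, pos]
  constructor <;> intro h <;> linear_combination h

lemma pd_comm {H : ℝ × ℝ → ℝ} {q : ℝ × ℝ} (hH : ContDiffAt ℝ ∞ H q) :
    pd₁ (pd₂ H) q = pd₂ (pd₁ H) q := by
  have h : DifferentiableAt ℝ (fderiv ℝ H) q :=
    (hH.fderiv_right (m := 1) (by norm_cast)).differentiableAt (by norm_num)
  have e : ∀ a b : ℝ × ℝ,
      fderiv ℝ (fun r => fderiv ℝ H r b) q a = fderiv ℝ (fderiv ℝ H) q a b := fun a b => by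
    rw [fderiv_clm_apply h (by fun_prop)]
    simp
  change fderiv ℝ (fun r => fderiv ℝ H r (0, 1)) q (1, 0)
    = fderiv ℝ (fun r => fderiv ℝ H r (1, 0)) q (0, 1)
  rw [e, e]
  refine hH.isSymmSndFDerivAt ?_ _ _
  simp only [minSmoothness_of_isRCLikeNormedField]
  exact WithTop.coe_le_coe.2 (le_top : (2 : ℕ∞) ≤ ⊤)

lemma contDiffAt_classifyingDefect {H : ℝ × ℝ → ℝ} {p : Base} (hH : ContDiffAt ℝ ∞ H (pos p))
    (h : ContDiffAt ℝ ∞ ζ (p.1 0)) (h₁ : ContDiffAt ℝ ∞ ζ₁ (p.1 0))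
    (h₂ : ContDiffAt ℝ ∞ ζ₂ (p.1 0)) :
    ContDiffAt ℝ ∞ (classifyingDefect H k₁ k₄ ζ ζ₁ ζ₂) p := by
  have hd := contDiffAt_dilation h k₁
  have c : ∀ k : Fin 2, ContDiffAt ℝ ∞ (fun p : Base => p.2 k) p := fun k => by fun_prop
  exact (contDiffAt_const.mul (((contDiffAt_affine hd contDiffAt_const h₁).mul
    (contDiffAt_comp_posL (contDiffAt_pd₁ hH))).add ((contDiffAt_affine contDiffAt_const hd h₂).mul
    (contDiffAt_comp_posL (contDiffAt_pd₂ hH))))).sub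
    (((contDiffAt_const.sub (contDiffAt_const.mul (contDiffAt_comp_timeL
      (contDiffAt_deriv h)))).mul (contDiffAt_comp_posL hH)).add
    ((((contDiffAt_comp_timeL (contDiffAt_iteratedDeriv h 3)).div_const 2).mul
      (((c 0).mul (c 0)).add ((c 1).mul (c 1)))).add
    (contDiffAt_affine (contDiffAt_const.mul (contDiffAt_iteratedDeriv h₁ 2))
      (contDiffAt_const.mul (contDiffAt_iteratedDeriv h₂ 2)) contDiffAt_const)))

/-- The derivatives of the classifying equation with respect to the position are the determining
equations for the bottom. -/
lemma dd_classifyingDefect {H : ℝ × ℝ → ℝ} {p : Base} (hH : ContDiffAt ℝ ∞ H (pos p))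
    (h : ContDiffAt ℝ ∞ ζ (p.1 0)) (h₁ : ContDiffAt ℝ ∞ ζ₁ (p.1 0))
    (h₂ : ContDiffAt ℝ ∞ ζ₂ (p.1 0)) (v : Base) (hv : v.1 0 = 0) :
    dd v (classifyingDefect H k₁ k₄ ζ ζ₁ ζ₂) p =
      -2 * v.2 0 * (iteratedDeriv 3 ζ (p.1 0) / 2 * p.2 0 + iteratedDeriv 2 ζ₁ (p.1 0)
        + dilation ζ k₁ (p.1 0) * pd₁ H (pos p) + k₄ * pd₂ H (pos p)
        - 2 * deriv ζ (p.1 0) * pd₁ H (pos p)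
        - (affine (dilation ζ k₁) (fun _ => k₄) ζ₁ p * pd₁ (pd₁ H) (pos p)
          + affine (fun _ => -k₄) (dilation ζ k₁) ζ₂ p * pd₂ (pd₁ H) (pos p)))
      - 2 * v.2 1 * (iteratedDeriv 3 ζ (p.1 0) / 2 * p.2 1 + iteratedDeriv 2 ζ₂ (p.1 0)
        + -k₄ * pd₁ H (pos p) + dilation ζ k₁ (p.1 0) * pd₂ H (pos p)
        - 2 * deriv ζ (p.1 0) * pd₂ H (pos p)
        - (affine (dilation ζ k₁) (fun _ => k₄) ζ₁ p * pd₁ (pd₂ H) (pos p)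
          + affine (fun _ => -k₄) (dilation ζ k₁) ζ₂ p * pd₂ (pd₂ H) (pos p))) := by
  have hd := contDiffAt_dilation h k₁
  have d : ∀ {F : ℝ × ℝ → ℝ}, ContDiffAt ℝ ∞ F (pos p) →
      HasDD (fun p => F (pos p)) v p (v.2 0 * pd₁ F (pos p) + v.2 1 * pd₂ F (pos p)) :=
    fun hF => hasDD_pos (hF.differentiableAt (by simp)) v
  have t : ∀ {φ : ℝ → ℝ}, ContDiffAt ℝ ∞ φ (p.1 0) → HasDD (fun p => φ (p.1 0)) v p 0 :=
    fun {φ} hφ => by simpa [hv] using hasDD_time (hφ.differentiableAt (by simp)) v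
  have c := fun k => hasDD_coordU k v p
  have key := ((hasDD_const 2 v p).mul
    (((hasDD_affine (Q := fun _ => k₄) hd contDiffAt_const h₁ v).mul
    (d (contDiffAt_pd₁ hH))).add ((hasDD_affine (P := fun _ => -k₄) contDiffAt_const hd h₂ v).mul
    (d (contDiffAt_pd₂ hH))))).sub
    (((t (φ := fun t => 4 * k₁ - 2 * deriv ζ t) (contDiffAt_const.sub
      (contDiffAt_const.mul (contDiffAt_deriv h)))).mul (d hH)).add
    (((t (φ := fun t => iteratedDeriv 3 ζ t / 2) ((contDiffAt_iteratedDeriv h 3).div_const 2)).mul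
      (((c 0).mul (c 0)).add ((c 1).mul (c 1)))).add
    (hasDD_affine (P := fun t => 2 * iteratedDeriv 2 ζ₁ t)
      (Q := fun t => 2 * iteratedDeriv 2 ζ₂ t) (g := fun _ => 0)
      (contDiffAt_const.mul (contDiffAt_iteratedDeriv h₁ 2))
      (contDiffAt_const.mul (contDiffAt_iteratedDeriv h₂ 2)) contDiffAt_const v)))
  refine key.2.trans ?_
  rw [hv, pd_comm hH]
  simp only [dilation]
  ring

lemma HasForm.projectable (h : HasForm Ω X k₁ k₄ ζ ζ₁ ζ₂ ψ) (hs : SmoothData Ω ζ ζ₁ ζ₂ ψ) :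
    Projectable Ω X := by
  have hΩ := hs.isOpen
  have cζ := fun p (hp : p ∈ Ω) => contDiffAt_time hΩ hs.time hp
  have cψ := fun p (hp : p ∈ Ω) => contDiffAt_label hΩ hs.stream hp
  have cF : ∀ p ∈ Ω, ContDiffAt ℝ ∞ (fun q : ℝ × ℝ => 4 * k₁ * q.1 - pd₂ ψ q) (p.1 1, p.1 2) :=
    fun p hp => (contDiffAt_const.mul contDiffAt_fst).sub (contDiffAt_pd₂ (cψ p hp))
  refine ⟨fun p hp => ?_, fun p hp => ?_, fun p hp l hl => ?_⟩
  · have ev : ∀ {f g : Base → ℝ}, Set.EqOn f g Ω → ContDiffAt ℝ ∞ g p → ContDiffAt ℝ ∞ f p :=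
      fun e hg => hg.congr_of_eventuallyEq (Filter.eventuallyEq_of_mem (hΩ.mem_nhds hp) e)
    have hd := contDiffAt_dilation (cζ p hp) k₁
    refine ContDiffAt.prodMk (contDiffAt_pi.2 fun i => ?_) (contDiffAt_pi.2 fun i => ?_)
    · fin_cases i
      · exact ev h.compS_zero (contDiffAt_comp_timeL (cζ p hp))
      · exact ev h.compS_one (contDiffAt_comp_labelL (cF p hp))
      · exact ev h.compS_two (contDiffAt_comp_labelL (contDiffAt_pd₁ (cψ p hp)))
    · fin_cases i
      · exact ev h.compU_zero (contDiffAt_affine hd contDiffAt_const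
          (contDiffAt_time hΩ hs.shift₁ hp))
      · exact ev h.compU_one (contDiffAt_affine contDiffAt_const hd
          (contDiffAt_time hΩ hs.shift₂ hp))
  · have e := fun v => (dd_congr hΩ h.compS_zero v hp).trans
      (hasDD_time ((cζ p hp).differentiableAt (by simp)) v).2
    simp only [e]
    simp [eS, eU]
  · fin_cases l
    · exact absurd rfl hl
    · have e := fun v => (dd_congr hΩ h.compS_one v hp).trans
        (hasDD_label ((cF p hp).differentiableAt (by simp)) v).2
      simp only [Fin.mk_one, e]
      simp [eS, eU]
    · have e := fun v => (dd_congr hΩ h.compS_two v hp).trans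
        (hasDD_label ((contDiffAt_pd₁ (cψ p hp)).differentiableAt (by simp)) v).2
      simp only [Fin.reduceFinMk, e]
      simp [eS, eU]

/-- The first and second derivatives of a function which is affine in the position. -/
lemma affine_derivs (hΩ : IsOpen Ω) {f : Base → ℝ} {P Q g : ℝ → ℝ}
    (e : Set.EqOn f (affine P Q g) Ω) (hP : ∀ p ∈ Ω, ContDiffAt ℝ ∞ P (p.1 0))
    (hQ : ∀ p ∈ Ω, ContDiffAt ℝ ∞ Q (p.1 0)) (hg : ∀ p ∈ Ω, ContDiffAt ℝ ∞ g (p.1 0))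
    {p : Base} (hp : p ∈ Ω) :
    (dd (eS 1) f p = 0 ∧ dd (eS 2) f p = 0) ∧
    (dd (eU 0) f p = P (p.1 0) ∧ dd (eU 1) f p = Q (p.1 0)) ∧
    (dd (eU 0) (dd (eU 0) f) p = 0 ∧ dd (eU 1) (dd (eU 0) f) p = 0 ∧
      dd (eU 1) (dd (eU 1) f) p = 0) ∧
    dd (eU 0) (dd (eS 0) f) p = deriv P (p.1 0) ∧ dd (eU 1) (dd (eS 0) f) p = deriv Q (p.1 0) ∧
    dd (eS 0) (dd (eS 0) f) p
      = affine (deriv (deriv P)) (deriv (deriv Q)) (deriv (deriv g)) p := by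
  have e' := fun v q (hq : q ∈ Ω) => (dd_congr hΩ e v hq).trans
    (hasDD_affine (hP q hq) (hQ q hq) (hg q hq) v).2
  have eP : Set.EqOn (dd (eU 0) f) (fun p => P (p.1 0)) Ω := fun q hq => by
    rw [e' _ q hq]; simp [eU]
  have eQ : Set.EqOn (dd (eU 1) f) (fun p => Q (p.1 0)) Ω := fun q hq => by
    rw [e' _ q hq]; simp [eU]
  have et : Set.EqOn (dd (eS 0) f) (affine (deriv P) (deriv Q) (deriv g)) Ω := fun q hq => by
    rw [e' _ q hq]; simp [eS]
  have tP := fun v => (dd_congr hΩ eP v hp).trans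
    (hasDD_time ((hP p hp).differentiableAt (by simp)) v).2
  have tQ := fun v => (dd_congr hΩ eQ v hp).trans
    (hasDD_time ((hQ p hp).differentiableAt (by simp)) v).2
  have tt := fun v => (dd_congr hΩ et v hp).trans (hasDD_affine (contDiffAt_deriv (hP p hp))
    (contDiffAt_deriv (hQ p hp)) (contDiffAt_deriv (hg p hp)) v).2
  refine ⟨⟨?_, ?_⟩, ⟨eP hp, eQ hp⟩, ⟨?_, ?_, ?_⟩, ?_, ?_, ?_⟩ <;>
    simp only [e' _ p hp, tP, tQ, tt] <;> simp [eS, eU]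

/-- For a generator of the stated form, the determining equations hold at `p` if and
only if the position derivatives of the classifying equation do. -/
lemma HasForm.determiningAt_iff {H : ℝ × ℝ → ℝ} (h : HasForm Ω X k₁ k₄ ζ ζ₁ ζ₂ ψ)
    (hs : SmoothData Ω ζ ζ₁ ζ₂ ψ) {p : Base} (hp : p ∈ Ω) (hH : ContDiffAt ℝ ∞ H (pos p)) :
    DeterminingAt H X p ↔ dd (eU 0) (classifyingDefect H k₁ k₄ ζ ζ₁ ζ₂) p = 0 ∧
      dd (eU 1) (classifyingDefect H k₁ k₄ ζ ζ₁ ζ₂) p = 0 := by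
  have hΩ := hs.isOpen
  have hd := fun p (hp : p ∈ Ω) => contDiffAt_dilation (contDiffAt_time hΩ hs.time hp) k₁
  have hX := (h.projectable hs).contDiffAt p hp
  have cψ := fun p (hp : p ∈ Ω) => contDiffAt_label hΩ hs.stream hp
  obtain ⟨x1, ⟨x2, x3⟩, ⟨x4, x5, x6⟩, x7, x8, x9⟩ := affine_derivs hΩ h.compU_zero hd
    (fun p hp => contDiffAt_const) (fun p hp => contDiffAt_time hΩ hs.shift₁ hp) hp
  obtain ⟨y1, ⟨y2, y3⟩, ⟨y4, y5, y6⟩, y7, y8, y9⟩ := affine_derivs hΩ h.compU_one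
    (fun p hp => contDiffAt_const) hd (fun p hp => contDiffAt_time hΩ hs.shift₂ hp) hp
  -- the divergence of the label components is the constant `4 k₁`
  have hdiv : ∀ q ∈ Ω, dd (eS 1) (compS X 1) q + dd (eS 2) (compS X 2) q = 4 * k₁ :=
    fun q hq => by
      have hψ := cψ q hq
      have cF : DifferentiableAt ℝ (fun q : ℝ × ℝ => 4 * k₁ * q.1 - pd₂ ψ q) (q.1 1, q.1 2) :=
        (differentiableAt_fst.const_mul _).fun_sub
          ((contDiffAt_pd₂ hψ).differentiableAt (by simp))
      have e : pd₁ (fun q : ℝ × ℝ => 4 * k₁ * q.1 - pd₂ ψ q) (q.1 1, q.1 2)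
          = 4 * k₁ - pd₁ (pd₂ ψ) (q.1 1, q.1 2) := by
        have : HasFDerivAt (fun q : ℝ × ℝ => 4 * k₁ * q.1 - pd₂ ψ q) _ (q.1 1, q.1 2) :=
          (hasFDerivAt_fst.const_mul (4 * k₁)).sub
            ((contDiffAt_pd₂ hψ).differentiableAt (by simp)).hasFDerivAt
        rw [pd₁, this.fderiv]
        simp [pd₁]
      rw [dd_congr hΩ h.compS_one _ hq, dd_congr hΩ h.compS_two _ hq, (hasDD_label cF _).2,
        (hasDD_label ((contDiffAt_pd₁ hψ).differentiableAt (by simp)) _).2, e, pd_comm hψ]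
      simp [eS]
  have hdiv' : ∀ v, dd v (dd (eS 1) (compS X 1)) p + dd v (dd (eS 2) (compS X 2)) p = 0 :=
    fun v => by
      rw [← (((differentiableAt_dd (contDiffAt_compS hX 1) (eS 1)).hasDD v).add
        ((differentiableAt_dd (contDiffAt_compS hX 2) (eS 2)).hasDD v)).2,
        dd_congr hΩ (g := fun _ => 4 * k₁) hdiv v hp, dd_const]
  have eζ : Set.EqOn (dd (eS 0) (compS X 0)) (fun p => deriv ζ (p.1 0)) Ω := fun q hq => by
    rw [dd_congr hΩ h.compS_zero _ hq, (hasDD_time ((contDiffAt_time hΩ hs.time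
      hq).differentiableAt (by simp)) _).2]
    simp [eS]
  have eζ' : dd (eS 0) (dd (eS 0) (compS X 0)) p = iteratedDeriv 2 ζ (p.1 0) := by
    rw [dd_congr hΩ eζ _ hp, (hasDD_time ((contDiffAt_deriv (contDiffAt_time hΩ hs.time
      hp)).differentiableAt (by simp)) _).2, iteratedDeriv_succ, iteratedDeriv_one]
    simp [eS]
  have i2 : ∀ φ : ℝ → ℝ, deriv (deriv φ) = iteratedDeriv 2 φ := fun φ => by
    rw [iteratedDeriv_succ, iteratedDeriv_one]
  rw [deriv_dilation] at x7 y8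
  rw [deriv_deriv_dilation, i2, i2] at x9 y9
  have cc := fun v => dd_classifyingDefect (k₁ := k₁) (k₄ := k₄) hH
    (contDiffAt_time hΩ hs.time hp) (contDiffAt_time hΩ hs.shift₁ hp)
    (contDiffAt_time hΩ hs.shift₂ hp) v
  rw [cc _ (by simp [eU]), cc _ (by simp [eU]), ← h.compU_zero hp, ← h.compU_one hp]
  have z0 : iteratedDeriv 2 (fun _ : ℝ => k₄) (p.1 0) = 0 := by
    rw [← i2]; simp
  have z1 : iteratedDeriv 2 (fun _ : ℝ => -k₄) (p.1 0) = 0 := by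
    rw [← i2]; simp
  simp only [affine, z0, z1, zero_mul, add_zero, zero_add] at x9 y9
  constructor
  · intro D
    have b1 := D.bottom_x
    have b2 := D.bottom_y
    rw [x9, x2, x3, eζ hp] at b1
    rw [y9, y2, y3, eζ hp] at b2
    simp [eU]
    exact ⟨by linarith, by linarith⟩
  · rintro ⟨b1, b2⟩
    simp [eU] at b1 b2
    refine ⟨fun k => ?_, ⟨?_, hdiv' _⟩, ⟨?_, ?_, x4, x5, x6⟩, ⟨?_, ?_, y4, y5, y6⟩,
      ⟨?_, ?_, ?_⟩, ?_, ?_⟩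
    · fin_cases k
      · exact x1
      · exact y1
    · rw [← dd_comm (contDiffAt_compS hX 2)]; exact hdiv' _
    · rw [x7, eζ']; ring
    · rw [x8]; simp
    · rw [y8, eζ']; ring
    · rw [y7]; simp
    · rw [hdiv p hp, x2, eζ hp, dilation]; ring
    · rw [hdiv p hp, y3, eζ hp, dilation]; ring
    · rw [x3, y2]
    · rw [x9, x2, x3, eζ hp]; linarith
    · rw [y9, y2, y3, eζ hp]; linarith

end

/-- The determining equations reduce to the classifying equation: the equations for the bottom say
that the difference of its two sides does not depend on the position, and `g` is this difference. -/
theorem admitted_iff {Ω : Set Base} (hΩ : IsOpen Ω) (hc : Convex ℝ Ω) {H : ℝ × ℝ → ℝ}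
    (hH : ContDiffOn ℝ ∞ H (positions Ω)) (X : VField) :
    Admitted H Ω X ↔
      ∃ (k₁ k₄ : ℝ) (ζ ζ₁ ζ₂ g : ℝ → ℝ) (ψ : ℝ × ℝ → ℝ),
        ContDiffOn ℝ ∞ ζ (times Ω) ∧ ContDiffOn ℝ ∞ ζ₁ (times Ω) ∧
        ContDiffOn ℝ ∞ ζ₂ (times Ω) ∧ ContDiffOn ℝ ∞ g (times Ω) ∧
        ContDiffOn ℝ ∞ ψ (labels Ω) ∧
        HasForm Ω X k₁ k₄ ζ ζ₁ ζ₂ ψ ∧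
        ∀ p ∈ Ω, ClassifyingEquation H k₁ k₄ ζ ζ₁ ζ₂ g (p.1 0) (p.2 0) (p.2 1) := by
  have hH' := fun p (hp : p ∈ Ω) => contDiffAt_position hΩ hH hp
  constructor
  · intro h
    have hP := h.projectable hΩ hH'
    have hD := fun p (hp : p ∈ Ω) => h.determiningAt hΩ hH' hp
    obtain ⟨k₁, k₄, ζ, ζ₁, ζ₂, ψ, hζ, h₁, h₂, hψ, hX⟩ := exists_hasForm hΩ hc hP hD
    have hs : SmoothData Ω ζ ζ₁ ζ₂ ψ := ⟨hΩ, hζ, h₁, h₂, hψ⟩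
    obtain ⟨g, hg, e⟩ := exists_function_of_time (f := classifyingDefect H k₁ k₄ ζ ζ₁ ζ₂) hΩ hc
      (fun p hp => contDiffAt_classifyingDefect (hH' p hp) (contDiffAt_time hΩ hζ hp)
        (contDiffAt_time hΩ h₁ hp) (contDiffAt_time hΩ h₂ hp))
      (fun p hp => by
        have cc := fun v => dd_classifyingDefect (k₁ := k₁) (k₄ := k₄) (hH' p hp)
          (contDiffAt_time hΩ hζ hp) (contDiffAt_time hΩ h₁ hp) (contDiffAt_time hΩ h₂ hp) v
        refine ⟨?_, ?_, (hX.determiningAt_iff hs hp (hH' p hp)).1 (hD p hp)⟩ <;>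
        · rw [cc _ (by simp [eS])]
          simp [eS])
    exact ⟨k₁, k₄, ζ, ζ₁, ζ₂, g, ψ, hζ, h₁, h₂, hg, hψ, hX, fun p hp =>
      (classifyingEquation_iff ..).2 (e p hp)⟩
  · rintro ⟨k₁, k₄, ζ, ζ₁, ζ₂, g, ψ, hζ, h₁, h₂, hg, hψ, hX, hcl⟩
    have hs : SmoothData Ω ζ ζ₁ ζ₂ ψ := ⟨hΩ, hζ, h₁, h₂, hψ⟩
    refine admitted_of_determiningAt hΩ hH' (hX.projectable hs) fun p hp =>
      (hX.determiningAt_iff hs hp (hH' p hp)).2 ?_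
    have e : Set.EqOn (classifyingDefect H k₁ k₄ ζ ζ₁ ζ₂) (fun p => g (p.1 0)) Ω :=
      fun q hq => (classifyingEquation_iff ..).1 (hcl q hq)
    have hg' := (contDiffAt_time hΩ hg hp).differentiableAt (by simp)
    rw [dd_congr hΩ e _ hp, dd_congr hΩ e _ hp, (hasDD_time hg' _).2, (hasDD_time hg' _).2]
    simp [eU]

/-! ### The kernel and the diagonal quadratic bottoms -/

/-- A polynomial of degree two in the position which vanishes on an open slice is zero. -/
lemma quadratic_eq_zero {Ω : Set Base} (hΩ : IsOpen Ω) {p : Base} (hp : p ∈ Ω)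
    {A B C D E F : ℝ}
    (h : ∀ q ∈ Ω, q.1 = p.1 → A * q.2 0 ^ 2 + B * (q.2 0 * q.2 1) + C * q.2 1 ^ 2
      + D * q.2 0 + E * q.2 1 + F = 0) :
    A = 0 ∧ B = 0 ∧ C = 0 ∧ D = 0 ∧ E = 0 := by
  obtain ⟨r, hr, hball⟩ := Metric.isOpen_iff.1 hΩ p hp
  have key : ∀ a b : ℝ, |a| ≤ 1 → |b| ≤ 1 →
      A * (p.2 0 + a * (r / 2)) ^ 2 + B * ((p.2 0 + a * (r / 2)) * (p.2 1 + b * (r / 2)))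
        + C * (p.2 1 + b * (r / 2)) ^ 2 + D * (p.2 0 + a * (r / 2)) + E * (p.2 1 + b * (r / 2))
        + F = 0 := by
    intro a b ha hb
    refine h (p.1, ![p.2 0 + a * (r / 2), p.2 1 + b * (r / 2)]) (hball ?_) rfl
    rw [Metric.mem_ball, Prod.dist_eq, dist_self, max_lt_iff]
    refine ⟨hr, (dist_pi_lt_iff hr).2 fun i => ?_⟩
    have hlt : ∀ c : ℝ, |c| ≤ 1 → |c * (r / 2)| < r := fun c hc => by
      rw [abs_mul, abs_of_pos (half_pos hr)]
      nlinarith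
    fin_cases i
    · change dist (p.2 0 + a * (r / 2)) (p.2 0) < r
      rw [Real.dist_eq, add_sub_cancel_left]
      exact hlt a ha
    · change dist (p.2 1 + b * (r / 2)) (p.2 1) < r
      rw [Real.dist_eq, add_sub_cancel_left]
      exact hlt b hb
  have k0 := key 0 0 (by simp) (by simp)
  have k1 := key 1 0 (by simp) (by simp)
  have k2 := key (-1) 0 (by simp) (by simp)
  have k3 := key 0 1 (by simp) (by simp)
  have k4 := key 0 (-1) (by simp) (by simp)
  have k5 := key 1 1 (by simp) (by simp)
  have hr2 : (r / 2) ^ 2 ≠ 0 := by positivity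
  have hr1 : r / 2 ≠ 0 := by positivity
  have hA : A = 0 := mul_right_cancel₀ hr2 (by linear_combination (k1 + k2 - 2 * k0) / 2)
  have hC : C = 0 := mul_right_cancel₀ hr2 (by linear_combination (k3 + k4 - 2 * k0) / 2)
  have hB : B = 0 := mul_right_cancel₀ hr2 (by linear_combination k5 - k1 - k3 + k0)
  subst hA hB hC
  exact ⟨rfl, rfl, rfl, mul_right_cancel₀ hr1 (by linear_combination k1 - k0),
    mul_right_cancel₀ hr1 (by linear_combination k3 - k0)⟩

lemma exists_const_of_deriv {S : Set ℝ} (hS : IsOpen S) (hc : Convex ℝ S) {u : ℝ → ℝ}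
    (h : ∀ t ∈ S, HasDerivAt u 0 t) : ∃ c, ∀ t ∈ S, u t = c :=
  hS.exists_is_const_of_deriv_eq_zero hc.isPreconnected
    (fun t ht => (h t ht).differentiableAt.differentiableWithinAt) fun t ht => (h t ht).deriv

/-- Two solutions `c`, `s` of `f'' = μ f`, the hyperbolic or trigonometric functions. -/
lemma exists_fundamental (μ : ℝ) : ∃ c s : ℝ → ℝ, ContDiff ℝ ∞ c ∧ ContDiff ℝ ∞ s ∧
    (∀ t, HasDerivAt c (μ * s t) t) ∧ (∀ t, HasDerivAt s (c t) t) ∧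
    ∀ t, c t ^ 2 - μ * s t ^ 2 = 1 := by
  rcases lt_trichotomy μ 0 with hμ | rfl | hμ
  · have hw : 0 < √(-μ) := Real.sqrt_pos.2 (by linarith)
    have hw2 : √(-μ) ^ 2 = -μ := Real.sq_sqrt (by linarith)
    have hl : ∀ t, HasDerivAt (fun t => √(-μ) * t) (√(-μ)) t := fun t => by
      simpa using (hasDerivAt_id t).const_mul (√(-μ))
    refine ⟨fun t => Real.cos (√(-μ) * t), fun t => Real.sin (√(-μ) * t) / √(-μ),
      by fun_prop, by fun_prop, fun t => ?_, fun t => ?_, fun t => ?_⟩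
    · convert (hl t).cos using 1
      field_simp
      linear_combination Real.sin (√(-μ) * t) * hw2
    · exact ((hl t).sin.div_const _).congr_deriv (mul_div_cancel_right₀ _ hw.ne')
    · have := Real.sin_sq_add_cos_sq (√(-μ) * t)
      have hμ0 : μ ≠ 0 := hμ.ne
      rw [div_pow, hw2]
      field_simp
      linarith
  · exact ⟨fun _ => 1, fun t => t, contDiff_const, contDiff_id,
      fun t => by simpa using hasDerivAt_const t (1 : ℝ), fun t => hasDerivAt_id t, by simp⟩
  · have hw : 0 < √μ := Real.sqrt_pos.2 hμ
    have hw2 : √μ ^ 2 = μ := Real.sq_sqrt hμ.le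
    have hl : ∀ t, HasDerivAt (fun t => √μ * t) (√μ) t := fun t => by
      simpa using (hasDerivAt_id t).const_mul (√μ)
    refine ⟨fun t => Real.cosh (√μ * t), fun t => Real.sinh (√μ * t) / √μ,
      by fun_prop, by fun_prop, fun t => ?_, fun t => ?_, fun t => ?_⟩
    · convert (hl t).cosh using 1
      field_simp
      linear_combination (-Real.sinh (√μ * t)) * hw2
    · exact ((hl t).sinh.div_const _).congr_deriv (mul_div_cancel_right₀ _ hw.ne')
    · have := Real.cosh_sq_sub_sinh_sq (√μ * t)
      rw [div_pow, hw2]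
      field_simp
      linarith

/-- A solution of `f'' = μ f` on an interval extends to the line. The coefficients of `f` in terms
of the fundamental solutions are the Wronskians, which are constant. -/
lemma exists_global_solution {S : Set ℝ} (hS : IsOpen S) (hc : Convex ℝ S) (μ : ℝ) {f : ℝ → ℝ}
    (hf : ContDiffOn ℝ ∞ f S) (hode : ∀ t ∈ S, iteratedDeriv 2 f t = μ * f t) :
    ∃ F : ℝ → ℝ, ContDiff ℝ ∞ F ∧ (∀ t, iteratedDeriv 2 F t = μ * F t) ∧ Set.EqOn f F S := by
  obtain ⟨c, s, hcs, hss, dc, ds, hid⟩ := exists_fundamental μ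
  have hfa : ∀ t ∈ S, ContDiffAt ℝ ∞ f t := fun t ht => (hf t ht).contDiffAt (hS.mem_nhds ht)
  have d1 : ∀ t ∈ S, HasDerivAt f (deriv f t) t := fun t ht =>
    ((hfa t ht).differentiableAt (by simp)).hasDerivAt
  have d2 : ∀ t ∈ S, HasDerivAt (deriv f) (μ * f t) t := fun t ht => by
    rw [← hode t ht, iteratedDeriv_succ, iteratedDeriv_one]
    exact ((contDiffAt_deriv (hfa t ht)).differentiableAt (by simp)).hasDerivAt
  obtain ⟨u, hu⟩ := exists_const_of_deriv (u := fun t => f t * c t - deriv f t * s t) hS hc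
    fun t ht => (((d1 t ht).fun_mul (dc t)).fun_sub ((d2 t ht).fun_mul (ds t))).congr_deriv
      (by ring)
  obtain ⟨v, hv⟩ := exists_const_of_deriv (u := fun t => deriv f t * c t - μ * (f t * s t)) hS hc
    fun t ht => (((d2 t ht).fun_mul (dc t)).fun_sub
      (((d1 t ht).fun_mul (ds t)).const_mul μ)).congr_deriv (by ring)
  have e1 : deriv (fun t => u * c t + v * s t) = fun t => u * (μ * s t) + v * c t :=
    funext fun t => (((dc t).const_mul u).fun_add ((ds t).const_mul v)).deriv
  refine ⟨fun t => u * c t + v * s t, by fun_prop, fun t => ?_, fun t ht => ?_⟩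
  · rw [iteratedDeriv_succ, iteratedDeriv_one, e1]
    refine ((((ds t).const_mul μ).const_mul u).fun_add ((dc t).const_mul v)).deriv.trans ?_
    ring
  · simp only [← hu t ht, ← hv t ht]
    linear_combination (-f t) * hid t

lemma relabelling_neg (ψ : ℝ × ℝ → ℝ) (p : Base) :
    relabelling (fun q => -ψ q) p
      = (![0, -pd₂ ψ (p.1 1, p.1 2), pd₁ ψ (p.1 1, p.1 2)], ![0, 0]) := by
  have h : ∀ q, fderiv ℝ (fun q => -ψ q) q = -fderiv ℝ ψ q := fun q => fderiv_fun_neg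
  simp [relabelling, pd₁, pd₂, h]

/-- A vector field of the stated form with `ζ = c` constant and `k₄ = 0`; the stream function
changes sign, since `HasForm` and `relabelling` have opposite conventions. -/
lemma HasForm.eq_of_const {Ω : Set Base} {X : VField} {k₁ k₄ c : ℝ} {ζ ζ₁ ζ₂ : ℝ → ℝ}
    {ψ : ℝ × ℝ → ℝ} (h : HasForm Ω X k₁ k₄ ζ ζ₁ ζ₂ ψ) {p : Base} (hp : p ∈ Ω)
    (hζ : ζ (p.1 0) = c) (hζ' : deriv ζ (p.1 0) = 0) (hk : k₄ = 0) :
    X p = (c • timeShift + relabelling (fun q => -ψ q)) p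
      + (![0, 4 * k₁ * p.1 1, 0],
        ![k₁ * p.2 0 + ζ₁ (p.1 0), k₁ * p.2 1 + ζ₂ (p.1 0)]) := by
  rw [h p hp, Pi.add_apply, relabelling_neg, hζ, hζ', hk]
  ext i <;> fin_cases i <;> simp [timeShift]

/-- Generators of the form that occurs in the tables: `ζ` and `g` are constant, `k₄ = 0`. -/
lemma admitted_of_eqOn {Ω : Set Base} (hΩ : IsOpen Ω) (hc : Convex ℝ Ω) {H : ℝ × ℝ → ℝ}
    (hH : ContDiff ℝ ∞ H) {X : VField} {c k : ℝ} {ψ : ℝ × ℝ → ℝ} {ζ₁ ζ₂ : ℝ → ℝ}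
    (hψ : ContDiffOn ℝ ∞ ψ (labels Ω)) (h₁ : ContDiff ℝ ∞ ζ₁) (h₂ : ContDiff ℝ ∞ ζ₂) (g : ℝ → ℝ)
    (hg : ContDiff ℝ ∞ g)
    (hX : ∀ p ∈ Ω, X p = (c • timeShift + relabelling ψ) p + (![0, 4 * k * p.1 1, 0],
        ![k * p.2 0 + ζ₁ (p.1 0), k * p.2 1 + ζ₂ (p.1 0)]))
    (hcl : ∀ t x y : ℝ,
      (2 * k * x + 2 * ζ₁ t) * pd₁ H (x, y) + (2 * k * y + 2 * ζ₂ t) * pd₂ H (x, y)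
      = 4 * k * H (x, y) + 2 * iteratedDeriv 2 ζ₁ t * x + 2 * iteratedDeriv 2 ζ₂ t * y + g t) :
    Admitted H Ω X := by
  refine (admitted_iff hΩ hc hH.contDiffOn X).2 ⟨k, 0, fun _ => c, ζ₁, ζ₂, g, fun q => -ψ q,
    contDiffOn_const, h₁.contDiffOn, h₂.contDiffOn, hg.contDiffOn, hψ.neg, fun p hp => ?_,
    fun p hp => ?_⟩
  · have h : ∀ q, fderiv ℝ (fun q => -ψ q) q = -fderiv ℝ ψ q := fun q => fderiv_fun_neg
    rw [hX p hp]
    ext i <;> fin_cases i <;> simp [timeShift, relabelling, pd₁, pd₂, h]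
  · have i3 : iteratedDeriv 3 (fun _ : ℝ => c) (p.1 0) = 0 := by
      simp [iteratedDeriv_const]
    simp only [ClassifyingEquation, i3, deriv_const]
    linear_combination hcl (p.1 0) (p.2 0) (p.2 1)

lemma pd_quadraticBottom (p c b q₁ q₂ q₀ x y : ℝ) :
    pd₁ (quadraticBottom p c b q₁ q₂ q₀) (x, y) = 2 * p * x + 2 * c * y + q₁ ∧
      pd₂ (quadraticBottom p c b q₁ q₂ q₀) (x, y) = 2 * c * x + 2 * b * y + q₂ := by
  have h1 : HasFDerivAt (fun r : ℝ × ℝ => r.1) (ContinuousLinearMap.fst ℝ ℝ ℝ) (x, y) :=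
    hasFDerivAt_fst
  have h2 : HasFDerivAt (fun r : ℝ × ℝ => r.2) (ContinuousLinearMap.snd ℝ ℝ ℝ) (x, y) :=
    hasFDerivAt_snd
  have h := ((((((h1.fun_mul h1).const_mul p).fun_add ((h1.const_mul (2 * c)).fun_mul h2)).fun_add
    ((h2.fun_mul h2).const_mul b)).fun_add (h1.const_mul q₁)).fun_add
      (h2.const_mul q₂)).add_const q₀
  have h' : HasFDerivAt (quadraticBottom p c b q₁ q₂ q₀) _ (x, y) :=
    h.congr_of_eventuallyEq (Filter.Eventually.of_forall fun r => by
      simp only [quadraticBottom]; ring)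
  rw [pd₁, pd₂, h'.fderiv]
  constructor <;> simp <;> ring

lemma pd_pd_quadraticBottom (p c b q₁ q₂ q₀ x y : ℝ) :
    pd₁ (pd₁ (quadraticBottom p c b q₁ q₂ q₀)) (x, y) = 2 * p ∧
      pd₂ (pd₁ (quadraticBottom p c b q₁ q₂ q₀)) (x, y) = 2 * c ∧
      pd₁ (pd₂ (quadraticBottom p c b q₁ q₂ q₀)) (x, y) = 2 * c ∧
      pd₂ (pd₂ (quadraticBottom p c b q₁ q₂ q₀)) (x, y) = 2 * b := by
  have e₁ : pd₁ (quadraticBottom p c b q₁ q₂ q₀) = quadraticBottom 0 0 0 (2 * p) (2 * c) q₁ :=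
    funext fun r => (pd_quadraticBottom p c b q₁ q₂ q₀ r.1 r.2).1.trans (by
      simp only [quadraticBottom]; ring)
  have e₂ : pd₂ (quadraticBottom p c b q₁ q₂ q₀) = quadraticBottom 0 0 0 (2 * c) (2 * b) q₂ :=
    funext fun r => (pd_quadraticBottom p c b q₁ q₂ q₀ r.1 r.2).2.trans (by
      simp only [quadraticBottom]; ring)
  rw [e₁, e₂, (pd_quadraticBottom ..).1, (pd_quadraticBottom ..).2, (pd_quadraticBottom ..).1,
    (pd_quadraticBottom ..).2]
  simp

lemma contDiff_quadraticBottom (p c b q₁ q₂ q₀ : ℝ) :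
    ContDiff ℝ ∞ (quadraticBottom p c b q₁ q₂ q₀) := by
  unfold quadraticBottom; fun_prop

lemma bottom₁_eq (l₁ l₂ : ℝ) : bottom₁ l₁ l₂ = quadraticBottom l₁ 0 l₂ 0 0 0 := by
  ext r; simp [bottom₁, quadraticBottom]

lemma bottom₂_eq (l₁ q₂ : ℝ) : bottom₂ l₁ q₂ = quadraticBottom l₁ 0 0 0 q₂ 0 := by
  ext r; simp [bottom₂, quadraticBottom]

/-- The kernel: testing with the bottoms `0, x, y, x², y²` leaves no action on the positions. -/
theorem forall_admitted_iff {Ω : Set Base} (hΩ : IsOpen Ω) (hc : Convex ℝ Ω) (X : VField) :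
    (∀ H : ℝ × ℝ → ℝ, ContDiff ℝ ∞ H → Admitted H Ω X) ↔
      ∃ (c : ℝ) (ψ : ℝ × ℝ → ℝ), ContDiffOn ℝ ∞ ψ (labels Ω) ∧
        Set.EqOn X (c • timeShift + relabelling ψ) Ω := by
  constructor
  · intro h
    have hD := fun (p c b q₁ q₂ : ℝ) (P : Base) (hP : P ∈ Ω) =>
      (h (quadraticBottom p c b q₁ q₂ 0) (contDiff_quadraticBottom ..)).determiningAt hΩ
        (fun q _ => (contDiff_quadraticBottom ..).contDiffAt) hP
    have hP := (h (quadraticBottom 0 0 0 0 0 0) (contDiff_quadraticBottom ..)).projectable hΩ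
      fun q _ => (contDiff_quadraticBottom ..).contDiffAt
    obtain ⟨k₁, k₄, ζ, ζ₁, ζ₂, ψ, hζ, h₁, h₂, hψ, hX⟩ := exists_hasForm hΩ hc hP (hD 0 0 0 0 0)
    have cζ := fun p (hp : p ∈ Ω) => contDiffAt_time hΩ hζ hp
    -- `H = 0` and `H = x` eliminate the derivatives of `η` from the equation for `H = x²`, which
    -- leaves `η^x = 0`; likewise for `y`; and `H = x` relates `η^x_x` to the derivative of `ζ`
    have key : ∀ p ∈ Ω, deriv ζ (p.1 0) = 0 ∧ k₁ = 0 ∧ compU X 0 p = 0 ∧ compU X 1 p = 0 := by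
      have hU : ∀ p ∈ Ω, (compU X 0 p = 0 ∧ compU X 1 p = 0) ∧
          dd (eU 0) (compU X 0) p = 2 * dd (eS 0) (compS X 0) p := by
        intro p hp
        have bx := fun P c b q₁ q₂ => (hD P c b q₁ q₂ p hp).bottom_x
        have bY := fun P c b q₁ q₂ => (hD P c b q₁ q₂ p hp).bottom_y
        simp only [pos, (pd_quadraticBottom ..).1, (pd_quadraticBottom ..).2,
          (pd_pd_quadraticBottom ..).1, (pd_pd_quadraticBottom ..).2.1,
          (pd_pd_quadraticBottom ..).2.2.1, (pd_pd_quadraticBottom ..).2.2.2] at bx bY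
        have x0 := bx 0 0 0 0 0
        have x1 := bx 0 0 0 1 0
        have x2 := bx 1 0 0 0 0
        have y0 := bY 0 0 0 0 0
        have y1 := bY 0 0 0 0 1
        have y2 := bY 0 0 1 0 0
        exact ⟨⟨by linear_combination p.2 0 * (x1 - x0) - (x2 - x0) / 2,
          by linear_combination p.2 1 * (y1 - y0) - (y2 - y0) / 2⟩,
          by linear_combination x1 - x0⟩
      intro p hp
      have e : dd (eU 0) (compU X 0) p = 0 := by
        rw [dd_congr hΩ (g := fun _ => 0) (fun q hq => (hU q hq).1.1) _ hp, dd_const]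
      have e₁ : dd (eS 0) (compS X 0) p = deriv ζ (p.1 0) := by
        rw [dd_congr hΩ hX.compS_zero _ hp, (hasDD_time ((cζ p hp).differentiableAt (by simp)) _).2]
        simp [eS]
      have e₂ := (affine_derivs hΩ hX.compU_zero (fun p hp => contDiffAt_dilation (cζ p hp) k₁)
        (fun p hp => contDiffAt_const) (fun p hp => contDiffAt_time hΩ h₁ hp) hp).2.1.1
      have e₃ := (hU p hp).2
      rw [e, e₁] at e₃
      rw [e, dilation] at e₂
      exact ⟨by linarith, by linarith, (hU p hp).1⟩
    obtain ⟨c, hcc⟩ := exists_const_of_deriv (isOpen_times hΩ) (convex_times hc) (u := ζ) (by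
      rintro _ ⟨p, hp, rfl⟩
      have := ((cζ p hp).differentiableAt (by simp)).hasDerivAt
      rwa [(key p hp).1] at this)
    refine ⟨c, fun q => -ψ q, hψ.neg, fun p hp => ?_⟩
    obtain ⟨-, hk, u0, u1⟩ := key p hp
    have e : X p = ((X p).1, ![compU X 0 p, compU X 1 p]) := by
      ext i <;> fin_cases i <;> rfl
    rw [e, u0, u1, hX p hp, Pi.add_apply, relabelling_neg, hcc _ ⟨p, hp, rfl⟩, hk]
    ext i <;> fin_cases i <;> simp [timeShift]
  · rintro ⟨c, ψ, hψ, hX⟩ H hH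
    refine admitted_of_eqOn (c := c) (k := 0) (ζ₁ := fun _ => 0) (ζ₂ := fun _ => 0) hΩ hc hH hψ
      contDiff_const contDiff_const (fun _ => 0) contDiff_const (fun p hp => ?_) (fun t x y => ?_)
    · rw [hX hp]
      ext i <;> fin_cases i <;> simp
    · simp

/-- A generator admitted over `l₁ x² + l₂ y² + q₂ y` with `l₁ ≠ l₂`: comparison of
coefficients in the classifying equation. -/
lemma exists_of_admitted_diagonal {Ω : Set Base} (hΩ : IsOpen Ω) (hc : Convex ℝ Ω) {l₁ l₂ q₂ : ℝ}
    (h12 : l₁ ≠ l₂) {X : VField}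
    (hX : Admitted (quadraticBottom l₁ 0 l₂ 0 q₂ 0) Ω X) :
    ∃ (c k : ℝ) (ψ : ℝ × ℝ → ℝ) (ζ₁ ζ₂ : ℝ → ℝ),
      ContDiffOn ℝ ∞ ψ (labels Ω) ∧ ContDiffOn ℝ ∞ ζ₁ (times Ω) ∧ ContDiffOn ℝ ∞ ζ₂ (times Ω) ∧
      (∀ t ∈ times Ω, iteratedDeriv 2 ζ₁ t = 2 * l₁ * ζ₁ t) ∧
      (∀ t ∈ times Ω, iteratedDeriv 2 ζ₂ t = 2 * l₂ * ζ₂ t - k * q₂) ∧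
      ∀ p ∈ Ω, X p = (c • timeShift + relabelling ψ) p + (![0, 4 * k * p.1 1, 0],
        ![k * p.2 0 + ζ₁ (p.1 0), k * p.2 1 + ζ₂ (p.1 0)]) := by
  obtain ⟨k₁, k₄, ζ, ζ₁, ζ₂, g, ψ, hζ, h₁, h₂, -, hψ, hF, hcl⟩ :=
    (admitted_iff hΩ hc (contDiff_quadraticBottom ..).contDiffOn X).1 hX
  have key : ∀ p ∈ Ω, deriv ζ (p.1 0) = 0 ∧ k₄ = 0 ∧
      iteratedDeriv 2 ζ₁ (p.1 0) = 2 * l₁ * ζ₁ (p.1 0) ∧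
      iteratedDeriv 2 ζ₂ (p.1 0) = 2 * l₂ * ζ₂ (p.1 0) - k₁ * q₂ := by
    intro p hp
    obtain ⟨A, B, C, D, E⟩ := quadratic_eq_zero hΩ hp
      (A := 2 * l₁ * (deriv ζ (p.1 0) + 2 * k₁) - 2 * (2 * k₁ - deriv ζ (p.1 0)) * l₁
        - iteratedDeriv 3 ζ (p.1 0) / 2)
      (B := 4 * k₄ * (l₁ - l₂))
      (C := 2 * l₂ * (deriv ζ (p.1 0) + 2 * k₁) - 2 * (2 * k₁ - deriv ζ (p.1 0)) * l₂
        - iteratedDeriv 3 ζ (p.1 0) / 2)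
      (D := 4 * l₁ * ζ₁ (p.1 0) - 2 * k₄ * q₂ - 2 * iteratedDeriv 2 ζ₁ (p.1 0))
      (E := 4 * l₂ * ζ₂ (p.1 0) + (deriv ζ (p.1 0) + 2 * k₁) * q₂
        - 2 * (2 * k₁ - deriv ζ (p.1 0)) * q₂ - 2 * iteratedDeriv 2 ζ₂ (p.1 0))
      (F := 2 * ζ₂ (p.1 0) * q₂ - g (p.1 0)) (fun q hq e => by
        have := hcl q hq
        simp only [ClassifyingEquation, e, (pd_quadraticBottom ..).1,
          (pd_quadraticBottom ..).2, quadraticBottom] at this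
        linear_combination this)
    have hk : k₄ = 0 := by
      rcases mul_eq_zero.1 B with h | h
      · linarith
      · exact absurd (by linarith) h12
    have hz : deriv ζ (p.1 0) = 0 := by
      have : (l₁ - l₂) * deriv ζ (p.1 0) = 0 := by linear_combination (A - C) / 4
      exact (mul_eq_zero.1 this).resolve_left (sub_ne_zero.2 h12)
    rw [hz] at E
    rw [hk] at D
    exact ⟨hz, hk, by linarith, by linarith⟩
  obtain ⟨c, hcc⟩ := exists_const_of_deriv (isOpen_times hΩ) (convex_times hc) (u := ζ) (by
    rintro _ ⟨p, hp, rfl⟩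
    have := ((contDiffAt_time hΩ hζ hp).differentiableAt (by simp)).hasDerivAt
    rwa [(key p hp).1] at this)
  refine ⟨c, k₁, fun q => -ψ q, ζ₁, ζ₂, hψ.neg, h₁, h₂, ?_, ?_, fun p hp =>
    hF.eq_of_const hp (hcc _ ⟨p, hp, rfl⟩) (key p hp).1 (key p hp).2.1⟩
  · rintro _ ⟨p, hp, rfl⟩
    exact (key p hp).2.2.1
  · rintro _ ⟨p, hp, rfl⟩
    exact (key p hp).2.2.2

theorem admitted_bottom₁_iff {l₁ l₂ : ℝ} (hl : l₁ * l₂ * (l₁ - l₂) ≠ 0) {Ω : Set Base}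
    (hΩ : IsOpen Ω) (hc : Convex ℝ Ω) (X : VField) :
    Admitted (bottom₁ l₁ l₂) Ω X ↔
      ∃ (c k : ℝ) (ψ : ℝ × ℝ → ℝ) (ζ₁ ζ₂ : ℝ → ℝ),
        ContDiffOn ℝ ∞ ψ (labels Ω) ∧ ContDiff ℝ ∞ ζ₁ ∧ ContDiff ℝ ∞ ζ₂ ∧
        (∀ t, iteratedDeriv 2 ζ₁ t = 2 * l₁ * ζ₁ t) ∧
        (∀ t, iteratedDeriv 2 ζ₂ t = 2 * l₂ * ζ₂ t) ∧
        Set.EqOn X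
          (c • timeShift + relabelling ψ + k • scaling + translation ζ₁ ζ₂) Ω := by
  have hform : ∀ (c k : ℝ) (ψ : ℝ × ℝ → ℝ) (ζ₁ ζ₂ : ℝ → ℝ) (p : Base),
      (c • timeShift + relabelling ψ + k • scaling + translation ζ₁ ζ₂) p
        = (c • timeShift + relabelling ψ) p + (![0, 4 * k * p.1 1, 0],
          ![k * p.2 0 + ζ₁ (p.1 0), k * p.2 1 + ζ₂ (p.1 0)]) := fun c k ψ ζ₁ ζ₂ p => by
    ext i <;> fin_cases i <;> simp [scaling, translation, timeShift, relabelling] <;> ring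
  rw [bottom₁_eq]
  constructor
  · intro hX
    have h12 : l₁ ≠ l₂ := fun h => hl (by simp [h])
    obtain ⟨c, k, ψ, ζ₁, ζ₂, hψ, h₁, h₂, o₁, o₂, e⟩ := exists_of_admitted_diagonal hΩ hc h12 hX
    obtain ⟨F₁, hF₁, oF₁, e₁⟩ := exists_global_solution (isOpen_times hΩ) (convex_times hc) _ h₁ o₁
    obtain ⟨F₂, hF₂, oF₂, e₂⟩ := exists_global_solution (isOpen_times hΩ) (convex_times hc) _ h₂
      (fun t ht => (o₂ t ht).trans (by ring) : ∀ t ∈ times Ω, _ = 2 * l₂ * ζ₂ t)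
    refine ⟨c, k, ψ, F₁, F₂, hψ, hF₁, hF₂, oF₁, oF₂, fun p hp => ?_⟩
    rw [e p hp, hform, e₁ ⟨p, hp, rfl⟩, e₂ ⟨p, hp, rfl⟩]
  · rintro ⟨c, k, ψ, ζ₁, ζ₂, hψ, h₁, h₂, o₁, o₂, e⟩
    refine admitted_of_eqOn (k := k) hΩ hc (contDiff_quadraticBottom ..) hψ h₁ h₂ (fun _ => 0)
      contDiff_const (fun p hp => (e hp).trans (hform ..)) (fun t x y => ?_)
    rw [(pd_quadraticBottom ..).1, (pd_quadraticBottom ..).2, o₁, o₂]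
    simp only [quadraticBottom]
    ring

theorem admitted_bottom₂_iff {l₁ q₂ : ℝ} (hl : l₁ ≠ 0) {Ω : Set Base}
    (hΩ : IsOpen Ω) (hc : Convex ℝ Ω) (X : VField) :
    Admitted (bottom₂ l₁ q₂) Ω X ↔
      ∃ (c k c₁ c₂ : ℝ) (ψ : ℝ × ℝ → ℝ) (ζ₁ : ℝ → ℝ),
        ContDiffOn ℝ ∞ ψ (labels Ω) ∧ ContDiff ℝ ∞ ζ₁ ∧
        (∀ t, iteratedDeriv 2 ζ₁ t = 2 * l₁ * ζ₁ t) ∧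
        Set.EqOn X
          (c • timeShift + relabelling ψ + k • scalingPlane q₂
            + c₁ • translation 0 (fun t => t) + c₂ • translation 0 1
            + translation ζ₁ 0) Ω := by
  have hform : ∀ (c k c₁ c₂ : ℝ) (ψ : ℝ × ℝ → ℝ) (ζ₁ : ℝ → ℝ) (p : Base),
      (c • timeShift + relabelling ψ + k • scalingPlane q₂ + c₁ • translation 0 (fun t => t)
        + c₂ • translation 0 1 + translation ζ₁ 0) p
        = (c • timeShift + relabelling ψ) p + (![0, 4 * (4 * k) * p.1 1, 0],
          ![4 * k * p.2 0 + ζ₁ (p.1 0),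
            4 * k * p.2 1 + (-(2 * k * q₂) * p.1 0 ^ 2 + c₁ * p.1 0 + c₂)]) :=
    fun c k c₁ c₂ ψ ζ₁ p => by
    ext i <;> fin_cases i <;> simp [scalingPlane, translation, timeShift, relabelling] <;> ring
  rw [bottom₂_eq]
  constructor
  · intro hX
    obtain ⟨c, k, ψ, ζ₁, ζ₂, hψ, h₁, h₂, o₁, o₂, e⟩ := exists_of_admitted_diagonal hΩ hc hl hX
    obtain ⟨F₁, hF₁, oF₁, e₁⟩ := exists_global_solution (isOpen_times hΩ) (convex_times hc) _ h₁ o₁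
    have hfa : ∀ t ∈ times Ω, ContDiffAt ℝ ∞ ζ₂ t := fun t ht =>
      (h₂ t ht).contDiffAt ((isOpen_times hΩ).mem_nhds ht)
    have d1 : ∀ t ∈ times Ω, HasDerivAt ζ₂ (deriv ζ₂ t) t := fun t ht =>
      ((hfa t ht).differentiableAt (by simp)).hasDerivAt
    have d2 : ∀ t ∈ times Ω, HasDerivAt (deriv ζ₂) (-(k * q₂)) t := fun t ht => by
      have h := ((contDiffAt_deriv (hfa t ht)).differentiableAt (by simp)).hasDerivAt
      have o := o₂ t ht
      rw [iteratedDeriv_succ, iteratedDeriv_one] at o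
      rw [o] at h
      exact h.congr_deriv (by ring)
    -- two integrations of `ζ₂'' = -k q₂`
    obtain ⟨c₁, hc₁⟩ := exists_const_of_deriv (u := fun t => deriv ζ₂ t + k * q₂ * t)
      (isOpen_times hΩ) (convex_times hc) fun t ht =>
        ((d2 t ht).fun_add ((hasDerivAt_id t).const_mul (k * q₂))).congr_deriv (by ring)
    obtain ⟨c₂, hc₂⟩ := exists_const_of_deriv
      (u := fun t => ζ₂ t + k * q₂ / 2 * t ^ 2 - c₁ * t)
      (isOpen_times hΩ) (convex_times hc) fun t ht =>
        (((d1 t ht).fun_add (((hasDerivAt_id t).fun_pow 2).const_mul (k * q₂ / 2))).fun_sub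
          ((hasDerivAt_id t).const_mul c₁)).congr_deriv (by
            rw [← hc₁ t ht]; simp; ring)
    refine ⟨c, k / 4, c₁, c₂, ψ, F₁, hψ, hF₁, oF₁, fun p hp => ?_⟩
    have e₂ : ζ₂ (p.1 0) = -(2 * (k / 4) * q₂) * p.1 0 ^ 2 + c₁ * p.1 0 + c₂ := by
      rw [← hc₂ _ ⟨p, hp, rfl⟩]; ring
    have hk : 4 * (k / 4) = k := by ring
    rw [e p hp, hform, e₁ ⟨p, hp, rfl⟩, ← e₂, hk]
  · rintro ⟨c, k, c₁, c₂, ψ, ζ₁, hψ, h₁, o₁, e⟩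
    have i2 : ∀ t, iteratedDeriv 2 (fun t : ℝ => -(2 * k * q₂) * t ^ 2 + c₁ * t + c₂) t
        = -(4 * k * q₂) := fun t => by
      have d : deriv (fun t : ℝ => -(2 * k * q₂) * t ^ 2 + c₁ * t + c₂)
          = fun t => -(4 * k * q₂) * t + c₁ := funext fun t =>
        (((((hasDerivAt_id t).fun_pow 2).const_mul (-(2 * k * q₂))).fun_add
          ((hasDerivAt_id t).const_mul c₁)).add_const c₂).deriv.trans (by simp; ring)
      rw [iteratedDeriv_succ, iteratedDeriv_one, d]
      exact ((((hasDerivAt_id t).const_mul (-(4 * k * q₂))).add_const c₁).deriv).trans (by simp)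
    refine admitted_of_eqOn (k := 4 * k) hΩ hc (contDiff_quadraticBottom ..) hψ h₁
      (ζ₂ := fun t => -(2 * k * q₂) * t ^ 2 + c₁ * t + c₂) (by fun_prop)
      (fun t => 2 * q₂ * (-(2 * k * q₂) * t ^ 2 + c₁ * t + c₂))
      (by fun_prop) (fun p hp => (e hp).trans (hform ..)) (fun t x y => ?_)
    rw [(pd_quadraticBottom ..).1, (pd_quadraticBottom ..).2, o₁, i2]
    simp only [quadraticBottom]
    ring

/-! ### Normal forms of quadratic bottoms -/

/-- The rotation `x → c x + s y`, `y → -s x + c y` of the positions (for `c² + s² = 1`), followed by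
the shift by `(v, w)`. -/
def motion (c s v w : ℝ) : Base → Base := fun p =>
  (p.1, ![c * p.2 0 + s * p.2 1 + v, -s * p.2 0 + c * p.2 1 + w])

section
variable {c s : ℝ} (v w : ℝ)

lemma motion_inverse (hcs : c ^ 2 + s ^ 2 = 1) (p : Base) :
    motion c (-s) (-(c * v - s * w)) (-(s * v + c * w)) (motion c s v w p) = p := by
  ext i
  · rfl
  · fin_cases i <;> simp [motion]
    · linear_combination p.2 0 * hcs
    · linear_combination p.2 1 * hcs

lemma inverse_motion (hcs : c ^ 2 + s ^ 2 = 1) (p : Base) :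
    motion c s v w (motion c (-s) (-(c * v - s * w)) (-(s * v + c * w)) p) = p := by
  ext i
  · rfl
  · fin_cases i <;> simp [motion]
    · linear_combination (p.2 0 - v) * hcs
    · linear_combination (p.2 1 - w) * hcs

lemma motion_image (hcs : c ^ 2 + s ^ 2 = 1) (Ω : Set Base) :
    motion c s v w '' Ω = motion c (-s) (-(c * v - s * w)) (-(s * v + c * w)) ⁻¹' Ω :=
  congrFun (Set.image_eq_preimage_of_inverse (motion_inverse v w hcs) (inverse_motion v w hcs)) Ω

lemma contDiff_motion (c s : ℝ) : ContDiff ℝ ∞ (motion c s v w) := by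
  refine contDiff_fst.prodMk (contDiff_pi.2 fun i => ?_)
  fin_cases i <;> simp <;> fun_prop

lemma isOpen_motion_image (hcs : c ^ 2 + s ^ 2 = 1) {Ω : Set Base} (hΩ : IsOpen Ω) :
    IsOpen (motion c s v w '' Ω) := by
  rw [motion_image v w hcs]
  exact hΩ.preimage (contDiff_motion ..).continuous

lemma convex_motion_image (c s : ℝ) {Ω : Set Base} (hΩ : Convex ℝ Ω) :
    Convex ℝ (motion c s v w '' Ω) := by
  rintro _ ⟨p, hp, rfl⟩ _ ⟨q, hq, rfl⟩ a b ha hb hab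
  refine ⟨a • p + b • q, hΩ hp hq ha hb hab, ?_⟩
  ext i
  · rfl
  · fin_cases i <;> simp [motion]
    · linear_combination -v * hab
    · linear_combination -w * hab

lemma fderiv_motion (c s : ℝ) (p q : Base) :
    fderiv ℝ (motion c s v w) p q = (q.1, ![c * q.2 0 + s * q.2 1, -s * q.2 0 + c * q.2 1]) := by
  have e : motion c s v w = fun p => motion c s 0 0 p + motion 0 0 v w 0 := by
    ext p i
    · simp [motion]
    · fin_cases i <;> simp [motion]
  let L : Base →ₗ[ℝ] Base :=
    { toFun := motion c s 0 0
      map_add' := fun p q => by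
        ext i
        · rfl
        · fin_cases i <;> simp [motion] <;> ring
      map_smul' := fun a p => by
        ext i
        · rfl
        · fin_cases i <;> simp [motion] <;> ring }
  have h : HasFDerivAt (motion c s 0 0) L.toContinuousLinearMap p :=
    L.toContinuousLinearMap.hasFDerivAt
  rw [e, (h.add_const _).fderiv]
  change motion c s 0 0 q = _
  simp [motion]

end

/-- Being admitted is a local property. -/
lemma admitted_of_forall_exists {H : ℝ × ℝ → ℝ} {Ω : Set Base} {X : VField}
    (h : ∀ p ∈ Ω, ∃ U, IsOpen U ∧ p ∈ U ∧ Admitted H U X) : Admitted H Ω X := by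
  refine ⟨fun p hp => ?_, fun z hz => ?_⟩
  · obtain ⟨U, hU, hpU, hX⟩ := h p hp
    exact (hX.contDiffAt hU hpU).contDiffWithinAt
  · obtain ⟨U, hU, hpU, hX⟩ := h _ hz
    exact hX.2 z hpU

lemma Admitted.mono {H : ℝ × ℝ → ℝ} {Ω U : Set Base} {X : VField} (h : Admitted H Ω X)
    (hU : U ⊆ Ω) : Admitted H U X :=
  ⟨h.1.mono hU, fun z hz => h.2 z (hU hz)⟩

/-- The gradients of a bottom and of the moved bottom. -/
lemma pd_of_motion {H H' : ℝ × ℝ → ℝ} {c s v w h : ℝ} (hH' : ContDiff ℝ ∞ H')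
    (e : ∀ x y, H' (c * x + s * y + v, -s * x + c * y + w) = H (x, y) + h) (x y : ℝ) :
    pd₁ H (x, y) = c * pd₁ H' (c * x + s * y + v, -s * x + c * y + w)
        - s * pd₂ H' (c * x + s * y + v, -s * x + c * y + w) ∧
      pd₂ H (x, y) = s * pd₁ H' (c * x + s * y + v, -s * x + c * y + w)
        + c * pd₂ H' (c * x + s * y + v, -s * x + c * y + w) := by
  have h1 : HasFDerivAt (fun r : ℝ × ℝ => r.1) (ContinuousLinearMap.fst ℝ ℝ ℝ) (x, y) :=
    hasFDerivAt_fst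
  have h2 : HasFDerivAt (fun r : ℝ × ℝ => r.2) (ContinuousLinearMap.snd ℝ ℝ ℝ) (x, y) :=
    hasFDerivAt_snd
  have hA := (((h1.const_mul c).fun_add (h2.const_mul s)).add_const v).prodMk
    (((h1.const_mul (-s)).fun_add (h2.const_mul c)).add_const w)
  have hd : HasFDerivAt H' (fderiv ℝ H' (c * x + s * y + v, -s * x + c * y + w))
      (c * x + s * y + v, -s * x + c * y + w) :=
    ((hH'.differentiable (by simp)) _).hasFDerivAt
  have hc : HasFDerivAt H _ (x, y) := ((hd.comp (x, y) hA).add_const (-h)).congr_of_eventuallyEq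
    (Filter.Eventually.of_forall fun r => by
      change H r = H' (c * r.1 + s * r.2 + v, -s * r.1 + c * r.2 + w) + -h
      rw [e]; ring)
  have split : ∀ q : ℝ × ℝ, ∀ a b : ℝ, fderiv ℝ H' q (a, b) = a * pd₁ H' q + b * pd₂ H' q :=
    fun q a b => by
      have : ((a, b) : ℝ × ℝ) = a • (1, 0) + b • (0, 1) := by simp
      rw [this, map_add, map_smul, map_smul]; rfl
  change fderiv ℝ H (x, y) (1, 0) = _ ∧ fderiv ℝ H (x, y) (0, 1) = _
  rw [hc.fderiv]
  constructor
  · refine Eq.trans ?_ ((split _ c (-s)).trans (by ring))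
    simp
  · refine Eq.trans ?_ (split _ s c)
    simp

/-- A rigid motion of the positions carries admitted vector fields to admitted ones: the constants
`k₁`, `k₄` and the functions `ζ`, `ψ` are kept, and `ζ₁`, `ζ₂`, `g` are changed so that the
classifying equation persists. -/
lemma Admitted.of_motion {H H' : ℝ × ℝ → ℝ} {c s v w h : ℝ} (hcs : c ^ 2 + s ^ 2 = 1)
    (hH : ContDiff ℝ ∞ H) (hH' : ContDiff ℝ ∞ H')
    (e : ∀ x y, H' (c * x + s * y + v, -s * x + c * y + w) = H (x, y) + h)
    {Ω : Set Base} (hΩ : IsOpen Ω) {X X' : VField}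
    (hX' : ∀ p ∈ Ω, X' (motion c s v w p) = fderiv ℝ (motion c s v w) p (X p))
    (hX : Admitted H Ω X) : Admitted H' (motion c s v w '' Ω) X' := by
  refine admitted_of_forall_exists ?_
  rintro _ ⟨p₀, hp₀, rfl⟩
  obtain ⟨r, hr, hball⟩ := Metric.isOpen_iff.1 hΩ p₀ hp₀
  refine ⟨motion c s v w '' Metric.ball p₀ r, isOpen_motion_image v w hcs Metric.isOpen_ball,
    ⟨p₀, Metric.mem_ball_self hr, rfl⟩, ?_⟩
  have hcb := convex_ball p₀ r
  obtain ⟨k₁, k₄, ζ, ζ₁, ζ₂, g, ψ, hζ, h₁, h₂, hg, hψ, hF, hcl⟩ :=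
    (admitted_iff Metric.isOpen_ball hcb hH.contDiffOn X).1 (hX.mono hball)
  have eT : times (motion c s v w '' Metric.ball p₀ r) = times (Metric.ball p₀ r) := by
    rw [times, Set.image_image]; rfl
  have eL : labels (motion c s v w '' Metric.ball p₀ r) = labels (Metric.ball p₀ r) := by
    rw [labels, Set.image_image]; rfl
  have hT : IsOpen (times (Metric.ball p₀ r)) := isOpen_times Metric.isOpen_ball
  have at' : ∀ {f : ℝ → ℝ}, ContDiffOn ℝ ∞ f (times (Metric.ball p₀ r)) →
      ∀ t ∈ times (Metric.ball p₀ r), ContDiffAt ℝ ∞ f t :=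
    fun hf t ht => (hf t ht).contDiffAt (hT.mem_nhds ht)
  have hd := fun t ht => contDiffAt_deriv (at' hζ t ht)
  have i2 : ∀ (f : ℝ → ℝ) t, iteratedDeriv 2 f t = deriv (deriv f) t := fun f t => by
    rw [iteratedDeriv_succ, iteratedDeriv_one]
  -- second derivatives of the new translation components
  have i2' : ∀ a b m n : ℝ, ∀ t ∈ times (Metric.ball p₀ r),
      iteratedDeriv 2 (fun t => a * ζ₁ t + b * ζ₂ t - m * deriv ζ t + n) t
        = a * iteratedDeriv 2 ζ₁ t + b * iteratedDeriv 2 ζ₂ t - m * iteratedDeriv 3 ζ t := by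
    intro a b m n t ht
    have D : ∀ {f : ℝ → ℝ} {t}, ContDiffAt ℝ ∞ f t → HasDerivAt f (deriv f t) t :=
      fun hf => (hf.differentiableAt (by simp)).hasDerivAt
    have d1 : Set.EqOn (deriv fun t => a * ζ₁ t + b * ζ₂ t - m * deriv ζ t + n)
        (fun t => a * deriv ζ₁ t + b * deriv ζ₂ t - m * deriv (deriv ζ) t)
        (times (Metric.ball p₀ r)) := fun t ht =>
      (((((D (at' h₁ t ht)).const_mul a).fun_add ((D (at' h₂ t ht)).const_mul b)).fun_sub
        ((D (hd t ht)).const_mul m)).add_const n).deriv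
    rw [i2, (d1.eventuallyEq_of_mem (hT.mem_nhds ht)).deriv_eq, iteratedDeriv_succ (n := 2),
      i2 ζ₁, i2 ζ₂]
    refine (((((D (contDiffAt_deriv (at' h₁ t ht))).const_mul a).fun_add
      ((D (contDiffAt_deriv (at' h₂ t ht))).const_mul b)).fun_sub
      ((D (contDiffAt_deriv (hd t ht))).const_mul m)).deriv).trans ?_
    rw [show iteratedDeriv 2 ζ = deriv (deriv ζ) from funext fun t => i2 ζ t]
  have hd' : ContDiffOn ℝ ∞ (deriv ζ) (times (Metric.ball p₀ r)) :=
    fun t ht => (hd t ht).contDiffWithinAt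
  have smooth : ∀ a b m n : ℝ, ContDiffOn ℝ ∞
      (fun t => a * ζ₁ t + b * ζ₂ t - m * deriv ζ t + n) (times (Metric.ball p₀ r)) :=
    fun a b m n => (((contDiffOn_const.mul h₁).add (contDiffOn_const.mul h₂)).sub
      (contDiffOn_const.mul hd')).add contDiffOn_const
  have hi : ∀ {f : ℝ → ℝ} (n : ℕ), ContDiffOn ℝ ∞ f (times (Metric.ball p₀ r)) →
      ContDiffOn ℝ ∞ (iteratedDeriv n f) (times (Metric.ball p₀ r)) :=
    fun n hf t ht => (contDiffAt_iteratedDeriv (at' hf t ht) n).contDiffWithinAt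
  refine (admitted_iff (isOpen_motion_image v w hcs Metric.isOpen_ball)
    (convex_motion_image v w c s hcb) hH'.contDiffOn X').2 ⟨k₁, k₄, ζ,
      fun t => c * ζ₁ t + s * ζ₂ t - v / 2 * deriv ζ t + (-k₁ * v - k₄ * w),
      fun t => -s * ζ₁ t + c * ζ₂ t - w / 2 * deriv ζ t + (-k₁ * w + k₄ * v),
      fun t => g t - 2 * (2 * k₁ - deriv ζ t) * h
        - 2 * (v * (c * iteratedDeriv 2 ζ₁ t + s * iteratedDeriv 2 ζ₂ t)
          + w * (-s * iteratedDeriv 2 ζ₁ t + c * iteratedDeriv 2 ζ₂ t))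
        + iteratedDeriv 3 ζ t / 2 * (v ^ 2 + w ^ 2),
      ψ, ?_, ?_, ?_, ?_, ?_, ?_, ?_⟩
  · rwa [eT]
  · rw [eT]; exact smooth _ _ _ _
  · rw [eT]; exact smooth _ _ _ _
  · rw [eT]
    have a1 := hi 2 h₁
    have a2 := hi 2 h₂
    have a3 := hi 3 hζ
    fun_prop
  · rwa [eL]
  · rintro _ ⟨p, hp, rfl⟩
    rw [hX' p (hball hp), fderiv_motion, hF p hp]
    ext i
    · rfl
    · fin_cases i <;> simp [motion] <;> ring
  · rintro _ ⟨p, hp, rfl⟩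
    have ht : p.1 0 ∈ times (Metric.ball p₀ r) := ⟨p, hp, rfl⟩
    have k := hcl p hp
    simp only [ClassifyingEquation, (pd_of_motion hH' e _ _).1, (pd_of_motion hH' e _ _).2] at k
    have e' := e (p.2 0) (p.2 1)
    simp only [ClassifyingEquation]
    change (_ * (motion c s v w p).2 0 + _ * (motion c s v w p).2 1 + _) * _ + _ = _
    simp only [i2' _ _ _ _ _ ht, motion, Matrix.cons_val_zero, Matrix.cons_val_one]
    rw [e']
    generalize pd₁ H' _ = A at k ⊢
    generalize pd₂ H' _ = B at k ⊢
    linear_combination k - (iteratedDeriv 3 ζ (p.1 0) / 2 * (p.2 0 ^ 2 + p.2 1 ^ 2)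
      + 2 * iteratedDeriv 2 ζ₁ (p.1 0) * p.2 0 + 2 * iteratedDeriv 2 ζ₂ (p.1 0) * p.2 1) * hcs

/-- The action of a rigid motion of the positions and a shift of the bottom on the variables
`((t, a, b), (x, y), H)`. -/
def motionWithBottom (c s v w h : ℝ) : Base × ℝ → Base × ℝ := fun P =>
  (motion c s v w P.1, P.2 + h)

lemma transformsAdmitted_motion {H H' : ℝ × ℝ → ℝ} {c s v w h : ℝ} (hcs : c ^ 2 + s ^ 2 = 1)
    (hH : ContDiff ℝ ∞ H) (hH' : ContDiff ℝ ∞ H')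
    (e : ∀ x y, H' (c * x + s * y + v, -s * x + c * y + w) = H (x, y) + h) :
    TransformsAdmitted (motionWithBottom c s v w h) H H' := by
  intro Ω X X' hΩ hX'
  refine ⟨Admitted.of_motion hcs hH hH' e hΩ hX', fun h' => ?_⟩
  have hX : ∀ p ∈ motion c s v w '' Ω,
      X (motion c (-s) (-(c * v - s * w)) (-(s * v + c * w)) p)
        = fderiv ℝ (motion c (-s) (-(c * v - s * w)) (-(s * v + c * w))) p (X' p) := by
    rintro _ ⟨p, hp, rfl⟩
    have hp' : X' (motion c s v w p) = fderiv ℝ (motion c s v w) p (X p) := hX' p hp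
    rw [motion_inverse v w hcs, hp', fderiv_motion, fderiv_motion]
    ext i
    · rfl
    · fin_cases i <;> simp
      · linear_combination -(X p).2 0 * hcs
      · linear_combination -(X p).2 1 * hcs
  have key := Admitted.of_motion (h := -h) (by linear_combination hcs) hH' hH (fun x y => by
    have := e (c * x + -s * y + -(c * v - s * w)) (-(-s) * x + c * y + -(s * v + c * w))
    have e₁ : c * (c * x + -s * y + -(c * v - s * w))
        + s * (-(-s) * x + c * y + -(s * v + c * w)) + v = x := by
      linear_combination (x - v) * hcs
    have e₂ : -s * (c * x + -s * y + -(c * v - s * w))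
        + c * (-(-s) * x + c * y + -(s * v + c * w)) + w = y := by
      linear_combination (y - w) * hcs
    rw [e₁, e₂] at this
    linarith) (isOpen_motion_image v w hcs hΩ) hX h'
  have im : motion c (-s) (-(c * v - s * w)) (-(s * v + c * w)) '' (motion c s v w '' Ω) = Ω := by
    rw [Set.image_image]
    simp only [motion_inverse v w hcs, Set.image_id']
  rwa [im] at key

lemma hasDerivAt_curve {F : ℝ → Base × ℝ} {V : Base × ℝ} {r : ℝ}
    (h₁ : ∀ i, HasDerivAt (fun r => (F r).1.1 i) (V.1.1 i) r)
    (h₂ : ∀ k, HasDerivAt (fun r => (F r).1.2 k) (V.1.2 k) r)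
    (h₃ : HasDerivAt (fun r => (F r).2) V.2 r) : HasDerivAt F V r :=
  ((hasDerivAt_pi.2 h₁).prodMk (hasDerivAt_pi.2 h₂)).prodMk h₃

/-- Rotations, shifts of the positions and shifts of the bottom generate the rigid motions. -/
lemma equivGroup_motion (θ v w h : ℝ) :
    EquivGroup (motionWithBottom (Real.cos θ) (Real.sin θ) v w h) := by
  have hr : EquivGroup (motionWithBottom (Real.cos θ) (Real.sin θ) 0 0 0) := by
    refine EquivGroup.flow _ .rotation
      (fun r => motionWithBottom (Real.cos r) (Real.sin r) 0 0 0) (fun P => ?_) (fun r P => ?_) θ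
    · ext i
      · rfl
      · fin_cases i <;> simp [motionWithBottom, motion]
      · simp [motionWithBottom]
    · refine hasDerivAt_curve (fun i => ?_) (fun k => ?_) (hasDerivAt_const _ _)
      · refine (hasDerivAt_const r (P.1.1 i)).congr_deriv ?_
        fin_cases i <;> rfl
      · have hc := Real.hasDerivAt_cos r
        have hs := Real.hasDerivAt_sin r
        fin_cases k
        · exact (((hc.mul_const (P.1.2 0)).fun_add (hs.mul_const (P.1.2 1))).add_const
            0).congr_deriv (by simp [motionWithBottom, motion])
        · exact (((hs.fun_neg.mul_const (P.1.2 0)).fun_add (hc.mul_const (P.1.2 1))).add_const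
            0).congr_deriv (by simp [motionWithBottom, motion]; ring)
  have hx : EquivGroup (motionWithBottom 1 0 v 0 0) := by
    refine EquivGroup.flow _ .shift_x (fun r => motionWithBottom 1 0 r 0 0) (fun P => ?_)
      (fun r P => ?_) v
    · ext i
      · rfl
      · fin_cases i <;> simp [motionWithBottom, motion]
      · simp [motionWithBottom]
    · refine hasDerivAt_curve (fun i => ?_) (fun k => ?_) (hasDerivAt_const _ _)
      · refine (hasDerivAt_const r (P.1.1 i)).congr_deriv ?_
        fin_cases i <;> rfl
      · fin_cases k
        · exact (hasDerivAt_id r).const_add _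
        · exact hasDerivAt_const r _
  have hy : EquivGroup (motionWithBottom 1 0 0 w 0) := by
    refine EquivGroup.flow _ .shift_y (fun r => motionWithBottom 1 0 0 r 0) (fun P => ?_)
      (fun r P => ?_) w
    · ext i
      · rfl
      · fin_cases i <;> simp [motionWithBottom, motion]
      · simp [motionWithBottom]
    · refine hasDerivAt_curve (fun i => ?_) (fun k => ?_) (hasDerivAt_const _ _)
      · refine (hasDerivAt_const r (P.1.1 i)).congr_deriv ?_
        fin_cases i <;> rfl
      · fin_cases k
        · exact hasDerivAt_const r _
        · exact (hasDerivAt_id r).const_add _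
  have hh : EquivGroup (motionWithBottom 1 0 0 0 h) := by
    refine EquivGroup.flow _ .shift_H (fun r => motionWithBottom 1 0 0 0 r) (fun P => ?_)
      (fun r P => ?_) h
    · ext i
      · rfl
      · fin_cases i <;> simp [motionWithBottom, motion]
      · simp [motionWithBottom]
    · refine hasDerivAt_curve (fun i => ?_) (fun k => ?_) ((hasDerivAt_id r).const_add _)
      · refine (hasDerivAt_const r (P.1.1 i)).congr_deriv ?_
        fin_cases i <;> rfl
      · refine (hasDerivAt_const r _).congr_deriv ?_
        fin_cases k <;> rfl
  convert hh.comp _ _ (hx.comp _ _ (hy.comp _ _ hr)) using 1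
  ext P i
  · rfl
  · fin_cases i <;> simp [motionWithBottom, motion]
  · simp [motionWithBottom]

/-- A rotation by half the argument of `(p - b) + 2 c i` diagonalizes the quadratic form
`p x² + 2 c x y + b y²`; after a further rotation by `π / 2` if necessary, the first eigenvalue is
not zero. -/
lemma exists_diagonal {p c b : ℝ} (hne : ¬ (p = b ∧ c = 0)) : ∃ θ l₁ l₂ : ℝ, l₁ ≠ 0 ∧ l₁ ≠ l₂ ∧
    p = l₁ * Real.cos θ ^ 2 + l₂ * Real.sin θ ^ 2 ∧
    c = (l₁ - l₂) * (Real.cos θ * Real.sin θ) ∧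
    b = l₁ * Real.sin θ ^ 2 + l₂ * Real.cos θ ^ 2 := by
  obtain ⟨θ, l₁, l₂, h12, e₁, e₂, e₃⟩ : ∃ θ l₁ l₂ : ℝ, l₁ ≠ l₂ ∧
      p = l₁ * Real.cos θ ^ 2 + l₂ * Real.sin θ ^ 2 ∧
      c = (l₁ - l₂) * (Real.cos θ * Real.sin θ) ∧
      b = l₁ * Real.sin θ ^ 2 + l₂ * Real.cos θ ^ 2 := by
    set z : ℂ := ⟨p - b, 2 * c⟩ with hz
    have z0 : z ≠ 0 := fun h => hne ⟨by
      have := congrArg Complex.re h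
      simp [hz] at this
      linarith, by
      have := congrArg Complex.im h
      simpa [hz] using this⟩
    have hre : ‖z‖ * Real.cos z.arg = p - b := Complex.norm_mul_cos_arg z
    have him : ‖z‖ * Real.sin z.arg = 2 * c := Complex.norm_mul_sin_arg z
    have ha : z.arg = 2 * (z.arg / 2) := by ring
    rw [ha, Real.cos_two_mul] at hre
    rw [ha, Real.sin_two_mul] at him
    have hcs := Real.sin_sq_add_cos_sq (z.arg / 2)
    refine ⟨z.arg / 2, (p + b + ‖z‖) / 2, (p + b - ‖z‖) / 2, fun h => z0 (norm_eq_zero.1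
      (by linarith)), ?_, ?_, ?_⟩
    · linear_combination -(p + b - ‖z‖) / 2 * hcs - hre / 2
    · linear_combination -him / 2
    · linear_combination -(p + b + ‖z‖) / 2 * hcs + hre / 2
  by_cases h : l₁ = 0
  · refine ⟨θ + Real.pi / 2, l₂, l₁, fun h2 => h12 (h.trans h2.symm), h12.symm, ?_, ?_, ?_⟩ <;>
      rw [Real.cos_add_pi_div_two, Real.sin_add_pi_div_two] <;> linarith
  · exact ⟨θ, l₁, l₂, h, h12, e₁, e₂, e₃⟩

/-- Every quadratic bottom whose quadratic part is not isotropic is moved to one of the two normal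
forms: diagonalize, then complete the squares. -/
theorem exists_normal_form {p c b : ℝ} (q₁ q₂ q₀ : ℝ) (hne : ¬ (p = b ∧ c = 0)) :
    ∃ (T : Base × ℝ → Base × ℝ) (H' : ℝ × ℝ → ℝ), EquivGroup T ∧
      MapsBottom T (quadraticBottom p c b q₁ q₂ q₀) H' ∧
      TransformsAdmitted T (quadraticBottom p c b q₁ q₂ q₀) H' ∧
      ((∃ l₁ l₂ : ℝ, l₁ * l₂ * (l₁ - l₂) ≠ 0 ∧ H' = bottom₁ l₁ l₂) ∨
        (∃ l₁ q : ℝ, l₁ ≠ 0 ∧ H' = bottom₂ l₁ q)) := by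
  obtain ⟨θ, l₁, l₂, hl₁, h12, e₁, e₂, e₃⟩ := exists_diagonal hne
  have hcs : Real.cos θ ^ 2 + Real.sin θ ^ 2 = 1 := Real.cos_sq_add_sin_sq θ
  -- the shift that completes the square in the first rotated variable
  have hv : 2 * l₁ * ((q₁ * Real.cos θ + q₂ * Real.sin θ) / (2 * l₁))
      = q₁ * Real.cos θ + q₂ * Real.sin θ := by field_simp
  have suff : ∀ (v w h : ℝ) (H' : ℝ × ℝ → ℝ), ContDiff ℝ ∞ H' →
      (∀ x y, H' (Real.cos θ * x + Real.sin θ * y + v, -Real.sin θ * x + Real.cos θ * y + w)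
        = quadraticBottom p c b q₁ q₂ q₀ (x, y) + h) →
      EquivGroup (motionWithBottom (Real.cos θ) (Real.sin θ) v w h) ∧
      MapsBottom (motionWithBottom (Real.cos θ) (Real.sin θ) v w h)
        (quadraticBottom p c b q₁ q₂ q₀) H' ∧
      TransformsAdmitted (motionWithBottom (Real.cos θ) (Real.sin θ) v w h)
        (quadraticBottom p c b q₁ q₂ q₀) H' := fun v w h H' hH' e =>
    ⟨equivGroup_motion .., fun P => (e (P.2 0) (P.2 1)).symm,
      transformsAdmitted_motion hcs (contDiff_quadraticBottom ..) hH' e⟩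
  generalize (q₁ * Real.cos θ + q₂ * Real.sin θ) / (2 * l₁) = v at hv
  by_cases hl₂ : l₂ = 0
  · obtain ⟨g₁, g₂, g₃⟩ := suff v 0 (l₁ * v ^ 2 - q₀)
      (bottom₂ l₁ (-q₁ * Real.sin θ + q₂ * Real.cos θ))
      (by rw [bottom₂_eq]; exact contDiff_quadraticBottom ..) fun x y => by
        subst hl₂
        simp only [bottom₂, quadraticBottom, e₁, e₂, e₃]
        linear_combination (Real.cos θ * x + Real.sin θ * y) * hv + (q₁ * x + q₂ * y) * hcs
    exact ⟨_, _, g₁, g₂, g₃, Or.inr ⟨l₁, _, hl₁, rfl⟩⟩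
  · have hw : 2 * l₂ * ((-q₁ * Real.sin θ + q₂ * Real.cos θ) / (2 * l₂))
        = -q₁ * Real.sin θ + q₂ * Real.cos θ := by field_simp
    generalize (-q₁ * Real.sin θ + q₂ * Real.cos θ) / (2 * l₂) = w at hw
    obtain ⟨g₁, g₂, g₃⟩ := suff v w (l₁ * v ^ 2 + l₂ * w ^ 2 - q₀) (bottom₁ l₁ l₂)
      (by rw [bottom₁_eq]; exact contDiff_quadraticBottom ..) fun x y => by
        simp only [bottom₁, quadraticBottom, e₁, e₂, e₃]
        linear_combination (Real.cos θ * x + Real.sin θ * y) * hv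
          + (-Real.sin θ * x + Real.cos θ * y) * hw + (q₁ * x + q₂ * y) * hcs
    exact ⟨_, _, g₁, g₂, g₃, Or.inl ⟨l₁, l₂,
      mul_ne_zero (mul_ne_zero hl₁ hl₂) (sub_ne_zero.2 h12), rfl⟩⟩

end ShallowWater

open ShallowWater in
theorem mainTheorem2 :
    -- the determining equations reduce to the classifying equation
    (∀ (Ω : Set Base), IsOpen Ω → Convex ℝ Ω →
      ∀ H : ℝ × ℝ → ℝ, ContDiffOn ℝ ∞ H (positions Ω) → ∀ X : VField,
        Admitted H Ω X ↔
          ∃ (k₁ k₄ : ℝ) (ζ ζ₁ ζ₂ g : ℝ → ℝ) (ψ : ℝ × ℝ → ℝ),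
            ContDiffOn ℝ ∞ ζ (times Ω) ∧ ContDiffOn ℝ ∞ ζ₁ (times Ω) ∧
            ContDiffOn ℝ ∞ ζ₂ (times Ω) ∧ ContDiffOn ℝ ∞ g (times Ω) ∧
            ContDiffOn ℝ ∞ ψ (labels Ω) ∧
            HasForm Ω X k₁ k₄ ζ ζ₁ ζ₂ ψ ∧
            ∀ p ∈ Ω, ClassifyingEquation H k₁ k₄ ζ ζ₁ ζ₂ g (p.1 0) (p.2 0) (p.2 1)) ∧
    -- the kernel of the admitted Lie algebras
    (∀ (Ω : Set Base), IsOpen Ω → Convex ℝ Ω → ∀ X : VField,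
      (∀ H : ℝ × ℝ → ℝ, ContDiff ℝ ∞ H → Admitted H Ω X) ↔
        ∃ (c : ℝ) (ψ : ℝ × ℝ → ℝ), ContDiffOn ℝ ∞ ψ (labels Ω) ∧
          Set.EqOn X (c • timeShift + relabelling ψ) Ω) ∧
    -- every quadratic bottom with distinct eigenvalues is equivalent to one in the table
    (∀ p c b q₁ q₂ q₀ : ℝ, ¬ (p = b ∧ c = 0) →
      ∃ (T : Base × ℝ → Base × ℝ) (H' : ℝ × ℝ → ℝ), EquivGroup T ∧
        MapsBottom T (quadraticBottom p c b q₁ q₂ q₀) H' ∧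
        TransformsAdmitted T (quadraticBottom p c b q₁ q₂ q₀) H' ∧
        ((∃ l₁ l₂ : ℝ, l₁ * l₂ * (l₁ - l₂) ≠ 0 ∧ H' = bottom₁ l₁ l₂) ∨
          (∃ l₁ q : ℝ, l₁ ≠ 0 ∧ H' = bottom₂ l₁ q))) ∧
    -- first row of the table
    (∀ l₁ l₂ : ℝ, l₁ * l₂ * (l₁ - l₂) ≠ 0 →
      ∀ (Ω : Set Base), IsOpen Ω → Convex ℝ Ω → ∀ X : VField,
        Admitted (bottom₁ l₁ l₂) Ω X ↔
          ∃ (c k : ℝ) (ψ : ℝ × ℝ → ℝ) (ζ₁ ζ₂ : ℝ → ℝ),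
            ContDiffOn ℝ ∞ ψ (labels Ω) ∧ ContDiff ℝ ∞ ζ₁ ∧ ContDiff ℝ ∞ ζ₂ ∧
            (∀ t, iteratedDeriv 2 ζ₁ t = 2 * l₁ * ζ₁ t) ∧
            (∀ t, iteratedDeriv 2 ζ₂ t = 2 * l₂ * ζ₂ t) ∧
            Set.EqOn X
              (c • timeShift + relabelling ψ + k • scaling + translation ζ₁ ζ₂) Ω) ∧
    -- second row of the table
    (∀ l₁ q₂ : ℝ, l₁ ≠ 0 →
      ∀ (Ω : Set Base), IsOpen Ω → Convex ℝ Ω → ∀ X : VField,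
        Admitted (bottom₂ l₁ q₂) Ω X ↔
          ∃ (c k c₁ c₂ : ℝ) (ψ : ℝ × ℝ → ℝ) (ζ₁ : ℝ → ℝ),
            ContDiffOn ℝ ∞ ψ (labels Ω) ∧ ContDiff ℝ ∞ ζ₁ ∧
            (∀ t, iteratedDeriv 2 ζ₁ t = 2 * l₁ * ζ₁ t) ∧
            Set.EqOn X
              (c • timeShift + relabelling ψ + k • scalingPlane q₂
                + c₁ • translation 0 (fun t => t) + c₂ • translation 0 1
                + translation ζ₁ 0) Ω) :=
  ⟨fun _ hΩ hc _ hH X => admitted_iff hΩ hc hH X, fun _ hΩ hc X => forall_admitted_iff hΩ hc X,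
    fun _ _ _ q₁ q₂ q₀ hne => exists_normal_form q₁ q₂ q₀ hne,
    fun _ _ hl _ hΩ hc X => admitted_bottom₁_iff hl hΩ hc X,
    fun _ _ hl _ hΩ hc X => admitted_bottom₂_iff hl hΩ hc X⟩
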